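/- **Conventions.** Let $G$ be a discrete group with identity $e$, let $C^*(G)$ be its full group $C^*$-algebra, identify $s\in G$ with its canonical unitary in $C^*(G)$, and let $\delta_G\colon C^*(G)\to C^*(G)\otimes C^*(G)$ be the homomorphism with $\delta_G(s)=s\otimes s$. All tensor products of $C^*$-algebras are minimal. A *coaction* of $G$ on a $C^*$-algebra $B$ is an injective $*$-homomorphism $\delta\colon B\to B\otimes C^*(G)$ that is nondegenerate (the closed linear span of $\delta(B)(B\otimes C^*(G))$ is $B\otimes C^*(G)$) and satisfies $(\delta\otimes\iota)\circ\delta=(\iota\otimes\delta_G)\circ\delta$; it is *normal* if $(\iota\otimes\lambda)\circ\delta$ is injective, where $\lambda$ is the left regular representation of $G$. Coactions $(B,\delta)$ and $(C,\varepsilon)$ are *isomorphic* if there is a $*$-isomorphism $\theta\colon B\to C$ with $(\theta\otimes\iota)\circ\delta=\varepsilon\circ\theta$. For $s\in G$ put $B_s=\{b\in B:\delta(b)=b\otimes s\}$ and $D_s=\overline{\operatorname{span}}\{bc^*:b,c\in B_s\}$, which is an ideal of $B_e$, and let $p_s$ be the identity of $D_s^{**}$, regarded as a projection in the double dual (enveloping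 von Neumann algebra) $B^{**}$. Put $$M(B_s)=\{m\in p_sB^{**}p_{s^{-1}}: D_sm\cup mD_{s^{-1}}\subset B_s\}.$$ $B_s$ is a left Hilbert $D_s$-module with inner product $\langle x,y\rangle=xy^*$, and so is $D_s$ itself. A *partial representation* of $G$ in a unital $*$-algebra is a family $(m_s)_{s\in G}$ of partial isometries whose range projections commute, with $m_em_e^*=1$, $m_s^*m_s=m_{s^{-1}}m_{s^{-1}}^*$, and such that $m_{st}$ extends $m_sm_t$, i.e. $(m_sm_t)(m_sm_t)^*=(m_sm_t)m_{st}^*$, for all $s,t\in G$. A *partial action* $\alpha$ of $G$ on a $C^*$-algebra $A$ consists of closed two-sided ideals $I_s$ of $A$ and $*$-isomorphisms $\alpha_s\colon I_{s^{-1}}\to I_s$ $(s\in G)$ such that $I_e=A$ and $\alpha_{st}$ extends $\alpha_s\circ\alpha_t$ for all $s,t\in G$. Let $\pi$ be the universal representation of $A$ on a Hilbert space $H$, and for $a\in A$ let $\pi(\bar\alpha_{t^{-1}}(a))$ be the operator on $H$ with $\pi(\alpha_{t^{-1}}(d))\xi\mapsto\pi(\alpha_{t^{-1}}(ad))\xi$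 for $d\in I_t$, $\xi\in H$, that vanishes on $(\pi(I_{t^{-1}})H)^\perp$. For $a\in I_s$ let $am_s$ be the operator on $\ell^2(G,H)$ with $(am_s\,\xi)(t)=\pi(\bar\alpha_{t^{-1}}(a))\,\xi(s^{-1}t)$. The *reduced crossed product* $A\rtimes_{\alpha,r}G$ is the $C^*$-algebra generated by all $am_s$ ($s\in G$, $a\in I_s$), and the *normalised dual coaction* $\hat\alpha^n$ is the unique coaction of $G$ on it with $\hat\alpha^n(am_s)=am_s\otimes s$ for all $s\in G$, $a\in I_s$. **Theorem (Landstad duality for partial actions).** Let $\delta$ be a normal coaction of a discrete group $G$ on a $C^*$-algebra $B$. The following are equivalent: (i) there is a partial action $\alpha$ of $G$ on a $C^*$-algebra $A$ such that $(B,\delta)$ is isomorphic to $(A\rtimes_{\alpha,r}G,\hat\alpha^n)$; (ii) there is a partial representation $m$ of $G$ in $B^{**}$ such that $m_s\in M(B_s)$ and $m_sm_s^*=p_s$ for all $s\in G$; (iii) there are isomorphisms $\psi_s\colon B_s\to D_s$ of left Hilbert $D_s$-modules $(s\in G)$ such that $\psi_{st}(xy)=\psi_s(x\,\psi_t(y))$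 for all $s,t\in G$, $x\in B_s$, $y\in B_t$. -/

import Mathlib

open scoped TensorProduct InnerProductSpace

universe u v

set_option linter.unusedSectionVars false

noncomputable section

/-- A C⋆-seminorm on a complex ⋆-algebra. -/
structure CStarSeminorm (X : Type u) [NonUnitalRing X] [StarRing X] [Module ℂ X] extends
    Seminorm ℂ X where
  mul_le : ∀ x y : X, toFun (x * y) ≤ toFun x * toFun y
  star_mul_self : ∀ x : X, toFun (star x * x) = toFun x ^ 2

namespace CStarSeminorm

section Basic

variable {X : Type u} [NonUnitalRing X] [StarRing X] [Module ℂ X]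

instance : CoeFun (CStarSeminorm X) (fun _ => X → ℝ) := ⟨fun p => p.toSeminorm⟩

theorem map_mul_le (p : CStarSeminorm X) (x y : X) : p (x * y) ≤ p x * p y := p.mul_le x y

theorem map_star_mul_self (p : CStarSeminorm X) (x : X) : p (star x * x) = p x ^ 2 :=
  p.star_mul_self x

theorem le_map_star (p : CStarSeminorm X) (x : X) : p x ≤ p (star x) := by
  rcases (apply_nonneg p.toSeminorm x).eq_or_lt with h | h
  · rw [← h]; exact apply_nonneg p.toSeminorm _
  · have h1 : p x ^ 2 ≤ p (star x) * p x := by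
      rw [← p.map_star_mul_self]; exact p.map_mul_le _ _
    rw [sq] at h1
    exact le_of_mul_le_mul_right h1 h

theorem map_star (p : CStarSeminorm X) (x : X) : p (star x) = p x :=
  le_antisymm (by simpa using p.le_map_star (star x)) (p.le_map_star x)

/-- The C⋆-seminorm `x ↦ ‖f x‖` of a ⋆-homomorphism into a C⋆-algebra. -/
def ofHom {E : Type v} [NonUnitalCStarAlgebra E] (f : X →⋆ₙₐ[ℂ] E) : CStarSeminorm X where
  toSeminorm := Seminorm.of (fun x => ‖f x‖) (fun x y => by rw [map_add]; exact norm_add_le _ _)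
    (fun a x => by rw [map_smul, norm_smul])
  mul_le x y := by
    change ‖f (x * y)‖ ≤ ‖f x‖ * ‖f y‖
    rw [map_mul]; exact norm_mul_le _ _
  star_mul_self x := by
    change ‖f (star x * x)‖ = ‖f x‖ ^ 2
    rw [map_mul, StarHomClass.map_star f, CStarRing.norm_star_mul_self, sq]

@[simp] theorem ofHom_apply {E : Type v} [NonUnitalCStarAlgebra E] (f : X →⋆ₙₐ[ℂ] E) (x : X) :
    ofHom f x = ‖f x‖ := rfl

/-- The pointwise supremum of a pointwise bounded nonempty family of C⋆-seminorms. -/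
def iSup {ι : Type v} [Nonempty ι] (p : ι → CStarSeminorm X)
    (hp : ∀ x, BddAbove (Set.range fun i => p i x)) : CStarSeminorm X where
  toSeminorm := Seminorm.of (fun x => ⨆ i, p i x)
    (fun x y => ciSup_le fun i => (map_add_le_add (p i).toSeminorm x y).trans
      (add_le_add (le_ciSup (hp x) i) (le_ciSup (hp y) i)))
    (fun a x => by
      simp_rw [map_smul_eq_mul]
      rw [Real.mul_iSup_of_nonneg (norm_nonneg a)])
  mul_le x y := ciSup_le fun i => ((p i).map_mul_le x y).trans
      (mul_le_mul (le_ciSup (hp x) i) (le_ciSup (hp y) i) (apply_nonneg (p i).toSeminorm y)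
        ((apply_nonneg (p i).toSeminorm x).trans (le_ciSup (hp x) i)))
  star_mul_self x := by
    change (⨆ i, p i (star x * x)) = (⨆ i, p i x) ^ 2
    have h0 : 0 ≤ ⨆ i, p i x := Real.iSup_nonneg fun i => apply_nonneg (p i).toSeminorm x
    apply le_antisymm
    · refine ciSup_le fun i => ?_
      rw [(p i).map_star_mul_self]
      exact pow_le_pow_left₀ (apply_nonneg (p i).toSeminorm x) (le_ciSup (hp x) i) 2
    · have h1 : 0 ≤ ⨆ i, p i (star x * x) :=
        Real.iSup_nonneg fun i => apply_nonneg (p i).toSeminorm _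
      rw [← Real.le_sqrt h0 h1]
      refine ciSup_le fun i => ?_
      rw [Real.le_sqrt (apply_nonneg (p i).toSeminorm x) h1, ← (p i).map_star_mul_self]
      exact le_ciSup (hp (star x * x)) i

theorem iSup_apply {ι : Type v} [Nonempty ι] (p : ι → CStarSeminorm X)
    (hp : ∀ x, BddAbove (Set.range fun i => p i x)) (x : X) : iSup p hp x = ⨆ i, p i x := rfl

end Basic

section Completion

variable {X : Type u} [NonUnitalRing X] [StarRing X] [Module ℂ X]

/-- The algebra `X`, regarded as a seminormed space under `p`. -/
def Pre (_p : CStarSeminorm X) : Type u := X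

instance (p : CStarSeminorm X) : SeminormedAddCommGroup p.Pre :=
  p.toSeminorm.toAddGroupSeminorm.toSeminormedAddCommGroup

instance (p : CStarSeminorm X) : Module ℂ p.Pre := inferInstanceAs (Module ℂ X)

instance (p : CStarSeminorm X) : NormedSpace ℂ p.Pre where
  norm_smul_le a x := (map_smul_eq_mul p.toSeminorm a x).le

/-- The Hausdorff completion of `X` under the C⋆-seminorm `p`; it is a C⋆-algebra. -/
def Completion (p : CStarSeminorm X) : Type u := UniformSpace.Completion p.Pre

variable (p : CStarSeminorm X)

instance : NormedAddCommGroup p.Completion :=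
  inferInstanceAs (NormedAddCommGroup (UniformSpace.Completion p.Pre))

instance : NormedSpace ℂ p.Completion :=
  inferInstanceAs (NormedSpace ℂ (UniformSpace.Completion p.Pre))

instance : CompleteSpace p.Completion :=
  inferInstanceAs (CompleteSpace (UniformSpace.Completion p.Pre))

/-- The canonical map of `X` into its completion, as a linear map. -/
def toComplₗ : X →ₗ[ℂ] p.Completion where
  toFun x := ((show p.Pre from x : p.Pre) : UniformSpace.Completion p.Pre)
  map_add' x y := UniformSpace.Completion.coe_add (α := p.Pre) x y
  map_smul' a x := UniformSpace.Completion.coe_smul (X := p.Pre) a x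

theorem norm_toComplₗ (x : X) : ‖p.toComplₗ x‖ = p x :=
  UniformSpace.Completion.norm_coe (E := p.Pre) x

theorem denseRange_toComplₗ : DenseRange p.toComplₗ :=
  UniformSpace.Completion.denseRange_coe (α := p.Pre)

@[elab_as_elim]
theorem induction_on {p : CStarSeminorm X} {P : p.Completion → Prop} (a : p.Completion)
    (hc : IsClosed {a | P a}) (h : ∀ x : X, P (p.toComplₗ x)) : P a :=
  UniformSpace.Completion.induction_on (α := p.Pre) a hc h

variable [IsScalarTower ℂ X X] [SMulCommClass ℂ X X] [StarModule ℂ X]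

/-- Left multiplication by an element of `X` on the completion. -/
def leftMul (x : X) : p.Completion →L[ℂ] p.Completion :=
  (p.toComplₗ ∘ₗ LinearMap.mul ℂ X x).extendOfNorm p.toComplₗ

theorem leftMul_bound (x : X) (y : X) :
    ‖(p.toComplₗ ∘ₗ LinearMap.mul ℂ X x) y‖ ≤ p x * ‖p.toComplₗ y‖ := by
  simpa [norm_toComplₗ] using p.map_mul_le x y

theorem leftMul_coe (x y : X) : p.leftMul x (p.toComplₗ y) = p.toComplₗ (x * y) :=
  LinearMap.extendOfNorm_eq p.denseRange_toComplₗ ⟨_, p.leftMul_bound x⟩ y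

/-- Left multiplication, as a linear map from `X` to the bounded operators on the completion. -/
def leftMulₗ : X →ₗ[ℂ] p.Completion →L[ℂ] p.Completion where
  toFun := p.leftMul
  map_add' x y := by
    ext z
    induction z using CStarSeminorm.induction_on with
    | hc => exact isClosed_eq (by fun_prop) (by fun_prop)
    | h z =>
    simp [leftMul_coe, add_mul]
  map_smul' a x := by
    refine ContinuousLinearMap.ext fun z => ?_
    change p.leftMul (a • x) z = a • p.leftMul x z
    induction z using CStarSeminorm.induction_on with
    | hc => exact isClosed_eq (p.leftMul (a • x)).continuous ((p.leftMul x).continuous.const_smul a)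
    | h z => rw [leftMul_coe, leftMul_coe, smul_mul_assoc, map_smul]

theorem leftMulₗ_bound (x : X) : ‖p.leftMulₗ x‖ ≤ 1 * ‖p.toComplₗ x‖ := by
  rw [one_mul, norm_toComplₗ]
  exact LinearMap.opNorm_extendOfNorm_le p.denseRange_toComplₗ (apply_nonneg p.toSeminorm x)
    (p.leftMul_bound x)

/-- Multiplication on the completion, as a bounded bilinear map. -/
def mulL : p.Completion →L[ℂ] p.Completion →L[ℂ] p.Completion :=
  p.leftMulₗ.extendOfNorm p.toComplₗ

theorem mulL_coe (x y : X) : p.mulL (p.toComplₗ x) (p.toComplₗ y) = p.toComplₗ (x * y) := by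
  have h : p.mulL (p.toComplₗ x) = p.leftMulₗ x :=
    LinearMap.extendOfNorm_eq p.denseRange_toComplₗ ⟨_, p.leftMulₗ_bound⟩ x
  rw [h]; exact p.leftMul_coe x y

theorem norm_mulL_le (a b : p.Completion) : ‖p.mulL a b‖ ≤ ‖a‖ * ‖b‖ := by
  have h : ‖p.mulL a‖ ≤ 1 * ‖a‖ :=
    LinearMap.norm_extendOfNorm_apply_le p.denseRange_toComplₗ 1 p.leftMulₗ_bound a
  rw [one_mul] at h
  exact (p.mulL a).le_of_opNorm_le h b

/-- The involution on the completion, as a bounded conjugate-linear map. -/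
def starL : p.Completion →L⋆[ℂ] p.Completion :=
  (p.toComplₗ.comp (starLinearEquiv ℂ (A := X)).toLinearMap).extendOfNorm p.toComplₗ

theorem starL_coe (x : X) : p.starL (p.toComplₗ x) = p.toComplₗ (star x) :=
  LinearMap.extendOfNorm_eq p.denseRange_toComplₗ
    ⟨1, fun y => by simp [norm_toComplₗ, map_star]⟩ x

instance : NonUnitalNormedRing p.Completion where
  mul a b := p.mulL a b
  left_distrib a b c := map_add (p.mulL a) b c
  right_distrib a b c := by
    change p.mulL (a + b) c = p.mulL a c + p.mulL b c
    simp
  zero_mul a := by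
    change p.mulL 0 a = 0
    simp
  mul_zero a := map_zero (p.mulL a)
  mul_assoc a b c := by
    change p.mulL (p.mulL a b) c = p.mulL a (p.mulL b c)
    induction a using CStarSeminorm.induction_on with
    | hc => exact isClosed_eq (by fun_prop) (by fun_prop)
    | h x =>
    induction b using CStarSeminorm.induction_on with
    | hc => exact isClosed_eq (by fun_prop) (by fun_prop)
    | h y =>
    induction c using CStarSeminorm.induction_on with
    | hc => exact isClosed_eq (by fun_prop) (by fun_prop)
    | h z =>
    simp only [mulL_coe, mul_assoc]
  dist_eq := NormedAddCommGroup.dist_eq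
  norm_mul_le a b := p.norm_mulL_le a b

theorem mul_def (a b : p.Completion) : a * b = p.mulL a b := rfl

instance : StarRing p.Completion where
  star a := p.starL a
  star_involutive a := by
    change p.starL (p.starL a) = a
    induction a using CStarSeminorm.induction_on with
    | hc => exact isClosed_eq (by fun_prop) (by fun_prop)
    | h x =>
    simp only [starL_coe, star_star]
  star_mul a b := by
    change p.starL (p.mulL a b) = p.mulL (p.starL b) (p.starL a)
    induction a using CStarSeminorm.induction_on with
    | hc => exact isClosed_eq (by fun_prop) (by fun_prop)
    | h x =>
    induction b using CStarSeminorm.induction_on with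
    | hc => exact isClosed_eq (by fun_prop) (by fun_prop)
    | h y =>
    simp only [starL_coe, mulL_coe, star_mul]
  star_add a b := map_add p.starL a b

theorem star_def (a : p.Completion) : star a = p.starL a := rfl

instance : NonUnitalCStarAlgebra p.Completion where
  norm_mul_self_le a := by
    change ‖a‖ * ‖a‖ ≤ ‖p.mulL (p.starL a) a‖
    induction a using CStarSeminorm.induction_on with
    | hc => exact isClosed_le (by fun_prop) (by fun_prop)
    | h x =>
    simp only [starL_coe, mulL_coe, norm_toComplₗ, map_star_mul_self, sq, le_refl]
  smul_assoc c a b := by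
    change p.mulL (c • a) b = c • p.mulL a b
    simp
  smul_comm c a b := by
    change c • p.mulL a b = p.mulL a (c • b)
    simp
  star_smul c a := map_smulₛₗ p.starL c a

/-- The canonical ⋆-homomorphism of `X` into its completion. -/
def toCompl : X →⋆ₙₐ[ℂ] p.Completion where
  toFun := p.toComplₗ
  map_smul' a x := map_smul p.toComplₗ a x
  map_zero' := map_zero p.toComplₗ
  map_add' x y := map_add p.toComplₗ x y
  map_mul' x y := (p.mulL_coe x y).symm
  map_star' x := (p.starL_coe x).symm

theorem norm_toCompl (x : X) : ‖p.toCompl x‖ = p x := p.norm_toComplₗ x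

theorem denseRange_toCompl : DenseRange p.toCompl := p.denseRange_toComplₗ

section Lift

variable {E : Type v} [NonUnitalCStarAlgebra E] (f : X →⋆ₙₐ[ℂ] E)

/-- The extension to the completion, as a bounded linear map. -/
def liftL : p.Completion →L[ℂ] E :=
  LinearMap.extendOfNorm ({ toFun := f, map_add' := map_add f, map_smul' := map_smul f } : X →ₗ[ℂ] E)
    p.toComplₗ

theorem liftL_coe (hf : ∀ x, ‖f x‖ ≤ p x) (x : X) : p.liftL f (p.toCompl x) = f x :=
  LinearMap.extendOfNorm_eq p.denseRange_toComplₗ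
    ⟨1, fun y => by simpa [norm_toComplₗ] using hf y⟩ x

/-- The extension to the completion of a ⋆-homomorphism that is contractive for `p`. -/
def lift (hf : ∀ x, ‖f x‖ ≤ p x) : p.Completion →⋆ₙₐ[ℂ] E where
  toFun := p.liftL f
  map_smul' a x := map_smul (p.liftL f) a x
  map_zero' := map_zero (p.liftL f)
  map_add' x y := map_add (p.liftL f) x y
  map_mul' a b := by
    induction a using CStarSeminorm.induction_on with
    | hc => exact isClosed_eq (by fun_prop) (by fun_prop)
    | h x =>
    induction b using CStarSeminorm.induction_on with
    | hc => exact isClosed_eq (by fun_prop) (by fun_prop)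
    | h y =>
    change p.liftL f (p.toCompl x * p.toCompl y) =
      p.liftL f (p.toCompl x) * p.liftL f (p.toCompl y)
    rw [← map_mul p.toCompl, p.liftL_coe f hf, p.liftL_coe f hf, p.liftL_coe f hf, map_mul]
  map_star' a := by
    have hs : Continuous fun a : p.Completion => star a := p.starL.continuous
    induction a using CStarSeminorm.induction_on with
    | hc => exact isClosed_eq (by fun_prop) (by fun_prop)
    | h x =>
    change p.liftL f (star (p.toCompl x)) = star (p.liftL f (p.toCompl x))
    rw [← StarHomClass.map_star p.toCompl, p.liftL_coe f hf, p.liftL_coe f hf,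
      StarHomClass.map_star f]

@[simp] theorem lift_toCompl (hf : ∀ x, ‖f x‖ ≤ p x) (x : X) : p.lift f hf (p.toCompl x) = f x := p.liftL_coe f hf x

end Lift

end Completion

end CStarSeminorm

/-! ### The minimal tensor product -/

section SpatialOperator

variable {H K : Type u} [NormedAddCommGroup H] [InnerProductSpace ℂ H] [CompleteSpace H]
  [NormedAddCommGroup K] [InnerProductSpace ℂ K] [CompleteSpace K]

theorem inner_map_map_adjoint (S : H →L[ℂ] H) (T : K →L[ℂ] K) (v w : H ⊗[ℂ] K) :
    ⟪TensorProduct.map (S : H →ₗ[ℂ] H) (T : K →ₗ[ℂ] K) v, w⟫_ℂ =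
      ⟪v, TensorProduct.map ((star S : H →L[ℂ] H) : H →ₗ[ℂ] H)
        ((star T : K →L[ℂ] K) : K →ₗ[ℂ] K) w⟫_ℂ := by
  induction v with
  | zero => simp
  | add v₁ v₂ h₁ h₂ => simp only [map_add, inner_add_left, h₁, h₂]
  | tmul h k =>
    induction w with
    | zero => simp
    | add w₁ w₂ h₁ h₂ => simp only [map_add, inner_add_right, h₁, h₂]
    | tmul h' k' =>
      simp [ContinuousLinearMap.star_eq_adjoint, ContinuousLinearMap.adjoint_inner_right]

theorem norm_map_id_le (S : H →L[ℂ] H) (v : H ⊗[ℂ] K) :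
    ‖TensorProduct.map (S : H →ₗ[ℂ] H) (LinearMap.id : K →ₗ[ℂ] K) v‖ ≤ ‖S‖ * ‖v‖ := by
  have h1 : star S * S ≤ algebraMap ℝ (H →L[ℂ] H) (‖S‖ ^ 2) := by
    have := CStarAlgebra.star_mul_le_algebraMap_norm_sq (a := S)
    exact this
  obtain ⟨R, hR⟩ := CStarAlgebra.nonneg_iff_eq_star_mul_self.mp (sub_nonneg.mpr h1)
  have key : ∀ T : H →L[ℂ] H, ‖TensorProduct.map (T : H →ₗ[ℂ] H) (LinearMap.id : K →ₗ[ℂ] K) v‖ ^ 2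
      = RCLike.re ⟪v, TensorProduct.map ((star T * T : H →L[ℂ] H) : H →ₗ[ℂ] H)
          (LinearMap.id : K →ₗ[ℂ] K) v⟫_ℂ := by
    intro T
    have h2 := inner_map_map_adjoint T (1 : K →L[ℂ] K) v
      (TensorProduct.map (T : H →ₗ[ℂ] H) (LinearMap.id : K →ₗ[ℂ] K) v)
    rw [← inner_self_eq_norm_sq (𝕜 := ℂ)]
    have h3 : ((1 : K →L[ℂ] K) : K →ₗ[ℂ] K) = LinearMap.id := rfl
    rw [star_one, h3, ← LinearMap.comp_apply, ← TensorProduct.map_comp] at h2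
    rw [h2]; rfl
  have h4 : ‖TensorProduct.map (S : H →ₗ[ℂ] H) (LinearMap.id : K →ₗ[ℂ] K) v‖ ^ 2 ≤
      (‖S‖ * ‖v‖) ^ 2 := by
    have h5 := key R
    have h6 : star S * S = algebraMap ℝ (H →L[ℂ] H) (‖S‖ ^ 2) - star R * R := by
      rw [← hR]; abel
    rw [key S, h6]
    have h7 : ((algebraMap ℝ (H →L[ℂ] H) (‖S‖ ^ 2) - star R * R : H →L[ℂ] H) : H →ₗ[ℂ] H) =
        ((‖S‖ ^ 2 : ℝ) : ℂ) • LinearMap.id - ((star R * R : H →L[ℂ] H) : H →ₗ[ℂ] H) := by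
      ext x
      simp [Algebra.algebraMap_eq_smul_one, ← Complex.coe_smul]
    have h8 : TensorProduct.map (((‖S‖ ^ 2 : ℝ) : ℂ) • LinearMap.id -
        ((star R * R : H →L[ℂ] H) : H →ₗ[ℂ] H)) (LinearMap.id : K →ₗ[ℂ] K) =
        TensorProduct.map (((‖S‖ ^ 2 : ℝ) : ℂ) • LinearMap.id) LinearMap.id -
        TensorProduct.map ((star R * R : H →L[ℂ] H) : H →ₗ[ℂ] H) LinearMap.id :=
      LinearMap.rTensor_sub _ _
    have h9 : RCLike.re (((‖S‖ ^ 2 : ℝ) : ℂ) * ⟪v, v⟫_ℂ) = ‖S‖ ^ 2 * RCLike.re ⟪v, v⟫_ℂ :=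
      Complex.re_ofReal_mul _ _
    have h10 : RCLike.re ⟪v, v⟫_ℂ = ‖v‖ ^ 2 := inner_self_eq_norm_sq (𝕜 := ℂ) v
    rw [h7, h8, TensorProduct.map_smul_left, TensorProduct.map_id, LinearMap.sub_apply, LinearMap.smul_apply, LinearMap.id_apply, inner_sub_right, map_sub,
      ← h5, inner_smul_right, h9, h10, mul_pow]
    nlinarith [sq_nonneg ‖TensorProduct.map (R : H →ₗ[ℂ] H) (LinearMap.id : K →ₗ[ℂ] K) v‖]
  exact le_of_sq_le_sq h4 (by positivity)

theorem norm_map_le (S : H →L[ℂ] H) (T : K →L[ℂ] K) (v : H ⊗[ℂ] K) :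
    ‖TensorProduct.map (S : H →ₗ[ℂ] H) (T : K →ₗ[ℂ] K) v‖ ≤ ‖S‖ * ‖T‖ * ‖v‖ := by
  have h1 : TensorProduct.map (S : H →ₗ[ℂ] H) (T : K →ₗ[ℂ] K) v =
      TensorProduct.map (S : H →ₗ[ℂ] H) (LinearMap.id : K →ₗ[ℂ] K)
        (TensorProduct.map (LinearMap.id : H →ₗ[ℂ] H) (T : K →ₗ[ℂ] K) v) := by
    rw [← LinearMap.comp_apply, ← TensorProduct.map_comp]; rfl
  have h2 : ‖TensorProduct.map (LinearMap.id : H →ₗ[ℂ] H) (T : K →ₗ[ℂ] K) v‖ ≤ ‖T‖ * ‖v‖ := by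
    have h3 := norm_map_id_le (K := H) T (TensorProduct.comm ℂ H K v)
    rwa [TensorProduct.map_comm, TensorProduct.norm_comm, TensorProduct.norm_comm] at h3
  rw [h1, mul_assoc]
  exact (norm_map_id_le S _).trans (mul_le_mul_of_nonneg_left h2 (norm_nonneg S))

/-- The Hilbert space tensor product of two Hilbert spaces. -/
def HilbertTensor (H K : Type u) [NormedAddCommGroup H] [InnerProductSpace ℂ H]
    [NormedAddCommGroup K] [InnerProductSpace ℂ K] : Type u :=
  UniformSpace.Completion (H ⊗[ℂ] K)

instance : NormedAddCommGroup (HilbertTensor H K) :=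
  inferInstanceAs (NormedAddCommGroup (UniformSpace.Completion (H ⊗[ℂ] K)))

instance : InnerProductSpace ℂ (HilbertTensor H K) :=
  inferInstanceAs (InnerProductSpace ℂ (UniformSpace.Completion (H ⊗[ℂ] K)))

instance : CompleteSpace (HilbertTensor H K) :=
  inferInstanceAs (CompleteSpace (UniformSpace.Completion (H ⊗[ℂ] K)))

namespace HilbertTensor

/-- The inclusion of the algebraic tensor product. -/
def ofAlg : H ⊗[ℂ] K →ₗ[ℂ] HilbertTensor H K where
  toFun v := (v : UniformSpace.Completion (H ⊗[ℂ] K))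
  map_add' v w := UniformSpace.Completion.coe_add v w
  map_smul' a v := UniformSpace.Completion.coe_smul a v

theorem norm_ofAlg (v : H ⊗[ℂ] K) : ‖ofAlg v‖ = ‖v‖ := UniformSpace.Completion.norm_coe v

theorem inner_ofAlg (v w : H ⊗[ℂ] K) : ⟪ofAlg v, ofAlg w⟫_ℂ = ⟪v, w⟫_ℂ :=
  UniformSpace.Completion.inner_coe v w

theorem denseRange_ofAlg : DenseRange (ofAlg : H ⊗[ℂ] K →ₗ[ℂ] HilbertTensor H K) :=
  UniformSpace.Completion.denseRange_coe

@[elab_as_elim]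
theorem induction_on {P : HilbertTensor H K → Prop} (a : HilbertTensor H K)
    (hc : IsClosed {a | P a}) (h : ∀ v : H ⊗[ℂ] K, P (ofAlg v)) : P a :=
  UniformSpace.Completion.induction_on (α := H ⊗[ℂ] K) a hc h

end HilbertTensor

/-- The bounded operator `S ⊗ T` on the Hilbert space tensor product. -/
def opTensor (S : H →L[ℂ] H) (T : K →L[ℂ] K) : HilbertTensor H K →L[ℂ] HilbertTensor H K :=
  (HilbertTensor.ofAlg ∘ₗ TensorProduct.map (S : H →ₗ[ℂ] H) (T : K →ₗ[ℂ] K)).extendOfNorm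
    HilbertTensor.ofAlg

theorem opTensor_bound (S : H →L[ℂ] H) (T : K →L[ℂ] K) (v : H ⊗[ℂ] K) :
    ‖(HilbertTensor.ofAlg ∘ₗ TensorProduct.map (S : H →ₗ[ℂ] H) (T : K →ₗ[ℂ] K)) v‖ ≤
      ‖S‖ * ‖T‖ * ‖HilbertTensor.ofAlg v‖ := by
  rw [LinearMap.comp_apply, HilbertTensor.norm_ofAlg, HilbertTensor.norm_ofAlg]
  exact norm_map_le S T v

theorem opTensor_ofAlg (S : H →L[ℂ] H) (T : K →L[ℂ] K) (v : H ⊗[ℂ] K) :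
    opTensor S T (HilbertTensor.ofAlg v) =
      HilbertTensor.ofAlg (TensorProduct.map (S : H →ₗ[ℂ] H) (T : K →ₗ[ℂ] K) v) :=
  LinearMap.extendOfNorm_eq HilbertTensor.denseRange_ofAlg ⟨_, opTensor_bound S T⟩ v

theorem opTensor_tmul (S : H →L[ℂ] H) (T : K →L[ℂ] K) (h : H) (k : K) :
    opTensor S T (HilbertTensor.ofAlg (h ⊗ₜ[ℂ] k)) = HilbertTensor.ofAlg (S h ⊗ₜ[ℂ] T k) :=
  opTensor_ofAlg S T _

/-- Bounded operators on the Hilbert space tensor product that agree on elementary tensors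
are equal. -/
theorem HilbertTensor.ext_op {P Q : HilbertTensor H K →L[ℂ] HilbertTensor H K}
    (hPQ : ∀ h k, P (HilbertTensor.ofAlg (h ⊗ₜ[ℂ] k)) = Q (HilbertTensor.ofAlg (h ⊗ₜ[ℂ] k))) :
    P = Q := by
  refine ContinuousLinearMap.ext fun v => ?_
  induction v using HilbertTensor.induction_on with
  | hc => exact isClosed_eq P.continuous Q.continuous
  | h v =>
    induction v with
    | zero => simp
    | add v w hv hw => rw [map_add, map_add, map_add, hv, hw]
    | tmul h k => exact hPQ h k

theorem opTensor_mul (S S' : H →L[ℂ] H) (T T' : K →L[ℂ] K) :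
    opTensor (S * S') (T * T') = opTensor S T * opTensor S' T' :=
  HilbertTensor.ext_op fun h k => by
    rw [mul_apply_eq_comp, opTensor_tmul, opTensor_tmul, opTensor_tmul]; rfl

theorem opTensor_star (S : H →L[ℂ] H) (T : K →L[ℂ] K) :
    opTensor (star S) (star T) = star (opTensor S T) := by
  rw [ContinuousLinearMap.star_eq_adjoint (opTensor S T)]
  refine (ContinuousLinearMap.eq_adjoint_iff _ _).mpr fun x y => ?_
  induction x using HilbertTensor.induction_on with
  | hc => exact isClosed_eq (by fun_prop) (by fun_prop)
  | h x =>
    induction y using HilbertTensor.induction_on with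
    | hc => exact isClosed_eq (by fun_prop) (by fun_prop)
    | h y =>
      rw [opTensor_ofAlg, opTensor_ofAlg, HilbertTensor.inner_ofAlg, HilbertTensor.inner_ofAlg,
        inner_map_map_adjoint, star_star, star_star]

theorem norm_opTensor_le (S : H →L[ℂ] H) (T : K →L[ℂ] K) : ‖opTensor S T‖ ≤ ‖S‖ * ‖T‖ :=
  LinearMap.opNorm_extendOfNorm_le HilbertTensor.denseRange_ofAlg (by positivity)
    (opTensor_bound S T)

/-- `S ⊗ T` as a bilinear expression. -/
def opTensorₗ : (H →L[ℂ] H) →ₗ[ℂ] (K →L[ℂ] K) →ₗ[ℂ]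
    (HilbertTensor H K →L[ℂ] HilbertTensor H K) :=
  LinearMap.mk₂ ℂ opTensor
    (fun S S' T => HilbertTensor.ext_op fun h k => by
      simp [opTensor_tmul, TensorProduct.add_tmul])
    (fun c S T => HilbertTensor.ext_op fun h k => by
      simp only [opTensor_tmul, smul_apply, ← TensorProduct.smul_tmul',
        map_smul])
    (fun S T T' => HilbertTensor.ext_op fun h k => by
      simp [opTensor_tmul, TensorProduct.tmul_add])
    (fun c S T => HilbertTensor.ext_op fun h k => by
      simp [opTensor_tmul, TensorProduct.tmul_smul])

end SpatialOperator

/-- A representation of a C⋆-algebra on a Hilbert space. -/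
structure CStarRep (A : Type u) [NonUnitalCStarAlgebra A] : Type (u + 1) where
  space : Type u
  [normed : NormedAddCommGroup space]
  [inner : InnerProductSpace ℂ space]
  [complete : CompleteSpace space]
  hom : A →⋆ₙₐ[ℂ] (space →L[ℂ] space)

attribute [instance] CStarRep.normed CStarRep.inner CStarRep.complete

section MinTensor

variable {A B A' B' : Type u} [NonUnitalCStarAlgebra A] [NonUnitalCStarAlgebra B]
  [NonUnitalCStarAlgebra A'] [NonUnitalCStarAlgebra B']

instance : Inhabited (CStarRep A) := ⟨{ space := PUnit, hom := 0 }⟩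

/-- The representation `ρ ∘ φ`. -/
def CStarRep.comp (ρ : CStarRep A') (φ : A →⋆ₙₐ[ℂ] A') : CStarRep A :=
  { space := ρ.space, hom := ρ.hom.comp φ }

instance instStarRingTensor : StarRing (A ⊗[ℂ] B) where
  star_mul x y := by
    induction x with
    | zero => simp
    | add x₁ x₂ h₁ h₂ => rw [add_mul, star_add, h₁, h₂, star_add, mul_add]
    | tmul a b =>
      induction y with
      | zero => simp
      | add y₁ y₂ h₁ h₂ => rw [mul_add, star_add, h₁, h₂, star_add, add_mul]
      | tmul a' b' => simp [Algebra.TensorProduct.tmul_mul_tmul]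
  star_add := star_add

/-- The spatial representation `ρ ⊗ σ` of the algebraic tensor product `A ⊙ B` on the Hilbert
space tensor product, `(ρ ⊗ σ)(a ⊗ b) = ρ(a) ⊗ σ(b)`. -/
def spatialRep (ρ : CStarRep A) (σ : CStarRep B) :
    A ⊗[ℂ] B →⋆ₙₐ[ℂ] (HilbertTensor ρ.space σ.space →L[ℂ] HilbertTensor ρ.space σ.space) :=
  let f : A ⊗[ℂ] B →ₗ[ℂ] (HilbertTensor ρ.space σ.space →L[ℂ] HilbertTensor ρ.space σ.space) :=
    TensorProduct.lift (opTensorₗ.compl₁₂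
      ({ toFun := ρ.hom, map_add' := map_add ρ.hom, map_smul' := map_smul ρ.hom } :
        A →ₗ[ℂ] (ρ.space →L[ℂ] ρ.space))
      ({ toFun := σ.hom, map_add' := map_add σ.hom, map_smul' := map_smul σ.hom } :
        B →ₗ[ℂ] (σ.space →L[ℂ] σ.space)))
  have hf : ∀ a b, f (a ⊗ₜ b) = opTensor (ρ.hom a) (σ.hom b) := fun a b => rfl
  { toFun := f
    map_smul' := map_smul f
    map_zero' := map_zero f
    map_add' := map_add f
    map_mul' := fun x y => by
      induction x with
      | zero => simp
      | add x₁ x₂ h₁ h₂ => rw [add_mul, map_add, map_add, h₁, h₂, add_mul]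
      | tmul a b =>
        induction y with
        | zero => simp
        | add y₁ y₂ h₁ h₂ => rw [mul_add, map_add, map_add, h₁, h₂, mul_add]
        | tmul a' b' =>
          rw [Algebra.TensorProduct.tmul_mul_tmul, hf, hf, hf, map_mul, map_mul, opTensor_mul]
    map_star' := fun x => by
      induction x with
      | zero => simp
      | add x₁ x₂ h₁ h₂ => rw [star_add, map_add, map_add, h₁, h₂, star_add]
      | tmul a b =>
        rw [TensorProduct.star_tmul, hf, hf, StarHomClass.map_star ρ.hom,
          StarHomClass.map_star σ.hom, opTensor_star] }

@[simp] theorem spatialRep_tmul (ρ : CStarRep A) (σ : CStarRep B) (a : A) (b : B) :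
    spatialRep ρ σ (a ⊗ₜ b) = opTensor (ρ.hom a) (σ.hom b) := rfl

theorem bddAbove_spatialRep (x : A ⊗[ℂ] B) :
    BddAbove (Set.range fun i : CStarRep A × CStarRep B =>
      CStarSeminorm.ofHom (spatialRep i.1 i.2) x) := by
  suffices h : ∃ C : ℝ, ∀ i : CStarRep A × CStarRep B, ‖spatialRep i.1 i.2 x‖ ≤ C by
    obtain ⟨C, hC⟩ := h
    exact ⟨C, by rintro _ ⟨i, rfl⟩; exact hC i⟩
  induction x with
  | zero => exact ⟨0, fun i => by simp⟩
  | add x y hx hy =>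
    obtain ⟨C, hC⟩ := hx
    obtain ⟨D, hD⟩ := hy
    exact ⟨C + D, fun i => by
      rw [map_add]; exact (norm_add_le _ _).trans (add_le_add (hC i) (hD i))⟩
  | tmul a b =>
    refine ⟨‖a‖ * ‖b‖, fun i => ?_⟩
    rw [spatialRep_tmul]
    exact (norm_opTensor_le _ _).trans (mul_le_mul
      (NonUnitalStarAlgHom.norm_apply_le i.1.hom a) (NonUnitalStarAlgHom.norm_apply_le i.2.hom b)
      (norm_nonneg _) (norm_nonneg _))

variable (A B) in
/-- The minimal (spatial) C⋆-norm on the algebraic tensor product: the supremum of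
`‖(ρ ⊗ σ)(x)‖` over all representations `ρ` of `A` and `σ` of `B`. -/
def minTensorNorm : CStarSeminorm (A ⊗[ℂ] B) :=
  CStarSeminorm.iSup (fun i : CStarRep A × CStarRep B => CStarSeminorm.ofHom (spatialRep i.1 i.2))
    bddAbove_spatialRep

variable (A B) in
/-- The minimal tensor product `A ⊗ B` of two C⋆-algebras. -/
def MinTensor : Type u := (minTensorNorm A B).Completion

namespace MinTensor

instance : NonUnitalCStarAlgebra (MinTensor A B) :=
  inferInstanceAs (NonUnitalCStarAlgebra (minTensorNorm A B).Completion)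

/-- The canonical map of the algebraic tensor product into the minimal one. -/
def ofAlg : A ⊗[ℂ] B →⋆ₙₐ[ℂ] MinTensor A B := (minTensorNorm A B).toCompl

theorem norm_ofAlg (x : A ⊗[ℂ] B) : ‖(ofAlg x : MinTensor A B)‖ = minTensorNorm A B x :=
  (minTensorNorm A B).norm_toCompl x

theorem denseRange_ofAlg : DenseRange (ofAlg : A ⊗[ℂ] B →⋆ₙₐ[ℂ] MinTensor A B) :=
  (minTensorNorm A B).denseRange_toCompl

/-- The elementary tensor `a ⊗ b` in the minimal tensor product. -/
def tmul (a : A) (b : B) : MinTensor A B := ofAlg (a ⊗ₜ[ℂ] b)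

theorem norm_spatialRep_le (ρ : CStarRep A) (σ : CStarRep B) (x : A ⊗[ℂ] B) :
    ‖spatialRep ρ σ x‖ ≤ minTensorNorm A B x :=
  le_ciSup (f := fun i : CStarRep A × CStarRep B => CStarSeminorm.ofHom (spatialRep i.1 i.2) x)
    (bddAbove_spatialRep x) (ρ, σ)

/-- The tensor product `φ ⊗ ψ` of two ⋆-homomorphisms on the algebraic tensor product. -/
def algMap (φ : A →⋆ₙₐ[ℂ] A') (ψ : B →⋆ₙₐ[ℂ] B') : A ⊗[ℂ] B →⋆ₙₐ[ℂ] A' ⊗[ℂ] B' :=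
  let f : A ⊗[ℂ] B →ₗ[ℂ] A' ⊗[ℂ] B' := TensorProduct.map
    ({ toFun := φ, map_add' := map_add φ, map_smul' := map_smul φ } : A →ₗ[ℂ] A')
    ({ toFun := ψ, map_add' := map_add ψ, map_smul' := map_smul ψ } : B →ₗ[ℂ] B')
  have hf : ∀ a b, f (a ⊗ₜ b) = φ a ⊗ₜ ψ b := fun a b => rfl
  { toFun := f
    map_smul' := map_smul f
    map_zero' := map_zero f
    map_add' := map_add f
    map_mul' := fun x y => by
      induction x with
      | zero => simp
      | add x₁ x₂ h₁ h₂ => rw [add_mul, map_add, map_add, h₁, h₂, add_mul]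
      | tmul a b =>
        induction y with
        | zero => simp
        | add y₁ y₂ h₁ h₂ => rw [mul_add, map_add, map_add, h₁, h₂, mul_add]
        | tmul a' b' =>
          rw [Algebra.TensorProduct.tmul_mul_tmul, hf, hf, hf, map_mul, map_mul,
            Algebra.TensorProduct.tmul_mul_tmul]
    map_star' := fun x => by
      induction x with
      | zero => simp
      | add x₁ x₂ h₁ h₂ => rw [star_add, map_add, map_add, h₁, h₂, star_add]
      | tmul a b =>
        rw [TensorProduct.star_tmul, hf, hf, StarHomClass.map_star φ, StarHomClass.map_star ψ,
          TensorProduct.star_tmul] }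

@[simp] theorem algMap_tmul (φ : A →⋆ₙₐ[ℂ] A') (ψ : B →⋆ₙₐ[ℂ] B') (a : A) (b : B) :
    algMap φ ψ (a ⊗ₜ b) = φ a ⊗ₜ ψ b := rfl

theorem spatialRep_algMap (φ : A →⋆ₙₐ[ℂ] A') (ψ : B →⋆ₙₐ[ℂ] B') (ρ : CStarRep A')
    (σ : CStarRep B') (x : A ⊗[ℂ] B) :
    spatialRep ρ σ (algMap φ ψ x) = spatialRep (ρ.comp φ) (σ.comp ψ) x := by
  induction x with
  | zero => rw [map_zero, map_zero, map_zero]; rfl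
  | add x y hx hy => rw [map_add, map_add, map_add, hx, hy]; rfl
  | tmul a b => rfl

theorem minTensorNorm_algMap_le (φ : A →⋆ₙₐ[ℂ] A') (ψ : B →⋆ₙₐ[ℂ] B') (x : A ⊗[ℂ] B) :
    minTensorNorm A' B' (algMap φ ψ x) ≤ minTensorNorm A B x :=
  ciSup_le fun i => by
    rw [CStarSeminorm.ofHom_apply, spatialRep_algMap]
    exact norm_spatialRep_le _ _ x

/-- The tensor product `φ ⊗ ψ : A ⊗ B → A' ⊗ B'` of two ⋆-homomorphisms. -/
def map (φ : A →⋆ₙₐ[ℂ] A') (ψ : B →⋆ₙₐ[ℂ] B') : MinTensor A B →⋆ₙₐ[ℂ] MinTensor A' B' :=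
  (minTensorNorm A B).lift (ofAlg.comp (algMap φ ψ)) fun x => by
    rw [NonUnitalStarAlgHom.comp_apply, norm_ofAlg]
    exact minTensorNorm_algMap_le φ ψ x

@[simp] theorem map_tmul (φ : A →⋆ₙₐ[ℂ] A') (ψ : B →⋆ₙₐ[ℂ] B') (a : A) (b : B) :
    map φ ψ (tmul a b) = tmul (φ a) (ψ b) :=
  (minTensorNorm A B).lift_toCompl _ _ _

theorem tmul_mul_tmul (a a' : A) (b b' : B) :
    tmul a b * tmul a' b' = tmul (a * a') (b * b') := by
  rw [tmul, tmul, ← _root_.map_mul, Algebra.TensorProduct.tmul_mul_tmul, tmul]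

theorem star_tmul (a : A) (b : B) : star (tmul a b) = tmul (star a) (star b) := by
  rw [tmul, tmul, ← StarHomClass.map_star, TensorProduct.star_tmul]

/-- `x ∈ (A ⊗ B) ⊗ C` and `y ∈ A ⊗ (B ⊗ C)` correspond to each other under the canonical
isomorphism `(a ⊗ b) ⊗ c ↦ a ⊗ (b ⊗ c)`, the graph of which is the closed linear span of the
pairs `((a ⊗ b) ⊗ c, a ⊗ (b ⊗ c))`. -/
def AssocRel {C : Type u} [NonUnitalCStarAlgebra C] (x : MinTensor (MinTensor A B) C)
    (y : MinTensor A (MinTensor B C)) : Prop :=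
  (x, y) ∈ (Submodule.span ℂ {z : MinTensor (MinTensor A B) C × MinTensor A (MinTensor B C) |
    ∃ a b c, z = (tmul (tmul a b) c, tmul a (tmul b c))}).topologicalClosure

end MinTensor

end MinTensor

/-! ### The full group C⋆-algebra -/

section GroupCStar

variable {G : Type u} [Group G]

/-- The involution `(∑ c_s s)⋆ = ∑ conj(c_s) s⁻¹` of the group algebra. -/
def groupAlgebraStar : MonoidAlgebra ℂ G →+ MonoidAlgebra ℂ G :=
  (Finsupp.liftAddHom fun s : G =>
    (MonoidAlgebra.singleAddHom (R := ℂ) s⁻¹).comp (starAddEquiv (R := ℂ)).toAddMonoidHom).comp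
    (MonoidAlgebra.coeffAddEquiv (R := ℂ) (M := G)).toAddMonoidHom

theorem groupAlgebraStar_single (s : G) (c : ℂ) :
    groupAlgebraStar (MonoidAlgebra.single s c) = MonoidAlgebra.single s⁻¹ (star c) := by
  simp [groupAlgebraStar]

instance instStarRingGroupAlgebra : StarRing (MonoidAlgebra ℂ G) where
  star := groupAlgebraStar
  star_involutive x := by
    induction x using MonoidAlgebra.induction_linear with
    | zero => simp
    | add x y hx hy => rw [map_add, map_add, hx, hy]
    | single s c => simp [groupAlgebraStar_single]
  star_mul x y := by
    change groupAlgebraStar (x * y) = groupAlgebraStar y * groupAlgebraStar x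
    induction x using MonoidAlgebra.induction_linear with
    | zero => simp
    | add x₁ x₂ h₁ h₂ => rw [add_mul, map_add, map_add, h₁, h₂, mul_add]
    | single s c =>
      induction y using MonoidAlgebra.induction_linear with
      | zero => simp
      | add y₁ y₂ h₁ h₂ => rw [mul_add, map_add, map_add, h₁, h₂, add_mul]
      | single t d =>
        simp [groupAlgebraStar_single, MonoidAlgebra.single_mul_single, mul_comm]
  star_add := map_add groupAlgebraStar

theorem groupAlgebra_star_single (s : G) (c : ℂ) :
    star (MonoidAlgebra.single s c) = MonoidAlgebra.single s⁻¹ (star c) :=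
  groupAlgebraStar_single s c

instance : StarModule ℂ (MonoidAlgebra ℂ G) where
  star_smul c x := by
    induction x using MonoidAlgebra.induction_linear with
    | zero => simp
    | add x y hx hy => rw [smul_add, star_add, hx, hy, star_add, smul_add]
    | single s d => simp [groupAlgebra_star_single]

theorem CStarSeminorm.map_single_le (p : CStarSeminorm (MonoidAlgebra ℂ G)) (s : G) :
    p (MonoidAlgebra.single s 1) ≤ 1 := by
  have h1 := p.map_star_mul_self (MonoidAlgebra.single (1 : G) 1)
  have h2 := p.map_star_mul_self (MonoidAlgebra.single s 1)
  rw [groupAlgebra_star_single, MonoidAlgebra.single_mul_single] at h1 h2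
  simp only [inv_one, mul_one, star_one, inv_mul_cancel] at h1 h2
  have h3 : p (MonoidAlgebra.single (1 : G) 1) ≤ 1 := by
    by_contra h
    push Not at h
    nlinarith
  have h4 : 0 ≤ p (MonoidAlgebra.single s 1) := apply_nonneg p.toSeminorm _
  nlinarith

theorem bddAbove_groupSeminorm (x : MonoidAlgebra ℂ G) :
    BddAbove (Set.range fun p : CStarSeminorm (MonoidAlgebra ℂ G) => p x) := by
  suffices h : ∃ C : ℝ, ∀ p : CStarSeminorm (MonoidAlgebra ℂ G), p x ≤ C by
    obtain ⟨C, hC⟩ := h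
    exact ⟨C, by rintro _ ⟨p, rfl⟩; exact hC p⟩
  induction x using MonoidAlgebra.induction_linear with
  | zero => exact ⟨0, fun p => (map_zero p.toSeminorm).le⟩
  | add x y hx hy =>
    obtain ⟨C, hC⟩ := hx
    obtain ⟨D, hD⟩ := hy
    exact ⟨C + D, fun p => (map_add_le_add p.toSeminorm x y).trans (add_le_add (hC p) (hD p))⟩
  | single s c =>
    refine ⟨‖c‖, fun p => ?_⟩
    have h : MonoidAlgebra.single s c = c • MonoidAlgebra.single s (1 : ℂ) := by simp
    rw [h, map_smul_eq_mul p.toSeminorm]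
    exact mul_le_of_le_one_right (norm_nonneg c) (p.map_single_le s)

instance : Nonempty (CStarSeminorm (MonoidAlgebra ℂ G)) :=
  ⟨CStarSeminorm.ofHom (E := ℂ) 0⟩

variable (G) in
/-- The greatest C⋆-seminorm on the group algebra. -/
def groupMaxNorm : CStarSeminorm (MonoidAlgebra ℂ G) :=
  CStarSeminorm.iSup (fun p : CStarSeminorm (MonoidAlgebra ℂ G) => p) bddAbove_groupSeminorm

variable (G) in
/-- The full group C⋆-algebra `C⋆(G)` of the discrete group `G`: the enveloping C⋆-algebra of the
group algebra. -/
def GroupCStar : Type u := (groupMaxNorm G).Completion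

namespace GroupCStar

instance : NonUnitalCStarAlgebra (GroupCStar G) :=
  inferInstanceAs (NonUnitalCStarAlgebra (groupMaxNorm G).Completion)

/-- The canonical map of the group algebra into `C⋆(G)`. -/
def ofAlg : MonoidAlgebra ℂ G →⋆ₙₐ[ℂ] GroupCStar G := (groupMaxNorm G).toCompl

theorem norm_ofAlg (x : MonoidAlgebra ℂ G) : ‖ofAlg x‖ = groupMaxNorm G x :=
  (groupMaxNorm G).norm_toCompl x

theorem denseRange_ofAlg : DenseRange (ofAlg : MonoidAlgebra ℂ G →⋆ₙₐ[ℂ] GroupCStar G) :=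
  (groupMaxNorm G).denseRange_toCompl

/-- The canonical unitary of `C⋆(G)` that belongs to `s ∈ G`. -/
def of (s : G) : GroupCStar G := ofAlg (MonoidAlgebra.single s 1)

theorem of_mul (s t : G) : of (s * t) = of s * of t := by
  rw [of, of, of, ← map_mul, MonoidAlgebra.single_mul_single, mul_one]

theorem of_inv (s : G) : of s⁻¹ = star (of s) := by
  rw [of, of, ← StarHomClass.map_star, groupAlgebra_star_single, star_one]

variable {E : Type v} [NonUnitalCStarAlgebra E]

/-- The ⋆-homomorphism of the group algebra given by a multiplicative, involution preserving map
of the group. -/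
def algLift (w : G → E) (hmul : ∀ s t, w (s * t) = w s * w t) (hstar : ∀ s, w s⁻¹ = star (w s)) :
    MonoidAlgebra ℂ G →⋆ₙₐ[ℂ] E :=
  { MonoidAlgebra.liftMagma ℂ (⟨w, hmul⟩ : G →ₙ* E) with
    map_star' := fun x => by
      change MonoidAlgebra.liftMagma ℂ (⟨w, hmul⟩ : G →ₙ* E) (star x) =
        star (MonoidAlgebra.liftMagma ℂ (⟨w, hmul⟩ : G →ₙ* E) x)
      induction x using MonoidAlgebra.induction_linear with
      | zero => simp
      | add x y hx hy => rw [star_add, map_add, map_add, hx, hy, star_add]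
      | single s c =>
        rw [groupAlgebra_star_single]
        simp [hstar] }

theorem algLift_single (w : G → E) (hmul : ∀ s t, w (s * t) = w s * w t)
    (hstar : ∀ s, w s⁻¹ = star (w s)) (s : G) :
    algLift w hmul hstar (MonoidAlgebra.single s 1) = w s := by
  change MonoidAlgebra.liftMagma ℂ (⟨w, hmul⟩ : G →ₙ* E) (MonoidAlgebra.single s 1) = w s
  simp

/-- The universal property of `C⋆(G)`: the ⋆-homomorphism with `s ↦ w s`. -/
def lift (w : G → E) (hmul : ∀ s t, w (s * t) = w s * w t) (hstar : ∀ s, w s⁻¹ = star (w s)) :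
    GroupCStar G →⋆ₙₐ[ℂ] E :=
  (groupMaxNorm G).lift (algLift w hmul hstar) fun x =>
    le_ciSup (f := fun p : CStarSeminorm (MonoidAlgebra ℂ G) => p x) (bddAbove_groupSeminorm x)
      (CStarSeminorm.ofHom (algLift w hmul hstar))

@[simp] theorem lift_of (w : G → E) (hmul : ∀ s t, w (s * t) = w s * w t)
    (hstar : ∀ s, w s⁻¹ = star (w s)) (s : G) : lift w hmul hstar (of s) = w s :=
  ((groupMaxNorm G).lift_toCompl _ _ _).trans (algLift_single w hmul hstar s)

/-- The comultiplication `δ_G : C⋆(G) → C⋆(G) ⊗ C⋆(G)`, `s ↦ s ⊗ s`. -/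
def comul : GroupCStar G →⋆ₙₐ[ℂ] MinTensor (GroupCStar G) (GroupCStar G) :=
  lift (fun s => MinTensor.tmul (of s) (of s))
    (fun s t => by rw [MinTensor.tmul_mul_tmul, of_mul])
    (fun s => by rw [MinTensor.star_tmul, of_inv])

end GroupCStar

end GroupCStar

/-! ### Operators on `ℓ²`-sums -/

section L2

variable {ι : Type u} {H : Type v} [NormedAddCommGroup H] [InnerProductSpace ℂ H]

theorem memℓp_comp_equiv (e : ι ≃ ι) {f : ι → H} (hf : Memℓp f 2) : Memℓp (fun i => f (e i)) 2 := by
  rw [memℓp_gen_iff (by simp)] at hf ⊢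
  exact (e.summable_iff (f := fun i => ‖f i‖ ^ (2 : ENNReal).toReal)).mpr hf

/-- The operator `(ξ_i) ↦ (ξ_{e i})` on `ℓ²(ι, H)`. -/
def l2Reindex (e : ι ≃ ι) : lp (fun _ : ι => H) 2 →L[ℂ] lp (fun _ : ι => H) 2 :=
  LinearMap.mkContinuous
    { toFun := fun f => ⟨fun i => f (e i), memℓp_comp_equiv e (lp.memℓp f)⟩
      map_add' := fun _ _ => rfl
      map_smul' := fun _ _ => rfl } 1
    fun f => by
      rw [one_mul, lp.norm_eq_tsum_rpow (by simp), lp.norm_eq_tsum_rpow (by simp)]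
      exact (congrArg (· ^ (1 / (2 : ENNReal).toReal))
        (e.tsum_eq (fun i => ‖f i‖ ^ (2 : ENNReal).toReal))).le

@[simp] theorem l2Reindex_apply (e : ι ≃ ι) (f : lp (fun _ : ι => H) 2) (i : ι) :
    l2Reindex e f i = f (e i) := rfl

end L2

section LeftRegular

variable {G : Type u} [Group G]

/-- The left regular representation on `ℓ²(G)`: `(λ_s ξ)(t) = ξ(s⁻¹ t)`. -/
def leftRegularOp (s : G) : lp (fun _ : G => ℂ) 2 →L[ℂ] lp (fun _ : G => ℂ) 2 :=
  l2Reindex (Equiv.mulLeft s⁻¹)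

theorem leftRegularOp_apply (s : G) (ξ : lp (fun _ : G => ℂ) 2) (t : G) :
    leftRegularOp s ξ t = ξ (s⁻¹ * t) := rfl

/-- The left regular representation of `C⋆(G)`. -/
def leftRegular : GroupCStar G →⋆ₙₐ[ℂ] (lp (fun _ : G => ℂ) 2 →L[ℂ] lp (fun _ : G => ℂ) 2) :=
  GroupCStar.lift leftRegularOp
    (fun s t => by
      ext ξ r
      simp [leftRegularOp_apply, mul_assoc])
    (fun s => by
      rw [ContinuousLinearMap.star_eq_adjoint]
      refine (ContinuousLinearMap.eq_adjoint_iff _ _).mpr fun ξ η => ?_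
      rw [lp.inner_eq_tsum, lp.inner_eq_tsum,
        ← (Equiv.mulLeft s⁻¹).tsum_eq (fun t => ⟪leftRegularOp s⁻¹ ξ t, η t⟫_ℂ)]
      simp [leftRegularOp_apply])

end LeftRegular

/-! ### Coactions and their spectral subspaces -/

namespace MinTensor

variable {A B : Type u} [NonUnitalCStarAlgebra A] [NonUnitalCStarAlgebra B]

theorem add_tmul (a a' : A) (b : B) : tmul (a + a') b = tmul a b + tmul a' b := by
  rw [tmul, TensorProduct.add_tmul, map_add]; rfl

theorem smul_tmul (c : ℂ) (a : A) (b : B) : tmul (c • a) b = c • tmul a b := by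
  rw [tmul, ← TensorProduct.smul_tmul', map_smul]; rfl

theorem norm_tmul_le (a : A) (b : B) : ‖tmul a b‖ ≤ ‖a‖ * ‖b‖ := by
  rw [tmul, norm_ofAlg]
  refine ciSup_le fun i => ?_
  rw [CStarSeminorm.ofHom_apply, spatialRep_tmul]
  exact (norm_opTensor_le _ _).trans (mul_le_mul
    (NonUnitalStarAlgHom.norm_apply_le i.1.hom a) (NonUnitalStarAlgHom.norm_apply_le i.2.hom b)
    (norm_nonneg _) (norm_nonneg _))

/-- The bounded linear map `a ↦ a ⊗ b`. -/
def tmulRight (b : B) : A →L[ℂ] MinTensor A B :=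
  LinearMap.mkContinuous
    { toFun := fun a => tmul a b
      map_add' := fun a a' => add_tmul a a' b
      map_smul' := fun c a => smul_tmul c a b } ‖b‖
    fun a => (norm_tmul_le a b).trans_eq (mul_comm _ _)

end MinTensor

/-- A coaction of the discrete group `G` on the C⋆-algebra `B`. -/
structure Coaction (G B : Type u) [Group G] [NonUnitalCStarAlgebra B] where
  /-- the underlying ⋆-homomorphism `δ : B → B ⊗ C⋆(G)` -/
  hom : B →⋆ₙₐ[ℂ] MinTensor B (GroupCStar G)
  injective : Function.Injective hom
  nondegenerate : (Submodule.span ℂ {z : MinTensor B (GroupCStar G) |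
    ∃ b x, z = hom b * x}).topologicalClosure = ⊤
  /-- the coaction identity `(δ ⊗ ι) ∘ δ = (ι ⊗ δ_G) ∘ δ` -/
  coassoc : ∀ b, MinTensor.AssocRel
    (MinTensor.map hom (NonUnitalStarAlgHom.id ℂ (GroupCStar G)) (hom b))
    (MinTensor.map (NonUnitalStarAlgHom.id ℂ B) GroupCStar.comul (hom b))

namespace Coaction

variable {G B : Type u} [Group G] [NonUnitalCStarAlgebra B] (δ : Coaction G B)

/-- A coaction is normal if `(ι ⊗ λ) ∘ δ` is faithful, `λ` the left regular representation. -/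
def IsNormal : Prop :=
  Function.Injective fun b =>
    MinTensor.map (NonUnitalStarAlgHom.id ℂ B) (leftRegular (G := G)) (δ.hom b)

/-- The spectral subspace `B_s = {b | δ(b) = b ⊗ s}`. -/
def spectral (s : G) : Submodule ℂ B where
  carrier := {b | δ.hom b = MinTensor.tmul b (GroupCStar.of s)}
  add_mem' {b c} hb hc := by
    change δ.hom (b + c) = _
    rw [map_add, hb, hc, MinTensor.add_tmul]
  zero_mem' := by
    change δ.hom 0 = MinTensor.tmulRight (GroupCStar.of s) 0
    rw [map_zero, map_zero]
  smul_mem' c b hb := by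
    change δ.hom (c • b) = _
    rw [map_smul, hb, MinTensor.smul_tmul]

theorem mem_spectral {s : G} {b : B} :
    b ∈ δ.spectral s ↔ δ.hom b = MinTensor.tmul b (GroupCStar.of s) := Iff.rfl

theorem isClosed_spectral (s : G) : IsClosed (δ.spectral s : Set B) := by
  have h : Continuous δ.hom :=
    AddMonoidHomClass.continuous_of_bound δ.hom 1 fun b =>
      (NonUnitalStarAlgHom.norm_apply_le δ.hom b).trans_eq (one_mul _).symm
  exact isClosed_eq h (MinTensor.tmulRight (GroupCStar.of s)).continuous

theorem mul_mem_spectral {s t : G} {x y : B} (hx : x ∈ δ.spectral s) (hy : y ∈ δ.spectral t) :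
    x * y ∈ δ.spectral (s * t) := by
  rw [mem_spectral] at *
  rw [map_mul, hx, hy, MinTensor.tmul_mul_tmul, GroupCStar.of_mul]

theorem star_mem_spectral {s : G} {x : B} (hx : x ∈ δ.spectral s) :
    star x ∈ δ.spectral s⁻¹ := by
  rw [mem_spectral] at *
  rw [StarHomClass.map_star, hx, MinTensor.star_tmul, GroupCStar.of_inv]

/-- `D_s = B_s B_s⋆`, the closed linear span of the products `b c⋆` with `b, c ∈ B_s`. -/
def rangeIdeal (s : G) : Submodule ℂ B :=
  (Submodule.span ℂ {d : B | ∃ b ∈ δ.spectral s, ∃ c ∈ δ.spectral s,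
    d = b * star c}).topologicalClosure

theorem rangeIdeal_le (s : G) : δ.rangeIdeal s ≤ δ.spectral 1 := by
  refine Submodule.topologicalClosure_minimal _ (Submodule.span_le.mpr ?_) (δ.isClosed_spectral 1)
  rintro _ ⟨b, hb, c, hc, rfl⟩
  simpa using δ.mul_mem_spectral hb (δ.star_mem_spectral hc)

theorem mul_rangeIdeal_mem {s t : G} {x d : B} (hx : x ∈ δ.spectral s)
    (hd : d ∈ δ.rangeIdeal t) : x * d ∈ δ.spectral s := by
  simpa using δ.mul_mem_spectral hx (δ.rangeIdeal_le t hd)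

theorem rangeIdeal_mul_mem {s t : G} {x d : B} (hd : d ∈ δ.rangeIdeal t)
    (hx : x ∈ δ.spectral s) : d * x ∈ δ.spectral s := by
  simpa using δ.mul_mem_spectral (δ.rangeIdeal_le t hd) hx

/-- An isomorphism `B_s → D_s` of left Hilbert `D_s`-modules, for the inner products `x y⋆`
on `B_s` and on `D_s`. -/
structure ModuleIso (s : G) where
  equiv : δ.spectral s ≃ₗ[ℂ] δ.rangeIdeal s
  map_module : ∀ (d : δ.rangeIdeal s) (x : δ.spectral s),
    (equiv ⟨(d : B) * x, δ.rangeIdeal_mul_mem d.2 x.2⟩ : B) = d * equiv x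
  map_inner : ∀ x y : δ.spectral s, (equiv x : B) * star (equiv y : B) = x * star (y : B)

end Coaction

/-! ### The universal representation and the double dual -/

section Universal

open scoped ComplexOrder

variable (A : Type u) [NonUnitalCStarAlgebra A] [PartialOrder A] [StarOrderedRing A]

/-- The states of a C⋆-algebra: the positive linear functionals of norm one. -/
def CStarState : Type u :=
  {φ : A →ₚ[ℂ] ℂ // IsLUB {r : ℝ | ∃ a : A, ‖a‖ ≤ 1 ∧ r = ‖φ a‖} 1}

/-- The Hilbert space of the universal representation: the Hilbert space direct sum of the GNS
spaces of all states. -/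
abbrev UniversalSpace : Type u := lp (fun φ : CStarState A => φ.1.GNS) 2

/-- The universal representation: the direct sum of the GNS representations of all states. -/
def universalRep : A →⋆ₙₐ[ℂ] (UniversalSpace A →L[ℂ] UniversalSpace A) where
  toFun a := lp.mapCLM 2 (fun φ : CStarState A => φ.1.gnsNonUnitalStarAlgHom a) (norm_nonneg a)
    fun φ => NonUnitalStarAlgHom.norm_apply_le φ.1.gnsNonUnitalStarAlgHom a
  map_smul' c a := by
    ext ξ φ
    simp
  map_zero' := by
    ext ξ φ
    simp
  map_add' a b := by
    ext ξ φ
    simp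
  map_mul' a b := by
    ext ξ φ
    simp
  map_star' a := by
    rw [ContinuousLinearMap.star_eq_adjoint]
    refine (ContinuousLinearMap.eq_adjoint_iff _ _).mpr fun ξ η => ?_
    rw [lp.inner_eq_tsum, lp.inner_eq_tsum]
    refine tsum_congr fun φ => ?_
    simp only [lp.mapCLM_apply_coe]
    rw [StarHomClass.map_star, ContinuousLinearMap.star_eq_adjoint,
      ContinuousLinearMap.adjoint_inner_left]

/-- The double dual `A⋆⋆`, realized as the enveloping von Neumann algebra: the double commutant
of the image of the universal representation. -/
def doubleDual : StarSubalgebra ℂ (UniversalSpace A →L[ℂ] UniversalSpace A) :=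
  StarSubalgebra.centralizer ℂ (StarSubalgebra.centralizer ℂ (Set.range (universalRep A)) :
    Set (UniversalSpace A →L[ℂ] UniversalSpace A))

variable {A} in
/-- For a C⋆-subalgebra `D` of `A`, the identity of `D⋆⋆` regarded as a projection in `A⋆⋆`: the
orthogonal projection onto the closed linear span of `D` acting on the universal space. -/
def unitProjection (D : Submodule ℂ A) : UniversalSpace A →L[ℂ] UniversalSpace A :=
  (Submodule.span ℂ {η : UniversalSpace A |
    ∃ d ∈ D, ∃ ξ, η = universalRep A d ξ}).topologicalClosure.starProjection

end Universal

/-- A partial representation of a group by partial isometries of a unital ⋆-algebra: the range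
projections commute, `u_e u_e⋆ = 1`, `u_s⋆ u_s = u_{s⁻¹} u_{s⁻¹}⋆`, and `u_{st}` extends
`u_s u_t`, where `v` extends `u` means `u u⋆ = u v⋆`. -/
structure IsPartialRepresentation {G : Type u} [Group G] {R : Type v} [Monoid R] [StarMul R]
    (m : G → R) : Prop where
  partialIsometry : ∀ s, m s * star (m s) * m s = m s
  commute : ∀ s t, Commute (m s * star (m s)) (m t * star (m t))
  one : m 1 * star (m 1) = 1
  inv : ∀ s, star (m s) * m s = m s⁻¹ * star (m s⁻¹)
  extend : ∀ s t, (m s * m t) * star (m s * m t) = (m s * m t) * star (m (s * t))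

namespace Coaction

variable {G B : Type u} [Group G] [NonUnitalCStarAlgebra B] [PartialOrder B] [StarOrderedRing B]
  (δ : Coaction G B)

/-- The projection `p_s ∈ B⋆⋆`, the identity of `D_s⋆⋆`. -/
def proj (s : G) : UniversalSpace B →L[ℂ] UniversalSpace B := unitProjection (δ.rangeIdeal s)

/-- The multiplier bimodule
`M(B_s) = {m ∈ p_s B⋆⋆ p_{s⁻¹} | D_s m ∪ m D_{s⁻¹} ⊆ B_s}`. -/
def multiplierBimodule (s : G) : Set (UniversalSpace B →L[ℂ] UniversalSpace B) :=
  {m | (∃ b ∈ doubleDual B, m = δ.proj s * b * δ.proj s⁻¹) ∧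
    (∀ d ∈ δ.rangeIdeal s, ∃ x ∈ δ.spectral s, universalRep B d * m = universalRep B x) ∧
    (∀ d ∈ δ.rangeIdeal s⁻¹, ∃ x ∈ δ.spectral s, m * universalRep B d = universalRep B x)}

end Coaction

/-! ### Partial actions and reduced crossed products -/

/-- A partial action of a discrete group on a C⋆-algebra. -/
structure PartialAction (G A : Type u) [Group G] [NonUnitalCStarAlgebra A] where
  /-- the closed ideals `D_s` -/
  D : G → NonUnitalStarSubalgebra ℂ A
  isClosed_D : ∀ s, IsClosed (D s : Set A)
  mul_mem_left : ∀ s (a : A), ∀ d ∈ D s, a * d ∈ D s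
  mul_mem_right : ∀ s (a : A), ∀ d ∈ D s, d * a ∈ D s
  /-- the isomorphisms `α_s : D_{s⁻¹} → D_s` -/
  α : ∀ s, D s⁻¹ ≃⋆ₐ[ℂ] D s
  D_one : D 1 = ⊤
  /-- `α_{st}` extends `α_s ∘ α_t` -/
  extend : ∀ s t (a : D t⁻¹) (h : (α t a : A) ∈ D s⁻¹),
    ∃ h' : (a : A) ∈ D (s * t)⁻¹, (α (s * t) ⟨a, h'⟩ : A) = α s ⟨α t a, h⟩

section IdealExtension

variable {A : Type u} [NonUnitalCStarAlgebra A] {H : Type v} [NormedAddCommGroup H]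
  [InnerProductSpace ℂ H] [CompleteSpace H]

theorem exists_idealExtension (I : NonUnitalStarSubalgebra ℂ A) (hI : IsClosed (I : Set A))
    (hmul : ∀ a : A, ∀ d ∈ I, a * d ∈ I) (ρ : I →⋆ₙₐ[ℂ] (H →L[ℂ] H)) (a : A) :
    ∃ T : H →L[ℂ] H, ‖T‖ ≤ ‖a‖ ∧
      (∀ (d : I) (ξ : H), T (ρ d ξ) = ρ ⟨a * d, hmul a d d.2⟩ ξ) ∧
      ∀ ξ : H, (∀ d : I, ρ d ξ = 0) → T ξ = 0 := by
  have := hI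
  let : PartialOrder I := CStarAlgebra.spectralOrder I
  have : StarOrderedRing I := CStarAlgebra.spectralOrderedRing I
  have hl := CStarAlgebra.increasingApproximateUnit I
  have := hl.neBot
  -- the maps `d ⊗ ξ ↦ ρ(d) ξ` and `d ⊗ ξ ↦ ρ(a d) ξ`
  let e : I ⊗[ℂ] H →ₗ[ℂ] H := TensorProduct.lift
    (LinearMap.mk₂ ℂ (fun d ξ => ρ d ξ) (by simp) (by simp) (by simp) (by simp))
  let f : I ⊗[ℂ] H →ₗ[ℂ] H := TensorProduct.lift
    (LinearMap.mk₂ ℂ (fun d ξ => ρ ⟨a * d, hmul a d d.2⟩ ξ)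
      (fun d d' ξ => by
        have : (⟨a * ((d + d' : I) : A), hmul a _ (d + d').2⟩ : I) =
          ⟨a * d, hmul a d d.2⟩ + ⟨a * d', hmul a d' d'.2⟩ := Subtype.ext (by simp [mul_add])
        rw [this, map_add]; rfl)
      (fun c d ξ => by
        have : (⟨a * ((c • d : I) : A), hmul a _ (c • d).2⟩ : I) =
          c • ⟨a * d, hmul a d d.2⟩ := Subtype.ext (mul_smul_comm c a (d : A))
        rw [this, map_smul]; rfl)
      (by simp) (by simp))
  have he : ∀ d ξ, e (d ⊗ₜ ξ) = ρ d ξ := fun d ξ => rfl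
  have hf : ∀ d ξ, f (d ⊗ₜ ξ) = ρ ⟨a * d, hmul a d d.2⟩ ξ := fun d ξ => rfl
  have hρ : Continuous ρ := AddMonoidHomClass.continuous_of_bound ρ 1 fun b => by
    simpa using NonUnitalStarAlgHom.norm_apply_le ρ b
  have hlim : ∀ w, Filter.Tendsto (fun x : I => ρ ⟨a * x, hmul a x x.2⟩ (e w))
      (CStarAlgebra.approximateUnit I) (nhds (f w)) := by
    intro w
    induction w with
    | zero => simp
    | add w₁ w₂ h₁ h₂ =>
      simp only [map_add]
      exact h₁.add h₂
    | tmul d ξ =>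
      have h1 : ∀ x : I, ρ ⟨a * x, hmul a x x.2⟩ (e (d ⊗ₜ ξ)) =
          ρ ⟨a * ((x * d : I) : A), hmul a _ (x * d).2⟩ ξ := by
        intro x
        have : (⟨a * ((x * d : I) : A), hmul a _ (x * d).2⟩ : I) =
          ⟨a * x, hmul a x x.2⟩ * d := Subtype.ext (by simp [mul_assoc])
        rw [this, map_mul, he]; rfl
      simp only [h1, hf]
      have hc : Continuous fun d : I => ρ ⟨a * (d : A), hmul a d d.2⟩ ξ := by
        have : Continuous fun d : I => ρ ⟨a * (d : A), hmul a d d.2⟩ :=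
          hρ.comp (Continuous.subtype_mk (continuous_const.mul continuous_subtype_val) _)
        fun_prop
      exact (hc.tendsto d).comp (hl.tendsto_mul_right d)
  have hbound : ∀ w, ‖f w‖ ≤ ‖a‖ * ‖e w‖ := by
    intro w
    refine le_of_tendsto (hlim w).norm ?_
    filter_upwards [hl.eventually_norm] with x hx
    refine (ContinuousLinearMap.le_opNorm _ _).trans ?_
    gcongr
    refine (NonUnitalStarAlgHom.norm_apply_le ρ _).trans ?_
    change ‖a * (x : A)‖ ≤ ‖a‖
    exact (norm_mul_le _ _).trans (mul_le_of_le_one_right (norm_nonneg a) hx)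
  let E : Submodule ℂ H := (LinearMap.range e).topologicalClosure
  let e' : I ⊗[ℂ] H →ₗ[ℂ] E :=
    e.codRestrict E fun w => Submodule.le_topologicalClosure _ (LinearMap.mem_range_self e w)
  have hdense : DenseRange e' := by
    intro y
    rw [closure_subtype]
    have : (Subtype.val '' Set.range e' : Set H) = (LinearMap.range e : Set H) := by
      ext z
      constructor
      · rintro ⟨_, ⟨w, rfl⟩, rfl⟩; exact ⟨w, rfl⟩
      · rintro ⟨w, rfl⟩; exact ⟨e' w, ⟨w, rfl⟩, rfl⟩
    rw [this]
    exact y.2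
  have hE : IsClosed (E : Set H) := Submodule.isClosed_topologicalClosure _
  have : CompleteSpace E := hE.completeSpace_coe
  have hb' : ∀ w, ‖f w‖ ≤ ‖a‖ * ‖e' w‖ := hbound
  refine ⟨(f.extendOfNorm e').comp E.orthogonalProjectionOnto, ?_, ?_, ?_⟩
  · refine (ContinuousLinearMap.opNorm_comp_le _ _).trans ?_
    calc _ ≤ ‖a‖ * 1 := mul_le_mul
          (LinearMap.opNorm_extendOfNorm_le hdense (norm_nonneg a) hb')
          (Submodule.orthogonalProjectionOnto_norm_le E) (ContinuousLinearMap.opNorm_nonneg _) (norm_nonneg a)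
      _ = ‖a‖ := mul_one _
  · intro d ξ
    have h1 : E.orthogonalProjectionOnto (ρ d ξ) = e' (d ⊗ₜ ξ) :=
      Submodule.orthogonalProjectionOnto_mem_subspace_eq_self (K := E) (e' (d ⊗ₜ ξ))
    rw [ContinuousLinearMap.comp_apply, h1,
      LinearMap.extendOfNorm_eq hdense ⟨_, hb'⟩, hf]
  · intro ξ hξ
    have h1 : ξ ∈ Eᗮ := by
      rw [Submodule.orthogonal_closure, Submodule.mem_orthogonal]
      rintro _ ⟨w, rfl⟩
      induction w with
      | zero => simp
      | add w₁ w₂ h₁ h₂ => rw [map_add, inner_add_left, h₁, h₂, add_zero]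
      | tmul d η =>
        rw [he, ← ContinuousLinearMap.adjoint_inner_right, ← ContinuousLinearMap.star_eq_adjoint,
          ← StarHomClass.map_star, hξ, inner_zero_right]
    rw [ContinuousLinearMap.comp_apply,
      Submodule.orthogonalProjectionOnto_apply_of_mem_orthogonal h1, map_zero]

/-- The extension to `A` of a representation `ρ` of a closed ideal `I`: the operator that is given
by `ρ(d)ξ ↦ ρ(a d)ξ` on the essential subspace of `ρ` and vanishes on its orthogonal complement. -/
def idealExtension (I : NonUnitalStarSubalgebra ℂ A) (hI : IsClosed (I : Set A))
    (hmul : ∀ a : A, ∀ d ∈ I, a * d ∈ I) (ρ : I →⋆ₙₐ[ℂ] (H →L[ℂ] H)) (a : A) : H →L[ℂ] H :=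
  Classical.choose (exists_idealExtension I hI hmul ρ a)

theorem norm_idealExtension_le (I : NonUnitalStarSubalgebra ℂ A) (hI : IsClosed (I : Set A))
    (hmul : ∀ a : A, ∀ d ∈ I, a * d ∈ I) (ρ : I →⋆ₙₐ[ℂ] (H →L[ℂ] H)) (a : A) :
    ‖idealExtension I hI hmul ρ a‖ ≤ ‖a‖ :=
  (Classical.choose_spec (exists_idealExtension I hI hmul ρ a)).1

theorem idealExtension_apply (I : NonUnitalStarSubalgebra ℂ A) (hI : IsClosed (I : Set A))
    (hmul : ∀ a : A, ∀ d ∈ I, a * d ∈ I) (ρ : I →⋆ₙₐ[ℂ] (H →L[ℂ] H)) (a : A) (d : I) (ξ : H) :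
    idealExtension I hI hmul ρ a (ρ d ξ) = ρ ⟨a * d, hmul a d d.2⟩ ξ :=
  (Classical.choose_spec (exists_idealExtension I hI hmul ρ a)).2.1 d ξ

theorem idealExtension_eq_zero (I : NonUnitalStarSubalgebra ℂ A) (hI : IsClosed (I : Set A))
    (hmul : ∀ a : A, ∀ d ∈ I, a * d ∈ I) (ρ : I →⋆ₙₐ[ℂ] (H →L[ℂ] H)) (a : A) (ξ : H)
    (hξ : ∀ d : I, ρ d ξ = 0) : idealExtension I hI hmul ρ a ξ = 0 :=
  (Classical.choose_spec (exists_idealExtension I hI hmul ρ a)).2.2 ξ hξ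

end IdealExtension

theorem starHom_ext_of_adjoin {R : Type u} {C : Type v} [NonUnitalCStarAlgebra R]
    [NonUnitalCStarAlgebra C] (S : Set R)
    (f g : (NonUnitalStarAlgebra.adjoin ℂ S).topologicalClosure →⋆ₙₐ[ℂ] C)
    (hf : Continuous f) (hg : Continuous g)
    (h : ∀ x ∈ S, ∀ hx, f ⟨x, hx⟩ = g ⟨x, hx⟩) : f = g := by
  have hsub : ∀ {x}, x ∈ NonUnitalStarAlgebra.adjoin ℂ S →
      x ∈ (NonUnitalStarAlgebra.adjoin ℂ S).topologicalClosure := fun hx => subset_closure hx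
  have key : ∀ x (hx : x ∈ NonUnitalStarAlgebra.adjoin ℂ S),
      f ⟨x, hsub hx⟩ = g ⟨x, hsub hx⟩ := by
    intro x hx
    induction hx using NonUnitalStarAlgebra.adjoin_induction with
    | mem x hx => exact h x hx _
    | add x y hx hy h₁ h₂ =>
      exact (map_add f ⟨x, hsub hx⟩ ⟨y, hsub hy⟩).trans
        ((congrArg₂ (· + ·) h₁ h₂).trans (map_add g ⟨x, hsub hx⟩ ⟨y, hsub hy⟩).symm)
    | zero => exact (map_zero f).trans (map_zero g).symm
    | mul x y hx hy h₁ h₂ =>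
      exact (map_mul f ⟨x, hsub hx⟩ ⟨y, hsub hy⟩).trans
        ((congrArg₂ (· * ·) h₁ h₂).trans (map_mul g ⟨x, hsub hx⟩ ⟨y, hsub hy⟩).symm)
    | smul c x hx h₁ =>
      exact (map_smul f c ⟨x, hsub hx⟩).trans
        ((congrArg (c • ·) h₁).trans (map_smul g c ⟨x, hsub hx⟩).symm)
    | star x hx h₁ =>
      exact (map_star f ⟨x, hsub hx⟩).trans
        ((congrArg star h₁).trans (map_star g ⟨x, hsub hx⟩).symm)
  have hd : Dense {x : (NonUnitalStarAlgebra.adjoin ℂ S).topologicalClosure |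
      (x : R) ∈ NonUnitalStarAlgebra.adjoin ℂ S} := by
    intro y
    refine closure_subtype.mpr (closure_mono ?_ y.2)
    intro z hz
    exact ⟨⟨z, hsub hz⟩, hz, rfl⟩
  exact DFunLike.coe_injective (Continuous.ext_on hd hf hg fun y hy => key _ hy)

namespace PartialAction

variable {G A : Type u} [Group G] [NonUnitalCStarAlgebra A] [PartialOrder A] [StarOrderedRing A]
  (P : PartialAction G A)

/-- The representation `π ∘ α_t⁻¹` of the ideal `D_t`, `π` the universal representation of `A`. -/
def twistedRep (t : G) : P.D t →⋆ₙₐ[ℂ] (UniversalSpace A →L[ℂ] UniversalSpace A) where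
  toFun d := universalRep A ((P.α t).symm d : P.D t⁻¹)
  map_smul' c d := by simp
  map_zero' := by simp
  map_add' d d' := by simp
  map_mul' d d' := by simp
  map_star' d := by simp [map_star]

/-- The operator `π(ᾱ_{t⁻¹}(a))`, where `ᾱ_{t⁻¹} : A → M(D_{t⁻¹})` is the canonical extension of
`α_{t⁻¹} : D_t → D_{t⁻¹}`. -/
def extendedOp (t : G) (a : A) : UniversalSpace A →L[ℂ] UniversalSpace A :=
  idealExtension (P.D t) (P.isClosed_D t) (P.mul_mem_left t) (P.twistedRep t) a

/-- The Hilbert space `H ⊗ ℓ²(G) = ℓ²(G, H)` of the regular representation. -/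
abbrev RegularSpace (_P : PartialAction G A) : Type u := lp (fun _ : G => UniversalSpace A) 2

/-- The value `∑_t ᾱ_{t⁻¹}(a) ⊗ χ_t λ_s` of the regular representation at `a m_s`, that is, the
operator `(T ξ)(t) = π(ᾱ_{t⁻¹}(a)) ξ(s⁻¹ t)`. -/
def regularOp (s : G) (a : A) : P.RegularSpace →L[ℂ] P.RegularSpace :=
  (lp.mapCLM 2 (fun t : G => P.extendedOp t a) (norm_nonneg a)
    fun _ => norm_idealExtension_le _ _ _ _ a).comp (l2Reindex (Equiv.mulLeft s⁻¹))

theorem regularOp_apply (s : G) (a : A) (ξ : P.RegularSpace) (t : G) :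
    P.regularOp s a ξ t = P.extendedOp t a (ξ (s⁻¹ * t)) := rfl

/-- The C⋆-algebra generated by the operators `a m_s`, `a ∈ D_s`, in the regular representation. -/
def reducedAlgebra : NonUnitalStarSubalgebra ℂ (P.RegularSpace →L[ℂ] P.RegularSpace) :=
  (NonUnitalStarAlgebra.adjoin ℂ
    {T : P.RegularSpace →L[ℂ] P.RegularSpace | ∃ s, ∃ a ∈ P.D s, T = P.regularOp s a}).topologicalClosure

instance : IsClosed (P.reducedAlgebra : Set (P.RegularSpace →L[ℂ] P.RegularSpace)) :=
  NonUnitalStarSubalgebra.isClosed_topologicalClosure _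

/-- The reduced crossed product `A ⋊_{α,r} G`. -/
def ReducedCrossedProduct : Type u := P.reducedAlgebra

instance : NonUnitalCStarAlgebra P.ReducedCrossedProduct :=
  NonUnitalStarSubalgebra.nonUnitalCStarAlgebra P.reducedAlgebra

/-- The inclusion of the reduced crossed product in the bounded operators. -/
def inclusion : P.ReducedCrossedProduct →⋆ₙₐ[ℂ] (P.RegularSpace →L[ℂ] P.RegularSpace) :=
  NonUnitalStarSubalgebraClass.subtype P.reducedAlgebra

/-- The element `a m_s` of the reduced crossed product, for `a ∈ D_s`. -/
def generator (s : G) (a : P.D s) : P.ReducedCrossedProduct :=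
  ⟨P.regularOp s a, subset_closure (NonUnitalStarAlgebra.subset_adjoin ℂ _ ⟨s, a, a.2, rfl⟩)⟩

/-- The normalized dual coaction is the (unique) coaction of `G` on the reduced crossed product
with `a m_s ↦ a m_s ⊗ s` for `a ∈ D_s`. -/
def IsNormalizedDualCoaction (ε : Coaction G P.ReducedCrossedProduct) : Prop :=
  ∀ (s : G) (a : P.D s),
    ε.hom (P.generator s a) = MinTensor.tmul (P.generator s a) (GroupCStar.of s)

/-- There is at most one normalized dual coaction. -/
theorem IsNormalizedDualCoaction.unique {ε ε' : Coaction G P.ReducedCrossedProduct}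
    (h : P.IsNormalizedDualCoaction ε) (h' : P.IsNormalizedDualCoaction ε') :
    ε.hom = ε'.hom := by
  have hcont : ∀ e : Coaction G P.ReducedCrossedProduct, Continuous e.hom := fun e =>
    AddMonoidHomClass.continuous_of_bound e.hom 1 fun b =>
      (NonUnitalStarAlgHom.norm_apply_le e.hom b).trans_eq (one_mul _).symm
  refine starHom_ext_of_adjoin _ ε.hom ε'.hom (hcont ε) (hcont ε') ?_
  rintro _ ⟨s, a, ha, rfl⟩ hT
  exact (h s ⟨a, ha⟩).trans (h' s ⟨a, ha⟩).symm

end PartialAction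

/-- An isomorphism of coactions: a ⋆-isomorphism `θ` with `(θ ⊗ ι) ∘ δ = ε ∘ θ`. -/
def Coaction.IsIso {G B C : Type u} [Group G] [NonUnitalCStarAlgebra B] [NonUnitalCStarAlgebra C]
    (δ : Coaction G B) (ε : Coaction G C) (θ : B ≃⋆ₐ[ℂ] C) : Prop :=
  ∀ b, MinTensor.map (θ : B →⋆ₙₐ[ℂ] C) (NonUnitalStarAlgHom.id ℂ (GroupCStar G)) (δ.hom b) =
    ε.hom (θ b)

end

/-! ### Approximate units and the universal representation -/

section ApproximateUnit

variable {B : Type u} [NonUnitalCStarAlgebra B]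

/-! The guiding picture is `B_s = D_s m_s = m_s D_{s⁻¹}` inside the double dual. (ii) ⟺ (iii). A
multiplier `m_s` with range projection `p_s` and source projection `p_{s⁻¹}` trivialises the fibre:
`x ↦ x m_s⋆` carries `B_s` onto `D_s`, preserves `x y⋆`, and has inverse `d ↦ d m_s`. Conversely
`ψ_s` recovers `m_s` as the partial isometry `x⋆h ↦ ψ_s(x)⋆h`, which is well defined because `⟨x⋆h,
y⋆k⟩ = ⟨h, x y⋆ k⟩` involves only the module inner product. Under this dictionary the statement that
`m_{st}` extends `m_s m_t`, tested against `B_s B_t`, reads `x y m_{st}⋆ = x (y m_t⋆) m_s⋆`, which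
is multiplicativity of `ψ`. See `exists_moduleIso_of_partialRepresentation` and
`exists_partialRepresentation_of_moduleIso`.

(i) ⟹ (iii). The spectral subspaces of a reduced crossed product are exactly the sets of `a m_s`
with `a ∈ I_s` (`mem_spectral_iff_exists_generator`), and `a m_s ↦ a m_e` is the required family
(`IsIso.exists_isMultiplicative`).

(iii) ⟹ (i). The action should be `α_s(c) = m_s c m_s⋆`. To express it by `ψ` alone, write `n = d
m_s = m_s c`; then `d = ψ_s(n)` and `c⋆ = ψ_{s⁻¹}(n⋆)`, and this is the relation `ActionRel`. The
pairs `(x, ψ_s(x) m_s)` span a ⋆-algebra in the product of `B` and the crossed product. Its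
projections are dense, and the conditional expectations of the two sides onto the unit fibre agree
on it. Both expectations are faithful, and a faithful positive map determines the norm
(`norm_le_of_faithful_positive`), so paired elements have equal norm and the graph extends to an
isomorphism.

Normality enters through Fourier coefficients. Slicing `δ(b)` by the matrix coefficients of `λ`
gives elements `E_s(b) ∈ B_s`, which are the matrix entries of `(ρ ⊗ λ)δ(b)`. Hence for normal `δ`
they separate points, `E_e` is faithful, and the spectral subspaces span a dense subspace
(`mem_closure_span_spectral`). -/

theorem mem_closure_mul_of_star_mul_self_mem (I : NonUnitalStarSubalgebra ℂ B)
    (hI : IsClosed (I : Set B)) {x : B} (hx : star x * x ∈ I) :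
    x ∈ closure {y | ∃ e ∈ I, y = x * e} := by
  have := hI
  let : PartialOrder I := CStarAlgebra.spectralOrder I
  have : StarOrderedRing I := CStarAlgebra.spectralOrderedRing I
  have hl := CStarAlgebra.increasingApproximateUnit I
  have := hl.neBot
  let y : I := ⟨star x * x, hx⟩
  have hy : Filter.Tendsto (fun e : I => ‖y - y * e‖ + ‖y - y * e‖)
      (CStarAlgebra.approximateUnit I) (nhds 0) := by
    have h1 : Filter.Tendsto (fun e : I => y - y * e) (CStarAlgebra.approximateUnit I)
        (nhds (y - y)) := tendsto_const_nhds.sub (hl.tendsto_mul_left y)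
    rw [sub_self] at h1
    simpa using h1.norm.add h1.norm
  have hle : ∀ᶠ e : I in CStarAlgebra.approximateUnit I,
      ‖x - x * e‖ ^ 2 ≤ ‖y - y * e‖ + ‖y - y * e‖ := by
    filter_upwards [hl.eventually_norm] with e he
    have h2 : star (x - x * (e : B)) * (x - x * (e : B)) =
        ((y - y * e : I) : B) - star (e : B) * ((y - y * e : I) : B) := by
      simp only [y, AddSubgroupClass.coe_sub, NonUnitalStarSubalgebra.coe_mul, star_sub, star_mul]
      noncomm_ring
    rw [sq, ← CStarRing.norm_star_mul_self, h2]
    refine (norm_sub_le _ _).trans (add_le_add le_rfl ((norm_mul_le _ _).trans ?_))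
    rw [norm_star]
    exact mul_le_of_le_one_left (norm_nonneg _) he
  have h3 : Filter.Tendsto (fun e : I => ‖x - x * e‖ ^ 2) (CStarAlgebra.approximateUnit I)
      (nhds 0) :=
    squeeze_zero' (Filter.Eventually.of_forall fun e => sq_nonneg _) hle hy
  have h4 : Filter.Tendsto (fun e : I => x * (e : B)) (CStarAlgebra.approximateUnit I)
      (nhds x) := by
    rw [tendsto_iff_norm_sub_tendsto_zero]
    have h5 := h3.sqrt
    simp only [Real.sqrt_sq (norm_nonneg _), Real.sqrt_zero] at h5
    simpa only [norm_sub_rev] using h5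
  exact mem_closure_of_tendsto h4 (Filter.Eventually.of_forall fun e => ⟨e, e.2, rfl⟩)

/-- An approximate unit of `I` satisfies `‖x - x e‖² ≤ 2 ‖x⋆x - x⋆x e‖ → 0`. A closed condition on
`x` therefore need only be checked on the products `x e`, which does the work of a factorisation
theorem throughout. -/
theorem mem_of_mul_mem_of_star_mul_self_mem (I : NonUnitalStarSubalgebra ℂ B)
    (hI : IsClosed (I : Set B)) {x : B} (hx : star x * x ∈ I) {S : Set B} (hS : IsClosed S)
    (h : ∀ e ∈ I, x * e ∈ S) : x ∈ S := by
  refine closure_minimal ?_ hS (mem_closure_mul_of_star_mul_self_mem I hI hx)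
  rintro _ ⟨e, he, rfl⟩
  exact h e he

theorem mem_of_mul_mem_of_mul_star_self_mem (I : NonUnitalStarSubalgebra ℂ B)
    (hI : IsClosed (I : Set B)) {x : B} (hx : x * star x ∈ I) {S : Set B} (hS : IsClosed S)
    (h : ∀ e ∈ I, e * x ∈ S) : x ∈ S := by
  have := mem_of_mul_mem_of_star_mul_self_mem I hI (x := star x) (by simpa using hx)
    (S := star ⁻¹' S) (hS.preimage continuous_star)
    (fun e he => by simpa using h (star e) (star_mem he))
  simpa using this

end ApproximateUnit

section UniversalRep

open scoped ComplexOrder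

variable {A : Type u} [NonUnitalCStarAlgebra A] [PartialOrder A] [StarOrderedRing A]

/-- Hahn–Banach separates `-c` from the closed cone of positive elements. -/
theorem exists_positive_functional_ne_zero {c : A} (hc : 0 ≤ c) (hc0 : c ≠ 0) :
    ∃ φ : A →ₚ[ℂ] ℂ, φ c ≠ 0 := by
  have : OrderClosedTopology A := inferInstance
  have hn : -c ∉ ProperCone.positive ℝ A := by
    intro h
    exact hc0 (le_antisymm (by simpa using h) hc)
  obtain ⟨f, hf, hfc⟩ := ProperCone.hyperplane_separation_point _ hn
  -- The separating functional is only real linear and uncontrolled on skew-adjoint elements;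
  -- precomposing with the real part makes its complexification real, and equal to `f`, on
  -- self-adjoint elements.
  let g : A →ₗ[ℝ] ℝ := f.toLinearMap ∘ₗ (selfAdjoint.submodule ℝ A).subtype ∘ₗ realPart
  have hg : ∀ x : A, IsSelfAdjoint x → g x = f x := fun x hx => by
    change f (realPart x : A) = f x
    rw [hx.coe_realPart]
  have hgI : ∀ x : A, IsSelfAdjoint x → g (Complex.I • x) = 0 := fun x hx => by
    change f (realPart (Complex.I • x) : A) = 0
    rw [realPart_I_smul, hx.imaginaryPart]
    simp
  have hφ : ∀ x : A, IsSelfAdjoint x → (Module.Dual.extendRCLike (𝕜 := ℂ) g) x = (f x : ℂ) := fun x hx => by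
    rw [Module.Dual.extendRCLike_apply, hg x hx]
    change (f x : ℂ) - Complex.I * ((g (Complex.I • x) : ℝ) : ℂ) = _
    rw [hgI x hx]
    simp
  refine ⟨PositiveLinearMap.mk₀ (Module.Dual.extendRCLike (𝕜 := ℂ) g) fun x hx => ?_, ?_⟩
  · rw [hφ x (.of_nonneg hx)]
    exact_mod_cast hf x (by simpa using hx)
  · change (Module.Dual.extendRCLike (𝕜 := ℂ) g) c ≠ 0
    rw [hφ c (.of_nonneg hc)]
    rw [map_neg] at hfc
    exact_mod_cast (by linarith : (0 : ℝ) < f c).ne'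

theorem exists_state_ne_zero {c : A} (hc : 0 ≤ c) (hc0 : c ≠ 0) :
    ∃ φ : CStarState A, φ.1 c ≠ 0 := by
  obtain ⟨φ, hφ⟩ := exists_positive_functional_ne_zero hc hc0
  obtain ⟨C, hC⟩ := φ.exists_norm_apply_le
  let S : Set ℝ := {r : ℝ | ∃ a : A, ‖a‖ ≤ 1 ∧ r = ‖φ a‖}
  have hne : S.Nonempty := ⟨0, 0, by simp, by simp⟩
  have hbd : BddAbove S := by
    refine ⟨C, ?_⟩
    rintro _ ⟨a, ha, rfl⟩
    exact (hC a).trans (mul_le_of_le_one_right C.2 ha)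
  have hlub := isLUB_csSup hne hbd
  have hpos : 0 < sSup S := by
    have hcn : 0 < ‖c‖ := norm_pos_iff.mpr hc0
    -- The normalised element `c / ‖c‖` of the unit ball shows that the functional has positive
    -- norm.
    refine lt_of_lt_of_le ?_ (hlub.1 ⟨((‖c‖⁻¹ : ℝ) : ℂ) • c, ?_, rfl⟩)
    · rw [map_smul]
      exact norm_pos_iff.mpr (smul_ne_zero (by simpa using hc0) hφ)
    · rw [norm_smul]
      simp [hcn.ne']
  have hinv : (0 : ℂ) ≤ (((sSup S)⁻¹ : ℝ) : ℂ) := by exact_mod_cast (inv_pos.mpr hpos).le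
  refine ⟨⟨PositiveLinearMap.mk₀ ((((sSup S)⁻¹ : ℝ) : ℂ) • φ.toLinearMap) fun x hx => ?_, ?_⟩, ?_⟩
  · exact mul_nonneg hinv (φ.map_nonneg hx)
  · have hval : ∀ a, ‖(PositiveLinearMap.mk₀ ((((sSup S)⁻¹ : ℝ) : ℂ) • φ.toLinearMap)
        fun x hx => mul_nonneg hinv (φ.map_nonneg hx)) a‖ = (sSup S)⁻¹ * ‖φ a‖ := fun a => by
      change ‖(((sSup S)⁻¹ : ℝ) : ℂ) • φ a‖ = _
      rw [norm_smul, Complex.norm_real, Real.norm_of_nonneg (inv_pos.mpr hpos).le]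
    refine ⟨?_, fun b hb => ?_⟩
    · rintro _ ⟨a, ha, rfl⟩
      rw [hval, inv_mul_le_iff₀ hpos, mul_one]
      exact hlub.1 ⟨a, ha, rfl⟩
    · have : sSup S ≤ sSup S * b := hlub.2 (by
        rintro _ ⟨a, ha, rfl⟩
        rw [← inv_mul_le_iff₀ hpos, ← hval]
        exact hb ⟨a, ha, rfl⟩)
      exact le_of_mul_le_mul_left (by simpa using this) hpos
  · change (((sSup S)⁻¹ : ℝ) : ℂ) • φ c ≠ 0
    exact smul_ne_zero (by simpa using hpos.ne') hφ

open scoped Classical in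
theorem universalRep_apply_single (a : A) (φ : CStarState A) (ξ : φ.1.GNS) :
    universalRep A a (lp.single 2 φ ξ) = lp.single 2 φ (φ.1.gnsNonUnitalStarAlgHom a ξ) := by
  ext χ
  change χ.1.gnsNonUnitalStarAlgHom a ((lp.single 2 φ ξ : UniversalSpace A) χ) = _
  rcases eq_or_ne χ φ with rfl | h
  · simp
  · rw [lp.single_apply_ne _ _ _ h, lp.single_apply_ne _ _ _ h, map_zero]

variable (A) in
-- There need be no unit and hence no ready cyclic vector, so the GNS vector of `a⋆` is used: the
-- squared norm of its image under `a` is `φ((a a⋆)⋆(a a⋆))`, and some state is nonzero there when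
-- `a ≠ 0`.
theorem universalRep_injective : Function.Injective (universalRep A) := by
  classical
  rw [injective_iff_map_eq_zero]
  intro a ha
  by_contra h0
  have h1 : a * star a ≠ 0 := by rwa [Ne, CStarRing.mul_star_self_eq_zero_iff]
  have h2 : star (a * star a) * (a * star a) ≠ 0 := by
    rwa [Ne, CStarRing.star_mul_self_eq_zero_iff]
  obtain ⟨φ, hφ⟩ := exists_state_ne_zero (star_mul_self_nonneg (a * star a)) h2
  have h4 := universalRep_apply_single a φ ((φ.1.toPreGNS (star a) : φ.1.PreGNS) : φ.1.GNS)
  rw [ha, PositiveLinearMap.gnsNonUnitalStarAlgHom_apply_coe] at h4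
  have h5 := congrArg (fun ξ : UniversalSpace A => ξ φ) h4
  simp only [lp.single_apply_self] at h5
  have h6 : ‖(φ.1.leftMulMapPreGNS a (φ.1.toPreGNS (star a)) : φ.1.PreGNS)‖ = 0 := by
    rw [← UniformSpace.Completion.norm_coe, ← h5]
    simp
  have h7 := φ.1.preGNS_norm_sq (φ.1.leftMulMapPreGNS a (φ.1.toPreGNS (star a)))
  rw [h6] at h7
  exact hφ (by simpa using h7.symm)

/-- GNS representations are nondegenerate: `η` is orthogonal to every class of a product `b e`,
because such a class is the image of a vector under `b`, and an approximate unit passes from `b e`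
to `b`. -/
theorem gns_eq_zero_of_forall_apply_eq_zero (φ : A →ₚ[ℂ] ℂ) (η : φ.GNS)
    (h : ∀ a, φ.gnsNonUnitalStarAlgHom a η = 0) : η = 0 := by
  obtain ⟨C, hC⟩ := φ.exists_norm_apply_le
  have hb : ∀ b : A, ‖φ.toPreGNS b‖ ≤ √C * ‖b‖ := fun b => by
    rw [PositiveLinearMap.preGNS_norm_def, Real.sqrt_le_left (by positivity), mul_pow,
      Real.sq_sqrt C.coe_nonneg, sq, ← CStarRing.norm_star_mul_self]
    exact (Complex.re_le_norm _).trans (hC _)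
  have hcont : Continuous fun b : A => ((φ.toPreGNS b : φ.PreGNS) : φ.GNS) :=
    (UniformSpace.Completion.continuous_coe _).comp
      (AddMonoidHomClass.continuous_of_bound φ.toPreGNS.toLinearMap _ hb)
  have h1 : ∀ b : A, ⟪((φ.toPreGNS b : φ.PreGNS) : φ.GNS), η⟫_ℂ = 0 := fun b => by
    have hS : IsClosed {b : A | ⟪((φ.toPreGNS b : φ.PreGNS) : φ.GNS), η⟫_ℂ = 0} :=
      isClosed_eq (hcont.inner continuous_const) continuous_const
    refine mem_of_mul_mem_of_star_mul_self_mem ⊤ isClosed_univ (x := b) trivial hS fun e _ => ?_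
    have h2 : ((φ.toPreGNS (b * e) : φ.PreGNS) : φ.GNS) =
        φ.gnsNonUnitalStarAlgHom b ((φ.toPreGNS e : φ.PreGNS) : φ.GNS) := by
      rw [PositiveLinearMap.gnsNonUnitalStarAlgHom_apply_coe]; rfl
    change ⟪((φ.toPreGNS (b * e) : φ.PreGNS) : φ.GNS), η⟫_ℂ = 0
    rw [h2, ← ContinuousLinearMap.adjoint_inner_right, ← ContinuousLinearMap.star_eq_adjoint,
      ← StarHomClass.map_star, h, inner_zero_right]
  have h3 : ∀ ζ : φ.GNS, ⟪ζ, η⟫_ℂ = 0 := fun ζ => by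
    induction ζ using UniformSpace.Completion.induction_on with
    | hp => exact isClosed_eq (by fun_prop) (by fun_prop)
    | ih b => exact h1 (φ.ofPreGNS b)
  exact inner_self_eq_zero.mp (h3 η)

theorem eq_zero_of_forall_universalRep_apply_eq_zero (ξ : UniversalSpace A)
    (h : ∀ a, universalRep A a ξ = 0) : ξ = 0 := by
  ext φ
  exact gns_eq_zero_of_forall_apply_eq_zero φ.1 (ξ φ) fun a =>
    congrArg (fun ξ : UniversalSpace A => ξ φ) (h a)

variable (A) in
theorem norm_universalRep (a : A) : ‖universalRep A a‖ = ‖a‖ :=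
  NonUnitalStarAlgHom.norm_map _ (universalRep_injective A) a

end UniversalRep

/-! ### Vector functionals and slice maps on the minimal tensor product -/

theorem ContinuousLinearMap.opNorm_le_of_forall_inner_le {H : Type u} {K : Type v}
    [NormedAddCommGroup H]
    [InnerProductSpace ℂ H] [NormedAddCommGroup K] [InnerProductSpace ℂ K] (T : H →L[ℂ] K) {M : ℝ}
    (hM : 0 ≤ M) (h : ∀ ξ η, ‖⟪η, T ξ⟫_ℂ‖ ≤ M * ‖ξ‖ * ‖η‖) : ‖T‖ ≤ M := by
  refine T.opNorm_le_bound hM fun ξ => ?_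
  rcases (norm_nonneg (T ξ)).eq_or_lt with h0 | h0
  · rw [← h0]; positivity
  · have h1 := h ξ (T ξ)
    rw [inner_self_eq_norm_sq_to_K, norm_pow, RCLike.norm_ofReal, abs_norm, sq] at h1
    exact le_of_mul_le_mul_right h1 h0

noncomputable section

/-- A ⋆-homomorphism of C⋆-algebras as a bounded linear map. -/
def NonUnitalStarAlgHom.toCLM {A : Type u} {E : Type v} [NonUnitalCStarAlgebra A]
    [NonUnitalCStarAlgebra E] (f : A →⋆ₙₐ[ℂ] E) : A →L[ℂ] E :=
  LinearMap.mkContinuous { toFun := f, map_add' := map_add f, map_smul' := map_smul f } 1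
    fun a => (NonUnitalStarAlgHom.norm_apply_le f a).trans_eq (one_mul _).symm

@[simp] theorem NonUnitalStarAlgHom.toCLM_apply {A : Type u} {E : Type v} [NonUnitalCStarAlgebra A]
    [NonUnitalCStarAlgebra E] (f : A →⋆ₙₐ[ℂ] E) (a : A) : f.toCLM a = f a := rfl

theorem NonUnitalStarAlgHom.continuous_of_cstar {A : Type u} {E : Type v} [NonUnitalCStarAlgebra A]
    [NonUnitalCStarAlgebra E] (f : A →⋆ₙₐ[ℂ] E) : Continuous f := f.toCLM.continuous

namespace CStarRep

variable {A : Type u} [NonUnitalCStarAlgebra A]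

/-- The vector functional `a ↦ ⟨ρ(a) h, k⟩`. -/
def coeff (ρ : CStarRep A) (h h' : ρ.space) : A →L[ℂ] ℂ :=
  (innerSL ℂ h').comp ((ContinuousLinearMap.apply ℂ ρ.space h).comp ρ.hom.toCLM)

theorem coeff_apply (ρ : CStarRep A) (h h' : ρ.space) (a : A) :
    ρ.coeff h h' a = ⟪h', ρ.hom a h⟫_ℂ := rfl

variable (A) in
theorem exists_injective : ∃ ρ : CStarRep A, Function.Injective ρ.hom := by
  let : PartialOrder A := CStarAlgebra.spectralOrder A
  have : StarOrderedRing A := CStarAlgebra.spectralOrderedRing A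
  exact ⟨{ space := UniversalSpace A, hom := universalRep A }, universalRep_injective A⟩

theorem eq_of_coeff_eq (ρ : CStarRep A) (hρ : Function.Injective ρ.hom) {a b : A}
    (h : ∀ k k', ρ.coeff k k' a = ρ.coeff k k' b) : a = b :=
  hρ (ContinuousLinearMap.ext fun k => ext_inner_left ℂ fun k' => h k k')

end CStarRep

namespace MinTensor

variable {A C A' C' : Type u} [NonUnitalCStarAlgebra A] [NonUnitalCStarAlgebra C]
  [NonUnitalCStarAlgebra A'] [NonUnitalCStarAlgebra C']

@[elab_as_elim]
theorem induction_on {P : MinTensor A C → Prop} (z : MinTensor A C) (hc : IsClosed {z | P z})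
    (add : ∀ x y, P x → P y → P (x + y)) (tmul : ∀ a c, P (tmul a c)) : P z := by
  refine CStarSeminorm.induction_on (p := minTensorNorm A C) (P := P) z hc fun x => ?_
  change P (ofAlg x)
  induction x with
  | zero => simpa [MinTensor.tmul] using tmul 0 0
  | add x y hx hy => rw [map_add]; exact add _ _ hx hy
  | tmul a c => exact tmul a c

theorem clm_ext {E : Type v} [NormedAddCommGroup E] [NormedSpace ℂ E]
    {f g : MinTensor A C →L[ℂ] E} (h : ∀ a c, f (tmul a c) = g (tmul a c)) (z : MinTensor A C) :
    f z = g z := by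
  induction z using MinTensor.induction_on with
  | hc => exact isClosed_eq f.continuous g.continuous
  | add x y hx hy => rw [map_add, map_add, hx, hy]
  | tmul a c => exact h a c

theorem hom_ext {E : Type v} [NonUnitalCStarAlgebra E] {f g : MinTensor A C →⋆ₙₐ[ℂ] E}
    (h : ∀ a c, f (tmul a c) = g (tmul a c)) (z : MinTensor A C) : f z = g z :=
  clm_ext (f := f.toCLM) (g := g.toCLM) h z

theorem map_map {A'' C'' : Type u} [NonUnitalCStarAlgebra A''] [NonUnitalCStarAlgebra C'']
    (φ : A →⋆ₙₐ[ℂ] A') (ψ : C →⋆ₙₐ[ℂ] C') (φ' : A' →⋆ₙₐ[ℂ] A'') (ψ' : C' →⋆ₙₐ[ℂ] C'')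
    (z : MinTensor A C) : map φ' ψ' (map φ ψ z) = map (φ'.comp φ) (ψ'.comp ψ) z :=
  hom_ext (f := (map φ' ψ').comp (map φ ψ)) (g := map (φ'.comp φ) (ψ'.comp ψ))
    (fun a c => by
      rw [NonUnitalStarAlgHom.comp_apply, map_tmul, map_tmul, map_tmul]; rfl) z

theorem map_id (z : MinTensor A C) :
    map (NonUnitalStarAlgHom.id ℂ A) (NonUnitalStarAlgHom.id ℂ C) z = z :=
  hom_ext (g := NonUnitalStarAlgHom.id ℂ (MinTensor A C)) (fun a c => map_tmul _ _ a c) z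

/-- The spatial representation `ρ ⊗ σ` of the minimal tensor product. -/
def rep (ρ : CStarRep A) (σ : CStarRep C) : CStarRep (MinTensor A C) where
  space := HilbertTensor ρ.space σ.space
  hom := (minTensorNorm A C).lift (spatialRep ρ σ) (norm_spatialRep_le ρ σ)

theorem rep_ofAlg (ρ : CStarRep A) (σ : CStarRep C) (x : A ⊗[ℂ] C) :
    (rep ρ σ).hom (ofAlg x) = spatialRep ρ σ x :=
  (minTensorNorm A C).lift_toCompl (spatialRep ρ σ) (norm_spatialRep_le ρ σ) x

theorem rep_tmul (ρ : CStarRep A) (σ : CStarRep C) (a : A) (c : C) :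
    (rep ρ σ).hom (tmul a c) = opTensor (ρ.hom a) (σ.hom c) := rep_ofAlg ρ σ _

theorem rep_map (φ : A →⋆ₙₐ[ℂ] A') (ψ : C →⋆ₙₐ[ℂ] C') (ρ : CStarRep A') (σ : CStarRep C')
    (z : MinTensor A C) :
    (rep ρ σ).hom (map φ ψ z) = (rep (ρ.comp φ) (σ.comp ψ)).hom z :=
  hom_ext (f := (rep ρ σ).hom.comp (map φ ψ)) (g := (rep (ρ.comp φ) (σ.comp ψ)).hom)
    (fun a c => (congrArg (rep ρ σ).hom (map_tmul φ ψ a c)).trans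
      ((rep_tmul ρ σ (φ a) (ψ c)).trans (rep_tmul (ρ.comp φ) (σ.comp ψ) a c).symm)) z

/-- The elementary tensor `h ⊗ k` in the space of `ρ ⊗ σ`. -/
def repVec (ρ : CStarRep A) (σ : CStarRep C) (h : ρ.space) (k : σ.space) : (rep ρ σ).space :=
  (HilbertTensor.ofAlg (h ⊗ₜ[ℂ] k) : HilbertTensor ρ.space σ.space)

theorem inner_repVec (ρ : CStarRep A) (σ : CStarRep C) (h h' : ρ.space) (k k' : σ.space) :
    ⟪repVec ρ σ h k, repVec ρ σ h' k'⟫_ℂ = ⟪h, h'⟫_ℂ * ⟪k, k'⟫_ℂ := by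
  refine (HilbertTensor.inner_ofAlg _ _).trans ?_
  simp

theorem norm_repVec (ρ : CStarRep A) (σ : CStarRep C) (h : ρ.space) (k : σ.space) :
    ‖repVec ρ σ h k‖ = ‖h‖ * ‖k‖ := by
  refine (HilbertTensor.norm_ofAlg _).trans ?_
  simp

theorem rep_ext {ρ : CStarRep A} {σ : CStarRep C} {S T : (rep ρ σ).space →L[ℂ] (rep ρ σ).space}
    (h : ∀ a b a' b', ⟪repVec ρ σ a' b', S (repVec ρ σ a b)⟫_ℂ =
      ⟪repVec ρ σ a' b', T (repVec ρ σ a b)⟫_ℂ) : S = T := by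
  refine HilbertTensor.ext_op fun a b => ?_
  refine ext_inner_left ℂ fun v => ?_
  induction v using HilbertTensor.induction_on with
  | hc => exact isClosed_eq (by fun_prop) (by fun_prop)
  | h v =>
    induction v with
    | zero => simp
    | add v w hv hw => rw [map_add, inner_add_left, inner_add_left, hv, hw]
    | tmul a' b' => exact h a b a' b'

theorem coeff_rep_tmul (ρ : CStarRep A) (σ : CStarRep C) (h h' : ρ.space) (k k' : σ.space)
    (a : A) (c : C) :
    (rep ρ σ).coeff (repVec ρ σ h k) (repVec ρ σ h' k') (tmul a c) =
      ρ.coeff h h' a * σ.coeff k k' c := by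
  rw [CStarRep.coeff_apply, rep_tmul]
  have : opTensor (ρ.hom a) (σ.hom c) (repVec ρ σ h k) = repVec ρ σ (ρ.hom a h) (σ.hom c k) :=
    opTensor_tmul _ _ _ _
  refine (congrArg (fun v => ⟪repVec ρ σ h' k', v⟫_ℂ) this).trans ?_
  rw [inner_repVec]; rfl

/-- The minimal norm is a supremum over representations only on the algebraic tensor product. If `x`
is algebraic and `ε`-close to `z`, then `(ρ ⊗ σ)(x) = -(ρ ⊗ σ)(z - x)` has norm at most `ε` for all
`ρ`, `σ`, so `‖x‖ ≤ ε` and `‖z‖ ≤ 2ε`. -/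
theorem eq_zero_of_rep_eq_zero (z : MinTensor A C) (h : ∀ ρ σ, (rep ρ σ).hom z = 0) : z = 0 := by
  have hz : ∀ ε > 0, ‖z‖ ≤ ε + ε := by
    intro ε hε
    obtain ⟨_, ⟨x, rfl⟩, hx⟩ := Metric.mem_closure_iff.mp (denseRange_ofAlg z) ε hε
    rw [dist_eq_norm] at hx
    have h1 : ‖(ofAlg x : MinTensor A C)‖ ≤ ε := by
      rw [norm_ofAlg]
      refine ciSup_le fun i => ?_
      rw [CStarSeminorm.ofHom_apply, ← rep_ofAlg]
      have h2 : (rep i.1 i.2).hom (ofAlg x) = - (rep i.1 i.2).hom (z - ofAlg x) := by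
        rw [map_sub, h, zero_sub, neg_neg]
      rw [h2]
      refine (norm_neg _).le.trans ?_
      exact (NonUnitalStarAlgHom.norm_apply_le _ _).trans hx.le
    calc ‖z‖ = ‖(z - ofAlg x) + ofAlg x‖ := by rw [sub_add_cancel]
      _ ≤ _ := (norm_add_le _ _).trans (add_le_add hx.le h1)
  by_contra h0
  have := hz (‖z‖ / 4) (by have := norm_pos_iff.mpr h0; linarith)
  have := norm_pos_iff.mpr h0
  linarith

theorem eq_of_coeff_eq {y z : MinTensor A C}
    (h : ∀ (ρ : CStarRep A) (σ : CStarRep C) (a a' : ρ.space) (c c' : σ.space),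
      (rep ρ σ).coeff (repVec ρ σ a c) (repVec ρ σ a' c') y =
        (rep ρ σ).coeff (repVec ρ σ a c) (repVec ρ σ a' c') z) : y = z := by
  rw [← sub_eq_zero]
  refine eq_zero_of_rep_eq_zero _ fun ρ σ => rep_ext fun a b a' b' => ?_
  have h1 := h ρ σ a a' b b'
  rw [← sub_eq_zero, ← map_sub, CStarRep.coeff_apply] at h1
  rw [h1, zero_apply, inner_zero_right]

/-- The slice map `a ⊗ c ↦ χ(c) a` on the algebraic tensor product. -/
def algSlice (χ : C →L[ℂ] ℂ) : A ⊗[ℂ] C →ₗ[ℂ] A :=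
  TensorProduct.lift (LinearMap.mk₂ ℂ (fun a c => χ c • a) (by simp)
    (fun c a b => smul_comm _ _ _) (by simp [add_smul]) (by simp [mul_smul]))

theorem algSlice_tmul (χ : C →L[ℂ] ℂ) (a : A) (c : C) : algSlice χ (a ⊗ₜ[ℂ] c) = χ c • a := rfl

theorem coeff_algSlice (ρ : CStarRep A) (σ : CStarRep C) (h h' : ρ.space) (k k' : σ.space)
    (x : A ⊗[ℂ] C) : ρ.coeff h h' (algSlice (σ.coeff k k') x) =
      (rep ρ σ).coeff (repVec ρ σ h k) (repVec ρ σ h' k') (ofAlg x) := by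
  induction x with
  | zero => simp
  | add x y hx hy => simp only [map_add, hx, hy]
  | tmul a c =>
    rw [algSlice_tmul, map_smul, smul_eq_mul, mul_comm]
    exact (coeff_rep_tmul ρ σ h h' k k' a c).symm

/-- In a faithful representation of `A` the matrix coefficients of the slice are matrix coefficients
of `x` at elementary tensors, so Cauchy–Schwarz bounds the slice by the minimal norm. -/
theorem norm_algSlice_le (σ : CStarRep C) (k k' : σ.space) (x : A ⊗[ℂ] C) :
    ‖(algSlice (σ.coeff k k') x : A)‖ ≤ ‖k‖ * ‖k'‖ * ‖(ofAlg x : MinTensor A C)‖ := by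
  obtain ⟨ρ, hρ⟩ := CStarRep.exists_injective A
  rw [← NonUnitalStarAlgHom.norm_map ρ.hom hρ]
  refine ContinuousLinearMap.opNorm_le_of_forall_inner_le _ (by positivity) fun ξ η => ?_
  have h1 := coeff_algSlice ρ σ ξ η k k' x
  rw [CStarRep.coeff_apply, CStarRep.coeff_apply] at h1
  rw [h1]
  refine (norm_inner_le_norm _ _).trans ?_
  have h2 := ((rep ρ σ).hom (ofAlg x)).le_of_opNorm_le
    (NonUnitalStarAlgHom.norm_apply_le (rep ρ σ).hom (ofAlg x)) (repVec ρ σ ξ k)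
  rw [norm_repVec] at h2
  rw [norm_repVec]
  calc ‖η‖ * ‖k'‖ * _ ≤ ‖η‖ * ‖k'‖ * (‖(ofAlg x : MinTensor A C)‖ * (‖ξ‖ * ‖k‖)) := by gcongr
    _ = _ := by ring

/-- The slice map `a ⊗ c ↦ χ(c) a` by the vector functional `χ = ⟨σ(·) h, k⟩`. -/
def slice (σ : CStarRep C) (k k' : σ.space) : MinTensor A C →L[ℂ] A :=
  (algSlice (σ.coeff k k')).extendOfNorm (minTensorNorm A C).toComplₗ

theorem slice_tmul (σ : CStarRep C) (k k' : σ.space) (a : A) (c : C) :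
    slice σ k k' (tmul a c) = σ.coeff k k' c • a :=
  LinearMap.extendOfNorm_eq (minTensorNorm A C).denseRange_toComplₗ
    ⟨_, norm_algSlice_le σ k k'⟩ (a ⊗ₜ[ℂ] c)

theorem coeff_slice (ρ : CStarRep A) (σ : CStarRep C) (h h' : ρ.space) (k k' : σ.space)
    (z : MinTensor A C) : ρ.coeff h h' (slice σ k k' z) =
      (rep ρ σ).coeff (repVec ρ σ h k) (repVec ρ σ h' k') z :=
  clm_ext (f := (ρ.coeff h h').comp (slice σ k k')) (fun a c => by
    rw [ContinuousLinearMap.comp_apply, slice_tmul, map_smul, coeff_rep_tmul, smul_eq_mul,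
      mul_comm]) z

theorem coeff_map (φ : A →⋆ₙₐ[ℂ] A') (ψ : C →⋆ₙₐ[ℂ] C') (ρ : CStarRep A') (σ : CStarRep C')
    (h h' : ρ.space) (k k' : σ.space) (z : MinTensor A C) :
    (rep ρ σ).coeff (repVec ρ σ h k) (repVec ρ σ h' k') (map φ ψ z) =
      (rep (ρ.comp φ) (σ.comp ψ)).coeff (repVec (ρ.comp φ) (σ.comp ψ) h k)
        (repVec (ρ.comp φ) (σ.comp ψ) h' k') z :=
  congrArg (fun T : HilbertTensor ρ.space σ.space →L[ℂ] HilbertTensor ρ.space σ.space =>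
    ⟪repVec ρ σ h' k', T (repVec ρ σ h k)⟫_ℂ) (rep_map φ ψ ρ σ z)

/-- The associativity isomorphism is known only through its graph, so the coaction identity is
exploited by testing it against pairs of continuous functionals that match on elementary tensors. -/
theorem AssocRel.apply_eq {C₁ : Type u} [NonUnitalCStarAlgebra C₁]
    {x : MinTensor (MinTensor A C) C₁} {y : MinTensor A (MinTensor C C₁)} (h : AssocRel x y)
    {f : MinTensor (MinTensor A C) C₁ →L[ℂ] ℂ} {g : MinTensor A (MinTensor C C₁) →L[ℂ] ℂ}
    (hfg : ∀ a b c, f (tmul (tmul a b) c) = g (tmul a (tmul b c))) : f x = g y := by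
  let k : MinTensor (MinTensor A C) C₁ × MinTensor A (MinTensor C C₁) →L[ℂ] ℂ :=
    f.comp (ContinuousLinearMap.fst ℂ _ _) - g.comp (ContinuousLinearMap.snd ℂ _ _)
  have h1 := Submodule.topologicalClosure_minimal _ (t := LinearMap.ker k.toLinearMap)
    (Submodule.span_le.mpr (by
      rintro _ ⟨a, b, c, rfl⟩
      exact sub_eq_zero.mpr (hfg a b c))) k.isClosed_ker h
  exact sub_eq_zero.mp h1

theorem AssocRel.coeff_eq {C₁ : Type u} [NonUnitalCStarAlgebra C₁]
    {x : MinTensor (MinTensor A C) C₁} {y : MinTensor A (MinTensor C C₁)} (h : AssocRel x y)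
    (ρ : CStarRep A) (σ : CStarRep C) (τ : CStarRep C₁) (a a' : ρ.space) (b b' : σ.space)
    (c c' : τ.space) :
    (rep (rep ρ σ) τ).coeff (repVec (rep ρ σ) τ (repVec ρ σ a b) c)
        (repVec (rep ρ σ) τ (repVec ρ σ a' b') c') x =
      (rep ρ (rep σ τ)).coeff (repVec ρ (rep σ τ) a (repVec σ τ b c))
        (repVec ρ (rep σ τ) a' (repVec σ τ b' c')) y :=
  h.apply_eq fun p q r => by simp only [coeff_rep_tmul, mul_assoc]

end MinTensor

end

/-! ### Independence of the spatial norm of the faithful representation -/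

noncomputable section

section MatrixRep

variable {C : Type u} [NonUnitalCStarAlgebra C] {ι : Type v} [Fintype ι]

/-- The operator on `K^ι` given by a matrix over `C` and a representation of `C` on `K`. -/
def CStarRep.matrixOp (σ : CStarRep C) (M : CStarMatrix ι ι C) :
    PiLp 2 (fun _ : ι => σ.space) →L[ℂ] PiLp 2 (fun _ : ι => σ.space) :=
  ((PiLp.continuousLinearEquiv 2 ℂ (fun _ : ι => σ.space)).symm :
      (ι → σ.space) →L[ℂ] PiLp 2 (fun _ : ι => σ.space)).comp
    ((ContinuousLinearMap.pi fun i => ∑ j, (σ.hom (M i j)).comp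
      (ContinuousLinearMap.proj (R := ℂ) (φ := fun _ : ι => σ.space) j)).comp
    (PiLp.continuousLinearEquiv 2 ℂ (fun _ : ι => σ.space) :
      PiLp 2 (fun _ : ι => σ.space) →L[ℂ] (ι → σ.space)))

theorem CStarRep.matrixOp_apply (σ : CStarRep C) (M : CStarMatrix ι ι C)
    (v : PiLp 2 (fun _ : ι => σ.space)) (i : ι) :
    σ.matrixOp M v i = ∑ j, σ.hom (M i j) (v j) := by
  simp [CStarRep.matrixOp]

theorem CStarRep.inner_matrixOp (σ : CStarRep C) (M : CStarMatrix ι ι C)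
    (v w : PiLp 2 (fun _ : ι => σ.space)) :
    ⟪w, σ.matrixOp M v⟫_ℂ = ∑ i, ∑ j, σ.coeff (v j) (w i) (M i j) := by
  simp only [PiLp.inner_apply, σ.matrixOp_apply, inner_sum]
  rfl

/-- The representation of the matrices over `C` on `K^ι`. -/
def CStarRep.matrixRep (σ : CStarRep C) :
    CStarMatrix ι ι C →⋆ₙₐ[ℂ]
      (PiLp 2 (fun _ : ι => σ.space) →L[ℂ] PiLp 2 (fun _ : ι => σ.space)) where
  toFun := σ.matrixOp
  map_smul' c M := by
    ext v i
    simp [σ.matrixOp_apply, Finset.smul_sum]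
  map_zero' := by
    ext v i
    simp [σ.matrixOp_apply]
  map_add' M N := by
    ext v i
    simp [σ.matrixOp_apply, Finset.sum_add_distrib]
  map_mul' M N := by
    ext v i
    simp only [σ.matrixOp_apply, CStarMatrix.mul_apply, mul_apply_eq_comp, map_sum,
      sum_apply, map_mul]
    exact Finset.sum_comm
  map_star' M := by
    rw [ContinuousLinearMap.star_eq_adjoint]
    refine (ContinuousLinearMap.eq_adjoint_iff _ _).mpr fun v w => ?_
    rw [σ.inner_matrixOp, ← inner_conj_symm, σ.inner_matrixOp, map_sum, Finset.sum_comm]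
    refine Finset.sum_congr rfl fun i _ => ?_
    rw [map_sum]
    refine Finset.sum_congr rfl fun j _ => ?_
    rw [CStarRep.coeff_apply, CStarRep.coeff_apply, inner_conj_symm, CStarMatrix.star_apply,
      StarHomClass.map_star, ContinuousLinearMap.star_eq_adjoint,
      ContinuousLinearMap.adjoint_inner_left]

theorem CStarRep.matrixRep_injective (σ : CStarRep C) (hσ : Function.Injective σ.hom) :
    Function.Injective (σ.matrixRep (ι := ι)) := by
  classical
  rw [injective_iff_map_eq_zero]
  intro M hM
  refine CStarMatrix.ext fun i j => ?_
  refine (injective_iff_map_eq_zero _).mp hσ _ ?_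
  ext k
  have h1 := congrArg (fun T => T (WithLp.toLp 2 (Pi.single j k)) i) hM
  have h2 := σ.matrixOp_apply M (WithLp.toLp 2 (Pi.single j k)) i
  rw [Finset.sum_eq_single j (fun b _ hb => by simp [Pi.single_eq_of_ne hb]) (by simp)] at h2
  simpa using h2.symm.trans h1

/-- A faithful `σ₀` stays faithful on matrices, so its amplification is isometric there, while the
amplification of `σ` is at least contractive. This is the complete contractivity that makes the
spatial norm independent of the faithful representation. -/
theorem CStarRep.norm_matrixOp_le (σ σ₀ : CStarRep C) (hσ₀ : Function.Injective σ₀.hom)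
    (M : CStarMatrix ι ι C) : ‖σ.matrixOp M‖ ≤ ‖σ₀.matrixOp M‖ := by
  let : PartialOrder C := CStarAlgebra.spectralOrder C
  have : StarOrderedRing C := CStarAlgebra.spectralOrderedRing C
  calc ‖σ.matrixRep M‖ ≤ ‖M‖ := NonUnitalStarAlgHom.norm_apply_le _ _
    _ = ‖σ₀.matrixRep M‖ :=
      (NonUnitalStarAlgHom.norm_map _ (σ₀.matrixRep_injective hσ₀) M).symm

end MatrixRep

section OrthonormalExpansion

variable {H K : Type u} [NormedAddCommGroup H] [InnerProductSpace ℂ H]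
  [NormedAddCommGroup K] [InnerProductSpace ℂ K]

/-- Two algebraic tensors have their left legs in a common finite-dimensional subspace, and one
orthonormal basis of it serves for both. -/
theorem exists_orthonormal_expansion (v w : H ⊗[ℂ] K) :
    ∃ (n : ℕ) (e : Fin n → H) (k l : Fin n → K), Orthonormal ℂ e ∧
      v = ∑ i, e i ⊗ₜ[ℂ] k i ∧ w = ∑ i, e i ⊗ₜ[ℂ] l i := by
  obtain ⟨F, hF, hs⟩ := TensorProduct.exists_finite_submodule_left_of_setFinite {v, w}
    (Set.toFinite _)
  have hfd : FiniteDimensional ℂ F := hF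
  let b := stdOrthonormalBasis ℂ F
  have key : ∀ x : F ⊗[ℂ] K, ∃ k : Fin (Module.finrank ℂ F) → K,
      F.subtype.rTensor K x = ∑ i, ((b i : F) : H) ⊗ₜ[ℂ] k i := by
    intro x
    induction x with
    | zero => exact ⟨0, by simp⟩
    | add x y hx hy =>
      obtain ⟨k, hk⟩ := hx
      obtain ⟨l, hl⟩ := hy
      exact ⟨k + l, by simp [map_add, hk, hl, TensorProduct.tmul_add, Finset.sum_add_distrib]⟩
    | tmul f k =>
      refine ⟨fun i => b.repr f i • k, ?_⟩
      have h1 : (f : H) = ∑ i, b.repr f i • ((b i : F) : H) := by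
        conv_lhs => rw [← b.sum_repr f]
        simp
      rw [LinearMap.rTensor_tmul, Submodule.subtype_apply, h1, TensorProduct.sum_tmul]
      exact Finset.sum_congr rfl fun i _ => by
        rw [← TensorProduct.smul_tmul]
  obtain ⟨x, hx⟩ := hs (Set.mem_insert v {w})
  obtain ⟨y, hy⟩ := hs (Set.mem_insert_of_mem v rfl)
  obtain ⟨k, hk⟩ := key x
  obtain ⟨l, hl⟩ := key y
  exact ⟨_, fun i => b i, k, l, b.orthonormal.comp_linearIsometry F.subtypeₗᵢ,
    hx ▸ hk, hy ▸ hl⟩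

theorem norm_sum_orthonormal_tmul {ι : Type v} [Fintype ι] {e : ι → H} (he : Orthonormal ℂ e)
    (k : ι → K) : ‖∑ i, e i ⊗ₜ[ℂ] k i‖ = ‖WithLp.toLp 2 k‖ := by
  classical
  rw [PiLp.norm_eq_of_L2, eq_comm, Real.sqrt_eq_iff_mul_self_eq (by positivity) (norm_nonneg _),
    ← sq, ← inner_self_eq_norm_sq (𝕜 := ℂ)]
  simp only [sum_inner, inner_sum, TensorProduct.inner_tmul, orthonormal_iff_ite.mp he, ite_mul,
    one_mul, zero_mul, Finset.sum_ite_eq', Finset.mem_univ, if_true, map_sum]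
  exact Finset.sum_congr rfl fun i _ => (inner_self_eq_norm_sq (𝕜 := ℂ) (k i)).symm

end OrthonormalExpansion

namespace MinTensor

variable {A C : Type u} [NonUnitalCStarAlgebra A] [NonUnitalCStarAlgebra C]

/-- The slice map `a ⊗ c ↦ χ(a) c` on the algebraic tensor product. -/
def algSliceLeft (χ : A →L[ℂ] ℂ) : A ⊗[ℂ] C →ₗ[ℂ] C :=
  TensorProduct.lift (LinearMap.mk₂ ℂ (fun a c => χ a • c) (by simp [add_smul])
    (by simp [mul_smul]) (by simp) (fun c a b => smul_comm _ _ _))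

theorem coeff_algSliceLeft (ρ : CStarRep A) (σ : CStarRep C) (h h' : ρ.space) (k k' : σ.space)
    (x : A ⊗[ℂ] C) : σ.coeff k k' (algSliceLeft (ρ.coeff h h') x) =
      ⟪HilbertTensor.ofAlg (h' ⊗ₜ[ℂ] k'), spatialRep ρ σ x (HilbertTensor.ofAlg (h ⊗ₜ[ℂ] k))⟫_ℂ := by
  induction x with
  | zero => simp
  | add x y hx hy =>
    rw [map_add, map_add, map_add, add_apply, inner_add_right, hx, hy]
  | tmul a c =>
    rw [spatialRep_tmul, opTensor_tmul, HilbertTensor.inner_ofAlg, TensorProduct.inner_tmul]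
    change σ.coeff k k' (ρ.coeff h h' a • c) = _
    rw [map_smul]
    rfl

theorem inner_spatialRep_sum (ρ : CStarRep A) (σ : CStarRep C) (x : A ⊗[ℂ] C) {ι : Type}
    [Fintype ι] (e : ι → ρ.space) (k l : ι → σ.space) :
    ⟪HilbertTensor.ofAlg (∑ i, e i ⊗ₜ[ℂ] l i),
      spatialRep ρ σ x (HilbertTensor.ofAlg (∑ i, e i ⊗ₜ[ℂ] k i))⟫_ℂ =
    ⟪WithLp.toLp 2 l, σ.matrixOp (CStarMatrix.ofMatrix fun i j =>
      algSliceLeft (ρ.coeff (e j) (e i)) x) (WithLp.toLp 2 k)⟫_ℂ := by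
  rw [σ.inner_matrixOp]
  simp only [map_sum, sum_inner, inner_sum]
  rw [Finset.sum_comm]
  exact Finset.sum_congr rfl fun i _ => Finset.sum_congr rfl fun j _ =>
    (coeff_algSliceLeft ρ σ (e j) (e i) (k j) (l i) x).symm

/-- On vectors `∑ e_i ⊗ k_i` with `e_i` orthonormal, `(ρ ⊗ σ)(x)` acts through the matrix `M` over
`C` whose entries are the slices of `x` by the coefficients of `ρ` at the `e_i`. Then `‖σ(M)‖ ≤
‖σ₀(M)‖` by faithfulness, and `σ₀(M)` is a compression of `(ρ ⊗ σ₀)(x)`. -/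
theorem norm_spatialRep_le_of_injective (ρ : CStarRep A) (σ σ₀ : CStarRep C)
    (hσ₀ : Function.Injective σ₀.hom) (x : A ⊗[ℂ] C) :
    ‖spatialRep ρ σ x‖ ≤ ‖spatialRep ρ σ₀ x‖ := by
  refine ContinuousLinearMap.opNorm_le_of_forall_inner_le _ (norm_nonneg _) fun ξ η => ?_
  induction ξ using HilbertTensor.induction_on with
  | hc => exact isClosed_le (by fun_prop) (by fun_prop)
  | h v =>
  induction η using HilbertTensor.induction_on with
  | hc => exact isClosed_le (by fun_prop) (by fun_prop)
  | h w =>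
  obtain ⟨n, e, k, l, he, rfl, rfl⟩ := exists_orthonormal_expansion v w
  rw [inner_spatialRep_sum, HilbertTensor.norm_ofAlg, HilbertTensor.norm_ofAlg,
    norm_sum_orthonormal_tmul he, norm_sum_orthonormal_tmul he]
  set M : CStarMatrix (Fin n) (Fin n) C := CStarMatrix.ofMatrix fun i j =>
      algSliceLeft (ρ.coeff (e j) (e i)) x with hM
  -- The isometry `(k_i) ↦ ∑ e_i ⊗ k_i` compresses `(ρ ⊗ σ₀)(x)` to `σ₀(M)`.
  have h1 : ‖σ₀.matrixOp M‖ ≤ ‖spatialRep ρ σ₀ x‖ := by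
    refine ContinuousLinearMap.opNorm_le_of_forall_inner_le _ (norm_nonneg _) fun ξ η => ?_
    have h2 := inner_spatialRep_sum ρ σ₀ x e ξ.ofLp η.ofLp
    rw [← hM, WithLp.toLp_ofLp, WithLp.toLp_ofLp] at h2
    rw [← h2]
    refine (norm_inner_le_norm _ _).trans ?_
    refine (mul_le_mul_of_nonneg_left ((spatialRep ρ σ₀ x).le_opNorm _) (norm_nonneg _)).trans ?_
    rw [HilbertTensor.norm_ofAlg, HilbertTensor.norm_ofAlg, norm_sum_orthonormal_tmul he,
      norm_sum_orthonormal_tmul he, WithLp.toLp_ofLp, WithLp.toLp_ofLp, mul_comm]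
  refine (norm_inner_le_norm _ _).trans ?_
  rw [mul_comm]
  refine mul_le_mul_of_nonneg_right ?_ (norm_nonneg _)
  exact (σ.matrixOp M).le_of_opNorm_le ((σ.norm_matrixOp_le σ₀ hσ₀ M).trans h1) _

theorem rep_eq_zero_of_injective (ρ : CStarRep A) (σ σ₀ : CStarRep C)
    (hσ₀ : Function.Injective σ₀.hom) {z : MinTensor A C} (hz : (rep ρ σ₀).hom z = 0) :
    (rep ρ σ).hom z = 0 := by
  have h : ∀ z : MinTensor A C, ‖(rep ρ σ).hom z‖ ≤ ‖(rep ρ σ₀).hom z‖ := fun z => by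
    refine CStarSeminorm.induction_on (p := minTensorNorm A C)
      (P := fun z => ‖(rep ρ σ).hom z‖ ≤ ‖(rep ρ σ₀).hom z‖) z
      (isClosed_le ((rep ρ σ).hom.continuous_of_cstar.norm)
        ((rep ρ σ₀).hom.continuous_of_cstar.norm)) fun x => ?_
    have h1 := norm_spatialRep_le_of_injective ρ σ σ₀ hσ₀ x
    rw [← rep_ofAlg, ← rep_ofAlg] at h1
    exact h1
  exact norm_le_zero_iff.mp ((h z).trans_eq (by rw [hz, norm_zero]))

end MinTensor

end

/-! ### Fourier coefficients of a coaction -/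

noncomputable section

open scoped Classical in
/-- The point mass `δ_t ∈ ℓ²(G)`. -/
def pointMass {G : Type u} (t : G) : lp (fun _ : G => ℂ) 2 := lp.single 2 t 1

theorem pointMass_apply {G : Type u} [DecidableEq G] (t r : G) :
    pointMass t r = if r = t then 1 else 0 := by
  classical
  rcases eq_or_ne r t with rfl | h
  · simp [pointMass]
  · simp [pointMass, h]

theorem inner_pointMass {G : Type u} (t : G) (ξ : lp (fun _ : G => ℂ) 2) :
    ⟪pointMass t, ξ⟫_ℂ = ξ t := by
  classical
  rw [pointMass, lp.inner_single_left]
  simp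

theorem clm_ext_pointMass {G : Type u} {E : Type v} [NormedAddCommGroup E] [NormedSpace ℂ E]
    {f g : lp (fun _ : G => ℂ) 2 →L[ℂ] E} (h : ∀ t, f (pointMass t) = g (pointMass t)) : f = g := by
  classical
  have : Fact ((1 : ENNReal) ≤ 2) := ⟨by norm_num⟩
  refine ContinuousLinearMap.ext fun ξ => ?_
  have h1 := lp.hasSum_single (p := 2) (by norm_num) ξ
  have h2 : ∀ t, f (lp.single 2 t (ξ t)) = g (lp.single 2 t (ξ t)) := fun t => by
    have h3 : (lp.single 2 t (ξ t) : lp (fun _ : G => ℂ) 2) = ξ t • pointMass t := by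
      rw [pointMass, ← lp.single_smul, smul_eq_mul, mul_one]
    rw [h3, map_smul, map_smul, h]
  refine (h1.mapL f).unique ?_
  simp only [h2]
  exact h1.mapL g

namespace GroupCStar

variable {G : Type u} [Group G]

theorem clm_ext {E : Type v} [NormedAddCommGroup E] [NormedSpace ℂ E]
    {f g : GroupCStar G →L[ℂ] E} (h : ∀ s, f (of s) = g (of s)) : f = g := by
  refine ContinuousLinearMap.ext fun z => ?_
  refine CStarSeminorm.induction_on (p := groupMaxNorm G) (P := fun z => f z = g z) z
    (isClosed_eq f.continuous g.continuous) fun x => ?_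
  change f (ofAlg x) = g (ofAlg x)
  induction x using MonoidAlgebra.induction_linear with
  | zero => simp
  | add x y hx hy => rw [map_add, map_add, map_add, hx, hy]
  | single s c =>
    have h1 : MonoidAlgebra.single s c = c • MonoidAlgebra.single s (1 : ℂ) := by simp
    rw [h1, map_smul, map_smul, map_smul]
    exact congrArg (c • ·) (h s)

variable (G) in
/-- The left regular representation of `C⋆(G)` on `ℓ²(G)`. -/
def regRep : CStarRep (GroupCStar G) where
  space := lp (fun _ : G => ℂ) 2
  hom := leftRegular

/-- The point mass `δ_t` in the space of the left regular representation. -/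
def regVec (t : G) : (regRep G).space := (pointMass t : lp (fun _ : G => ℂ) 2)

theorem inner_regVec [DecidableEq G] (t r : G) :
    ⟪regVec t, regVec r⟫_ℂ = if t = r then 1 else 0 := by
  exact (inner_pointMass t (pointMass r)).trans (pointMass_apply r t)

theorem coeff_regRep_of [DecidableEq G] (t r g : G) :
    (regRep G).coeff (regVec t) (regVec r) (of g) = if g * t = r then 1 else 0 := by
  have h1 : leftRegular (of g) = leftRegularOp g := GroupCStar.lift_of _ _ _ g
  refine (congrArg (fun T => ⟪pointMass r, T (pointMass t)⟫_ℂ) h1).trans ?_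
  rw [inner_pointMass, leftRegularOp_apply, pointMass_apply]
  congr 1
  rw [inv_mul_eq_iff_eq_mul, eq_comm (a := r)]

/-- Both functionals are the indicator of the single group element `r t⁻¹`. Hence the matrix entries
of `(ρ ⊗ λ)δ(b)` depend only on `r t⁻¹`, and one family of Fourier coefficients describes them all.
-/
theorem coeff_regRep_eq (t r : G) :
    (regRep G).coeff (regVec t) (regVec r) = (regRep G).coeff (regVec 1) (regVec (r * t⁻¹)) := by
  classical
  refine clm_ext fun g => ?_
  rw [coeff_regRep_of, coeff_regRep_of, mul_one, eq_mul_inv_iff_mul_eq]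

end GroupCStar

open GroupCStar MinTensor

namespace MinTensor

variable {G A : Type u} [Group G] [NonUnitalCStarAlgebra A]

@[elab_as_elim]
theorem induction_of {P : MinTensor A (GroupCStar G) → Prop} (z : MinTensor A (GroupCStar G))
    (hc : IsClosed {z | P z}) (add : ∀ x y, P x → P y → P (x + y))
    (tmul : ∀ a s, P (tmul a (of s))) : P z := by
  induction z using MinTensor.induction_on with
  | hc => exact hc
  | add x y hx hy => exact add x y hx hy
  | tmul a c =>
    let k : GroupCStar G →L[ℂ] MinTensor A (GroupCStar G) := LinearMap.mkContinuous
      { toFun := fun c => MinTensor.tmul a c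
        map_add' := fun c c' => by rw [MinTensor.tmul, TensorProduct.tmul_add, map_add]; rfl
        map_smul' := fun r c => by rw [MinTensor.tmul, TensorProduct.tmul_smul, map_smul]; rfl } ‖a‖
      fun c => norm_tmul_le a c
    change P (k c)
    refine CStarSeminorm.induction_on (p := groupMaxNorm G) (P := fun c => P (k c)) c
      (hc.preimage k.continuous) fun x => ?_
    change P (k (GroupCStar.ofAlg x))
    induction x using MonoidAlgebra.induction_linear with
    | zero =>
      rw [map_zero, map_zero]
      have h0 : (MinTensor.tmul 0 (of 1) : MinTensor A (GroupCStar G)) = 0 :=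
        map_zero (tmulRight (of (1 : G)))
      exact h0 ▸ tmul 0 1
    | add x y hx hy => rw [map_add, map_add]; exact add _ _ hx hy
    | single s r =>
      have h1 : MonoidAlgebra.single s r = r • MonoidAlgebra.single s (1 : ℂ) := by simp
      rw [h1, map_smul, map_smul]
      have h2 : r • k (GroupCStar.ofAlg (MonoidAlgebra.single s 1)) =
          MinTensor.tmul (r • a) (of s) := (smul_tmul r a (of s)).symm
      rw [h2]
      exact tmul _ _

theorem clm_ext_of {E : Type v} [NormedAddCommGroup E] [NormedSpace ℂ E]
    {f g : MinTensor A (GroupCStar G) →L[ℂ] E} (h : ∀ a s, f (tmul a (of s)) = g (tmul a (of s)))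
    (z : MinTensor A (GroupCStar G)) : f z = g z := by
  induction z using MinTensor.induction_of with
  | hc => exact isClosed_eq f.continuous g.continuous
  | add x y hx hy => rw [map_add, map_add, hx, hy]
  | tmul a s => exact h a s

theorem mem_closure_span_tmul_of (z : MinTensor A (GroupCStar G)) :
    z ∈ (Submodule.span ℂ {z : MinTensor A (GroupCStar G) |
      ∃ a s, z = tmul a (of s)}).topologicalClosure := by
  induction z using MinTensor.induction_of with
  | hc => exact Submodule.isClosed_topologicalClosure _
  | add x y hx hy => exact add_mem hx hy
  | tmul a s => exact Submodule.le_topologicalClosure _ (Submodule.subset_span ⟨a, s, rfl⟩)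

theorem repVec_add_left {C : Type u} [NonUnitalCStarAlgebra C] (ρ : CStarRep A) (σ : CStarRep C)
    (h h' : ρ.space) (k : σ.space) :
    repVec ρ σ (h + h') k = repVec ρ σ h k + repVec ρ σ h' k :=
  (congrArg HilbertTensor.ofAlg (TensorProduct.add_tmul h h' k)).trans (map_add _ _ _)

theorem repVec_smul_left {C : Type u} [NonUnitalCStarAlgebra C] (ρ : CStarRep A) (σ : CStarRep C)
    (c : ℂ) (h : ρ.space) (k : σ.space) : repVec ρ σ (c • h) k = c • repVec ρ σ h k :=
  (congrArg HilbertTensor.ofAlg (TensorProduct.smul_tmul' c h k).symm).trans (map_smul _ _ _)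

/-- The bounded linear map `k ↦ h ⊗ k`. -/
def repVecRight {C : Type u} [NonUnitalCStarAlgebra C] (ρ : CStarRep A) (σ : CStarRep C)
    (h : ρ.space) : σ.space →L[ℂ] (rep ρ σ).space :=
  LinearMap.mkContinuous
    { toFun := fun k => repVec ρ σ h k
      map_add' := fun k k' =>
        (congrArg HilbertTensor.ofAlg (TensorProduct.tmul_add h k k')).trans (map_add _ _ _)
      map_smul' := fun c k =>
        (congrArg HilbertTensor.ofAlg (TensorProduct.tmul_smul c h k)).trans (map_smul _ _ _) } ‖h‖
    fun k => (norm_repVec ρ σ h k).le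

/-- An operator on `H ⊗ ℓ²(G)` is determined by its values on the vectors `h ⊗ δ_t`. -/
theorem rep_ext_regVec {E : Type v} [NormedAddCommGroup E] [NormedSpace ℂ E] (ρ : CStarRep A)
    {S T : (rep ρ (regRep G)).space →L[ℂ] E}
    (h : ∀ a t, S (repVec ρ (regRep G) a (regVec t)) = T (repVec ρ (regRep G) a (regVec t))) :
    S = T := by
  have h1 : ∀ a k, S (repVec ρ (regRep G) a k) = T (repVec ρ (regRep G) a k) := fun a k => by
    have h2 : S.comp (repVecRight ρ (regRep G) a) = T.comp (repVecRight ρ (regRep G) a) :=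
      clm_ext_pointMass (G := G) fun t => h a t
    exact congrArg (fun T : (regRep G).space →L[ℂ] E => T k) h2
  refine ContinuousLinearMap.ext fun v => ?_
  refine HilbertTensor.induction_on (P := fun v => S v = T v) v
    (isClosed_eq S.continuous T.continuous) fun v => ?_
  induction v with
  | zero => rw [map_zero]; exact (map_zero S).trans (map_zero T).symm
  | add v w hv hw =>
    rw [map_add]
    exact (map_add S _ _).trans ((congrArg₂ (· + ·) hv hw).trans (map_add T _ _).symm)
  | tmul a k => exact h1 a k

theorem rep_ext_coeff_regVec (ρ : CStarRep A)
    {S T : (rep ρ (regRep G)).space →L[ℂ] (rep ρ (regRep G)).space}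
    (h : ∀ a a' t r, ⟪repVec ρ (regRep G) a' (regVec r), S (repVec ρ (regRep G) a (regVec t))⟫_ℂ =
      ⟪repVec ρ (regRep G) a' (regVec r), T (repVec ρ (regRep G) a (regVec t))⟫_ℂ) :
    S = T := by
  refine rep_ext_regVec ρ fun a t => ?_
  have h1 : innerSL ℂ (S (repVec ρ (regRep G) a (regVec t))) =
      innerSL ℂ (T (repVec ρ (regRep G) a (regVec t))) := rep_ext_regVec ρ fun a' r => by
    rw [innerSL_apply_apply, innerSL_apply_apply, ← inner_conj_symm, h, inner_conj_symm]
  exact ext_inner_right ℂ fun v =>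
    congrArg (fun T : (rep ρ (regRep G)).space →L[ℂ] ℂ => T v) h1

end MinTensor

namespace Coaction

variable {G B : Type u} [Group G] [NonUnitalCStarAlgebra B] (δ : Coaction G B)

/-- The Fourier coefficient `(ι ⊗ χ_s) ∘ δ` of a coaction. -/
def fourier (s : G) : B →L[ℂ] B := (slice (regRep G) (regVec 1) (regVec s)).comp δ.hom.toCLM

theorem slice_regVec (t r : G) (b : B) :
    slice (regRep G) (regVec t) (regVec r) (δ.hom b) = δ.fourier (r * t⁻¹) b :=
  MinTensor.clm_ext (f := slice (regRep G) (regVec t) (regVec r))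
    (g := slice (regRep G) (regVec 1) (regVec (r * t⁻¹))) (fun a c => by
      rw [slice_tmul, slice_tmul, coeff_regRep_eq]) (δ.hom b)

theorem coeff_regVec (ρ : CStarRep B) (h h' : ρ.space) (t r : G) (b : B) :
    (rep ρ (regRep G)).coeff (repVec ρ (regRep G) h (regVec t)) (repVec ρ (regRep G) h' (regVec r))
      (δ.hom b) = ρ.coeff h h' (δ.fourier (r * t⁻¹) b) := by
  rw [← coeff_slice, slice_regVec]

theorem fourier_of_mem [DecidableEq G] {s t : G} {b : B} (hb : b ∈ δ.spectral t) :
    δ.fourier s b = if t = s then b else 0 := by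
  have h1 : δ.hom b = tmul b (of t) := hb
  change slice (regRep G) (regVec 1) (regVec s) (δ.hom b) = _
  rw [h1, slice_tmul, coeff_regRep_of, mul_one]
  split_ifs <;> simp

/-- As `δ_G(g) = g ⊗ g`, slicing the last two legs of `(ι ⊗ δ_G)δ(b)` by two functionals is slicing
`δ(b)` by their pointwise product on `G`; `hκ` says that this product is a multiple of an indicator.
The coaction identity moves the computation to `(δ ⊗ ι)δ(b)`. It is applied with one functional an
indicator, and with both equal to the same indicator. -/
theorem coeff_coassoc (ρ : CStarRep B) (σ τ : CStarRep (GroupCStar G)) (a a' : ρ.space)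
    (c c' : σ.space) (k k' : τ.space) (κ : ℂ) (t r : G)
    (hκ : ∀ g, σ.coeff c c' (of g) * τ.coeff k k' (of g) =
      κ * (regRep G).coeff (regVec t) (regVec r) (of g)) (b : B) :
    (rep ((rep ρ σ).comp δ.hom) τ).coeff (repVec ((rep ρ σ).comp δ.hom) τ (repVec ρ σ a c) k)
        (repVec ((rep ρ σ).comp δ.hom) τ (repVec ρ σ a' c') k') (δ.hom b) =
      κ * ρ.coeff a a' (δ.fourier (r * t⁻¹) b) := by
  have h1 := coeff_map δ.hom (NonUnitalStarAlgHom.id ℂ (GroupCStar G)) (rep ρ σ) τ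
    (repVec ρ σ a c) (repVec ρ σ a' c') k k' (δ.hom b)
  have h2 := (δ.coassoc b).coeff_eq ρ σ τ a a' c c' k k'
  have h3 := coeff_map (NonUnitalStarAlgHom.id ℂ B) GroupCStar.comul ρ (rep σ τ) a a'
    (repVec σ τ c k) (repVec σ τ c' k') (δ.hom b)
  refine h1.symm.trans (h2.trans (h3.trans ?_))
  rw [← δ.coeff_regVec]
  refine MinTensor.clm_ext_of (g := κ • (rep ρ (regRep G)).coeff
    (repVec ρ (regRep G) a (regVec t)) (repVec ρ (regRep G) a' (regVec r))) (fun x g => ?_) _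
  refine (coeff_rep_tmul _ _ _ _ _ _ _ _).trans ?_
  rw [smul_apply, coeff_rep_tmul, smul_eq_mul, ← mul_assoc, mul_comm κ, mul_assoc, ← hκ,
    ← coeff_rep_tmul]
  have h4 : GroupCStar.comul (of g) = tmul (of g) (of g) := GroupCStar.lift_of _ _ _ g
  exact congrArg (fun z => ρ.coeff a a' x * (rep σ τ).coeff (repVec σ τ c k) (repVec σ τ c' k') z) h4

/-- A functional on `C⋆(G)` multiplied on `G` by the indicator of `s` is its value at `s` times that
indicator. By `coeff_coassoc` the matrix coefficients of `δ(E_s(b))` are therefore those of `E_s(b)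
⊗ s`. -/
theorem fourier_mem (s : G) (b : B) : δ.fourier s b ∈ δ.spectral s := by
  classical
  rw [mem_spectral]
  refine MinTensor.eq_of_coeff_eq fun ρ σ a a' c c' => ?_
  have h1 := coeff_slice ((rep ρ σ).comp δ.hom) (regRep G) (repVec ρ σ a c) (repVec ρ σ a' c')
    (regVec 1) (regVec s) (δ.hom b)
  refine h1.trans ?_
  rw [δ.coeff_coassoc ρ σ (regRep G) a a' c c' (regVec 1) (regVec s) (σ.coeff c c' (of s)) 1 s,
    coeff_rep_tmul, mul_comm, inv_one, mul_one]
  intro g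
  rw [coeff_regRep_of, mul_one]
  split_ifs with h
  · rw [h]
  · simp

end Coaction

end

/-! ### Normal coactions -/

noncomputable section

open GroupCStar MinTensor

namespace Coaction

variable {G B : Type u} [Group G] [NonUnitalCStarAlgebra B] (δ : Coaction G B)

/-- The representation `(ρ ⊗ λ) ∘ δ`. -/
def inducedRep (ρ : CStarRep B) : CStarRep B := (rep ρ (regRep G)).comp δ.hom

/-- The vector `h ⊗ δ_t` in the space of `(ρ ⊗ λ) ∘ δ`. -/
def inducedVec (ρ : CStarRep B) (h : ρ.space) (t : G) : (δ.inducedRep ρ).space :=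
  (repVec ρ (regRep G) h (regVec t) : (rep ρ (regRep G)).space)

/-- The vector `(h ⊗ δ_t) ⊗ δ_t`. -/
def diagVec (ρ : CStarRep B) (h : ρ.space) (t : G) :
    (rep (δ.inducedRep ρ) (regRep G)).space :=
  repVec (δ.inducedRep ρ) (regRep G) (δ.inducedVec ρ h t) (regVec t)

theorem inner_inducedVec (ρ : CStarRep B) (h h' : ρ.space) (t r : G) :
    ⟪δ.inducedVec ρ h t, δ.inducedVec ρ h' r⟫_ℂ =
      ⟪repVec ρ (regRep G) h (regVec t), repVec ρ (regRep G) h' (regVec r)⟫_ℂ := rfl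

theorem coeff_inducedVec (ρ : CStarRep B) (h h' : ρ.space) (t r : G) (b : B) :
    (δ.inducedRep ρ).coeff (δ.inducedVec ρ h t) (δ.inducedVec ρ h' r) b =
      ρ.coeff h h' (δ.fourier (r * t⁻¹) b) := δ.coeff_regVec ρ h h' t r b

theorem rep_hom_eq_zero_of_fourier_eq_zero {b : B} (hb : ∀ s, δ.fourier s b = 0) (ρ : CStarRep B) :
    (rep ρ (regRep G)).hom (δ.hom b) = 0 := by
  refine rep_ext_coeff_regVec ρ fun a a' t r => ?_
  have h := δ.coeff_regVec ρ a a' t r b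
  rw [hb, map_zero] at h
  exact h.trans (inner_zero_right _).symm

variable {δ}

/-- The Fourier coefficients are all the matrix entries of `(ρ ⊗ λ)δ(b)`. Normality speaks of the
minimal tensor product with `B(ℓ²(G))`, so an arbitrary second representation has to be replaced by
the faithful identity representation; `rep_eq_zero_of_injective` does that. -/
theorem eq_zero_of_fourier_eq_zero (hδ : δ.IsNormal) {b : B} (hb : ∀ s, δ.fourier s b = 0) :
    b = 0 := by
  refine hδ ?_
  change MinTensor.map _ _ (δ.hom b) = MinTensor.map _ _ (δ.hom 0)
  rw [map_zero, map_zero]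
  let σ₀ : CStarRep (lp (fun _ : G => ℂ) 2 →L[ℂ] lp (fun _ : G => ℂ) 2) :=
    { space := lp (fun _ : G => ℂ) 2, hom := NonUnitalStarAlgHom.id ℂ _ }
  refine eq_zero_of_rep_eq_zero _ fun ρ σ => ?_
  refine rep_eq_zero_of_injective ρ σ σ₀ (fun _ _ h => h) ?_
  have h1 : ρ.comp (NonUnitalStarAlgHom.id ℂ B) = ρ := rfl
  have h2 : σ₀.comp leftRegular = regRep G := rfl
  have h3 := rep_map (NonUnitalStarAlgHom.id ℂ B) leftRegular ρ σ₀ (δ.hom b)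
  have h4 : ∀ ρ' σ', ρ' = ρ → σ' = regRep G → (rep ρ' σ').hom (δ.hom b) = 0 := by
    rintro _ _ rfl rfl
    exact δ.rep_hom_eq_zero_of_fourier_eq_zero hb _
  exact h3.trans (h4 _ _ h1 h2)

theorem inducedRep_injective (hδ : δ.IsNormal) (ρ : CStarRep B) (hρ : Function.Injective ρ.hom) :
    Function.Injective (δ.inducedRep ρ).hom := by
  rw [injective_iff_map_eq_zero]
  intro b hb
  refine eq_zero_of_fourier_eq_zero hδ fun s => ρ.eq_of_coeff_eq hρ fun h h' => ?_
  have h1 := δ.coeff_regVec ρ h h' 1 s b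
  rw [inv_one, mul_one] at h1
  rw [← h1, map_zero]
  have h2 : (rep ρ (regRep G)).hom (δ.hom b) = 0 := hb
  rw [CStarRep.coeff_apply, h2]
  exact inner_zero_right _

theorem inner_inducedRep_star_mul_self (ρ : CStarRep B) (h : ρ.space) (t : G) (b : B) :
    ((‖(rep ρ (regRep G)).hom (δ.hom b) (repVec ρ (regRep G) h (regVec t))‖ ^ 2 : ℝ) : ℂ) =
      ρ.coeff h h (δ.fourier 1 (star b * b)) := by
  have h1 := δ.coeff_regVec ρ h h t t (star b * b)
  rw [mul_inv_cancel] at h1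
  rw [← h1, CStarRep.coeff_apply, map_mul, map_mul, StarHomClass.map_star, StarHomClass.map_star,
    mul_apply_eq_comp, ContinuousLinearMap.star_eq_adjoint,
    ContinuousLinearMap.adjoint_inner_right, inner_self_eq_norm_sq_to_K]
  push_cast
  rfl

/-- Faithfulness of the conditional expectation onto `B_e`: the diagonal entries of `(ρ ⊗ λ)δ(b⋆b)`
are all `ρ(E_e(b⋆b))`, and they are the squared norms of the columns of `(ρ ⊗ λ)δ(b)`. -/
theorem eq_zero_of_fourier_one_star_mul_self (hδ : δ.IsNormal) {b : B}
    (hb : δ.fourier 1 (star b * b) = 0) : b = 0 := by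
  obtain ⟨ρ, hρ⟩ := CStarRep.exists_injective B
  refine (injective_iff_map_eq_zero _).mp (inducedRep_injective hδ ρ hρ) b ?_
  refine rep_ext_regVec ρ fun a t => ?_
  have h1 := inner_inducedRep_star_mul_self (δ := δ) ρ a t b
  rw [hb, map_zero] at h1
  have h2 : ‖(rep ρ (regRep G)).hom (δ.hom b) (repVec ρ (regRep G) a (regVec t))‖ ^ 2 = 0 := by
    exact_mod_cast h1
  exact norm_eq_zero.mp ((pow_eq_zero_iff two_ne_zero).mp h2)

end Coaction

section Diagonal

variable {G B : Type u} [Group G] [NonUnitalCStarAlgebra B]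

/-- The vector `∑ h_t ⊗ δ_t` of `H ⊗ ℓ²(G)`. -/
def finsuppVec (ρ : CStarRep B) : (G →₀ ρ.space) →ₗ[ℂ] (rep ρ (regRep G)).space :=
  Finsupp.lsum ℂ fun t =>
    { toFun := fun h => repVec ρ (regRep G) h (regVec t)
      map_add' := fun h h' => repVec_add_left ρ _ h h' _
      map_smul' := fun c h => repVec_smul_left ρ _ c h _ }

theorem finsuppVec_apply (ρ : CStarRep B) (f : G →₀ ρ.space) :
    finsuppVec ρ f = f.sum fun t h => repVec ρ (regRep G) h (regVec t) := rfl

theorem denseRange_finsuppVec (ρ : CStarRep B) : DenseRange (finsuppVec (G := G) ρ) := by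
  intro v
  change v ∈ (LinearMap.range (finsuppVec (G := G) ρ)).topologicalClosure
  set W := (LinearMap.range (finsuppVec (G := G) ρ)).topologicalClosure with hW
  have : CompleteSpace W := (Submodule.isClosed_topologicalClosure _).completeSpace_coe
  -- Density is obtained from the projection onto the closure: it fixes every `h ⊗ δ_t`, and these
  -- vectors determine a bounded operator.
  have h1 : W.starProjection = ContinuousLinearMap.id ℂ _ := rep_ext_regVec ρ fun a t => by
    refine Submodule.starProjection_eq_self_iff.mpr ?_
    refine Submodule.le_topologicalClosure _ ⟨Finsupp.single t a, ?_⟩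
    rw [finsuppVec_apply, Finsupp.sum_single_index]
    exact (repVec_smul_left ρ (regRep G) 0 0 (regVec t) |> fun h => by simpa using h)
  refine Submodule.starProjection_eq_self_iff.mp ?_
  rw [h1]
  rfl

/-- The doubling map `V : h ⊗ δ_t ↦ (h ⊗ δ_t) ⊗ δ_t` is isometric; compression by `V` is what
inverts the coaction below. -/
theorem norm_sum_repVec_repVec (ρ : CStarRep B) (δ : Coaction G B) (f : G →₀ ρ.space) :
    ‖f.sum fun t h => δ.diagVec ρ h t‖ = ‖finsuppVec ρ f‖ := by
  classical
  have key : ⟪f.sum fun t h => δ.diagVec ρ h t,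
      f.sum fun t h => δ.diagVec ρ h t⟫_ℂ = ⟪finsuppVec ρ f, finsuppVec ρ f⟫_ℂ := by
    simp only [finsuppVec_apply, Finsupp.sum, sum_inner, inner_sum]
    refine Finset.sum_congr rfl fun t _ => Finset.sum_congr rfl fun r _ => ?_
    rw [Coaction.diagVec, Coaction.diagVec, inner_repVec, inner_regVec, δ.inner_inducedVec]
    split_ifs with h
    · exact mul_one _
    · rw [mul_zero, inner_repVec, inner_regVec, if_neg h, mul_zero]
  rw [norm_eq_sqrt_re_inner (𝕜 := ℂ), key, ← norm_eq_sqrt_re_inner]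

end Diagonal

namespace Coaction

variable {G B : Type u} [Group G] [NonUnitalCStarAlgebra B] {δ : Coaction G B}

/-- If the diagonal coefficients of `z` are the Fourier coefficients of `b`, then `‖b‖ ≤ ‖z‖`. -/
theorem norm_le_of_coeff_diagonal (hδ : δ.IsNormal) (ρ : CStarRep B)
    (hρ : Function.Injective ρ.hom) {b : B} {z : MinTensor B (GroupCStar G)}
    (h : ∀ a a' t r, (rep (δ.inducedRep ρ) (regRep G)).coeff
      (δ.diagVec ρ a t)
      (δ.diagVec ρ a' r) z =
      ρ.coeff a a' (δ.fourier (r * t⁻¹) b)) : ‖b‖ ≤ ‖z‖ := by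
  rw [← NonUnitalStarAlgHom.norm_map _ (inducedRep_injective hδ ρ hρ) b]
  have key : ∀ f f' : G →₀ ρ.space,
      ‖⟪finsuppVec ρ f', (rep ρ (regRep G)).hom (δ.hom b) (finsuppVec ρ f)⟫_ℂ‖ ≤
        ‖z‖ * ‖finsuppVec (G := G) ρ f‖ * ‖finsuppVec (G := G) ρ f'‖ := by
    intro f f'
    rw [← norm_sum_repVec_repVec ρ δ f, ← norm_sum_repVec_repVec ρ δ f']
    have h1 : ⟪finsuppVec ρ f', (rep ρ (regRep G)).hom (δ.hom b) (finsuppVec ρ f)⟫_ℂ =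
        ⟪f'.sum fun t h => δ.diagVec ρ h t,
          (rep (δ.inducedRep ρ) (regRep G)).hom z (f.sum fun t h =>
            δ.diagVec ρ h t)⟫_ℂ := by
      simp only [finsuppVec_apply, Finsupp.sum, map_sum, sum_inner, inner_sum]
      refine Finset.sum_congr rfl fun t _ => Finset.sum_congr rfl fun r _ => ?_
      exact (δ.coeff_regVec ρ (f t) (f' r) t r b).trans (h (f t) (f' r) t r).symm
    rw [h1]
    refine (norm_inner_le_norm _ _).trans ?_
    rw [mul_comm]
    refine mul_le_mul_of_nonneg_right ?_ (norm_nonneg _)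
    exact ContinuousLinearMap.le_of_opNorm_le _ (NonUnitalStarAlgHom.norm_apply_le _ _) _
  refine ContinuousLinearMap.opNorm_le_of_forall_inner_le _ (norm_nonneg _) fun ξ η => ?_
  refine (denseRange_finsuppVec (G := G) ρ).induction_on₂
    (p := fun ξ η => ‖⟪η, (rep ρ (regRep G)).hom (δ.hom b) ξ⟫_ℂ‖ ≤ ‖z‖ * ‖ξ‖ * ‖η‖) 
    (isClosed_le ?_ ?_) key ξ η
  · exact (continuous_snd.inner (((rep ρ (regRep G)).hom (δ.hom b)).continuous.comp
      continuous_fst)).norm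
  · fun_prop

variable (δ) in
-- Compressing `δ(b)`, taken in `((ρ ⊗ λ)δ) ⊗ λ`, by the doubling isometry returns `(ρ ⊗ λ)δ(b)`,
-- because the indicator of `r t⁻¹` is idempotent under the pointwise product.
theorem coeff_diagonal_hom (ρ : CStarRep B) (b : B) (a a' : ρ.space) (t r : G) :
    (rep (δ.inducedRep ρ) (regRep G)).coeff
      (δ.diagVec ρ a t)
      (δ.diagVec ρ a' r)
      (δ.hom b) = ρ.coeff a a' (δ.fourier (r * t⁻¹) b) := by
  classical
  refine (δ.coeff_coassoc ρ (regRep G) (regRep G) a a' (regVec t) (regVec r) (regVec t) (regVec r)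
    1 t r (fun g => ?_) b).trans (one_mul _)
  rw [coeff_regRep_of]
  split_ifs <;> simp

variable (δ) in
theorem coeff_diagonal_tmul (ρ : CStarRep B) (c : B) (g : G) (a a' : ρ.space) (t r : G) :
    (rep (δ.inducedRep ρ) (regRep G)).coeff
      (δ.diagVec ρ a t)
      (δ.diagVec ρ a' r)
      (tmul c (of g)) = ρ.coeff a a' (δ.fourier (r * t⁻¹) (δ.fourier g c)) := by
  classical
  rw [diagVec, diagVec, coeff_rep_tmul, coeff_regRep_of, δ.fourier_of_mem (δ.fourier_mem g c),
    coeff_inducedVec]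
  -- If `r = g t`, both sides are the coefficient of `E_g(c)`; otherwise the entry of `λ_g` vanishes
  -- on the left and `E_{r t⁻¹}` kills `B_g` on the right.
  by_cases h : g * t = r
  · subst h
    simp
  · rw [if_neg h, if_neg (fun h' => h (by rw [h']; group)), mul_zero, map_zero]

/-- For a normal coaction the spectral subspaces span a dense subspace. -/
theorem mem_closure_span_spectral (hδ : δ.IsNormal) (b : B) :
    b ∈ (Submodule.span ℂ {x : B | ∃ s, x ∈ δ.spectral s}).topologicalClosure := by
  obtain ⟨ρ, hρ⟩ := CStarRep.exists_injective B
  have key : ∀ z ∈ Submodule.span ℂ {z : MinTensor B (GroupCStar G) | ∃ a s, z = tmul a (of s)},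
      ∃ y ∈ Submodule.span ℂ {x : B | ∃ s, x ∈ δ.spectral s}, ∀ a a' t r,
        (rep (δ.inducedRep ρ) (regRep G)).coeff
        (δ.diagVec ρ a t)
        (δ.diagVec ρ a' r) z =
        ρ.coeff a a' (δ.fourier (r * t⁻¹) y) := by
    intro z hz
    induction hz using Submodule.span_induction with
    | mem z hz =>
      obtain ⟨c, g, rfl⟩ := hz
      exact ⟨δ.fourier g c, Submodule.subset_span ⟨g, δ.fourier_mem g c⟩,
        δ.coeff_diagonal_tmul ρ c g⟩
    | zero => exact ⟨0, zero_mem _, by simp⟩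
    | add z w _ _ hz hw =>
      obtain ⟨y, hy, hy'⟩ := hz
      obtain ⟨x, hx, hx'⟩ := hw
      exact ⟨y + x, add_mem hy hx, fun a a' t r => by simp only [map_add, hy', hx']⟩
    | smul c z _ hz =>
      obtain ⟨y, hy, hy'⟩ := hz
      exact ⟨c • y, Submodule.smul_mem _ c hy, fun a a' t r => by simp only [map_smul, hy']⟩
  refine Metric.mem_closure_iff.mpr fun ε hε => ?_
  -- Approximate `δ(b)` by a finite sum `z` of terms `c ⊗ g`. Compression by the doubling isometry
  -- turns `z` into the corresponding sum of the `E_g(c)`, and by `norm_le_of_coeff_diagonal` it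
  -- does not increase the distance to `b`.
  obtain ⟨z, hz, hzε⟩ := Metric.mem_closure_iff.mp (mem_closure_span_tmul_of (δ.hom b)) ε hε
  obtain ⟨y, hy, hy'⟩ := key z hz
  refine ⟨y, hy, ?_⟩
  rw [dist_eq_norm] at hzε ⊢
  refine lt_of_le_of_lt (norm_le_of_coeff_diagonal hδ ρ hρ fun a a' t r => ?_) hzε
  rw [map_sub, map_sub, map_sub, δ.coeff_diagonal_hom ρ, hy']

end Coaction

end

/-! ### The ideals `D_s` and their unit projections -/

noncomputable section

namespace Coaction

variable {G B : Type u} [Group G] [NonUnitalCStarAlgebra B] (δ : Coaction G B)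

/-- The fixed point algebra `B_e`. -/
def unitFiber : NonUnitalStarSubalgebra ℂ B where
  carrier := δ.spectral 1
  add_mem' := add_mem
  zero_mem' := zero_mem _
  smul_mem' c _ := Submodule.smul_mem _ c
  mul_mem' hx hy := by simpa using δ.mul_mem_spectral hx hy
  star_mem' hx := by simpa using δ.star_mem_spectral hx

theorem isClosed_unitFiber : IsClosed (δ.unitFiber : Set B) := δ.isClosed_spectral 1

variable {δ}

theorem star_mem_spectral_inv {s : G} {x : B} (hx : x ∈ δ.spectral s⁻¹) : star x ∈ δ.spectral s := by
  simpa using δ.star_mem_spectral hx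

theorem star_mem_spectral_one {x : B} (hx : x ∈ δ.spectral 1) : star x ∈ δ.spectral 1 := by
  simpa using δ.star_mem_spectral hx

theorem one_mul_mem_spectral {s : G} {b x : B} (hb : b ∈ δ.spectral 1) (hx : x ∈ δ.spectral s) :
    b * x ∈ δ.spectral s := by simpa using δ.mul_mem_spectral hb hx

theorem mul_one_mem_spectral {s : G} {x b : B} (hx : x ∈ δ.spectral s) (hb : b ∈ δ.spectral 1) :
    x * b ∈ δ.spectral s := by simpa using δ.mul_mem_spectral hx hb

theorem isClosed_rangeIdeal (s : G) : IsClosed (δ.rangeIdeal s : Set B) :=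
  Submodule.isClosed_topologicalClosure _

theorem mul_star_mem_rangeIdeal {s : G} {x y : B} (hx : x ∈ δ.spectral s) (hy : y ∈ δ.spectral s) :
    x * star y ∈ δ.rangeIdeal s :=
  Submodule.le_topologicalClosure _ (Submodule.subset_span ⟨x, hx, y, hy, rfl⟩)

theorem star_mul_mem_rangeIdeal {s : G} {x y : B} (hx : x ∈ δ.spectral s) (hy : y ∈ δ.spectral s) :
    star x * y ∈ δ.rangeIdeal s⁻¹ := by
  simpa using mul_star_mem_rangeIdeal (δ.star_mem_spectral hx) (δ.star_mem_spectral hy)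

theorem rangeIdeal_le_of_forall {s : G} {W : Submodule ℂ B} (hW : IsClosed (W : Set B))
    (h : ∀ x ∈ δ.spectral s, ∀ y ∈ δ.spectral s, x * star y ∈ W) : δ.rangeIdeal s ≤ W :=
  Submodule.topologicalClosure_minimal _ (Submodule.span_le.mpr (by
    rintro _ ⟨x, hx, y, hy, rfl⟩
    exact h x hx y hy)) hW

theorem mul_mem_rangeIdeal {s : G} {b d : B} (hb : b ∈ δ.spectral 1) (hd : d ∈ δ.rangeIdeal s) :
    b * d ∈ δ.rangeIdeal s := by
  have h := rangeIdeal_le_of_forall (δ := δ) (s := s)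
    (W := (δ.rangeIdeal s).comap (ContinuousLinearMap.mul ℂ B b).toLinearMap)
    ((isClosed_rangeIdeal s).preimage (ContinuousLinearMap.mul ℂ B b).continuous)
    (fun x hx y hy => by
      change b * (x * star y) ∈ δ.rangeIdeal s
      rw [← mul_assoc]
      exact mul_star_mem_rangeIdeal (one_mul_mem_spectral hb hx) hy)
  exact h hd

theorem star_mem_rangeIdeal {s : G} {d : B} (hd : d ∈ δ.rangeIdeal s) :
    star d ∈ δ.rangeIdeal s := by
  have h : ∀ d ∈ (Submodule.span ℂ {d : B | ∃ b ∈ δ.spectral s, ∃ c ∈ δ.spectral s,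
      d = b * star c}), star d ∈ δ.rangeIdeal s := by
    intro d hd
    induction hd using Submodule.span_induction with
    | mem d hd =>
      obtain ⟨x, hx, y, hy, rfl⟩ := hd
      simpa using mul_star_mem_rangeIdeal hy hx
    | zero => simp
    | add x y _ _ hx hy => rw [star_add]; exact add_mem hx hy
    | smul c x _ hx => rw [star_smul]; exact Submodule.smul_mem _ _ hx
  exact closure_minimal (t := star ⁻¹' (δ.rangeIdeal s : Set B)) h
    ((isClosed_rangeIdeal s).preimage continuous_star) hd

theorem mul_one_mem_rangeIdeal {s : G} {d b : B} (hd : d ∈ δ.rangeIdeal s)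
    (hb : b ∈ δ.spectral 1) : d * b ∈ δ.rangeIdeal s := by
  simpa using star_mem_rangeIdeal (mul_mem_rangeIdeal (star_mem_spectral_one hb)
    (star_mem_rangeIdeal hd))

variable (δ) in
/-- The ideal `D_s` as a C⋆-subalgebra. -/
def rangeAlgebra (s : G) : NonUnitalStarSubalgebra ℂ B where
  carrier := δ.rangeIdeal s
  add_mem' := add_mem
  zero_mem' := zero_mem _
  smul_mem' c _ := Submodule.smul_mem _ c
  mul_mem' hx hy := mul_mem_rangeIdeal (δ.rangeIdeal_le s hx) hy
  star_mem' hx := star_mem_rangeIdeal hx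

theorem spectral_induction_right {s : G} {x : B} (hx : x ∈ δ.spectral s) {S : Set B}
    (hS : IsClosed S) (h : ∀ e ∈ δ.rangeIdeal s⁻¹, x * e ∈ S) : x ∈ S :=
  mem_of_mul_mem_of_star_mul_self_mem (δ.rangeAlgebra s⁻¹) (isClosed_rangeIdeal s⁻¹)
    (star_mul_mem_rangeIdeal hx hx) hS h

theorem spectral_induction_left {s : G} {x : B} (hx : x ∈ δ.spectral s) {S : Set B}
    (hS : IsClosed S) (h : ∀ e ∈ δ.rangeIdeal s, e * x ∈ S) : x ∈ S :=
  mem_of_mul_mem_of_mul_star_self_mem (δ.rangeAlgebra s) (isClosed_rangeIdeal s)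
    (mul_star_mem_rangeIdeal hx hx) hS h

theorem rangeIdeal_induction_right {s : G} {d : B} (hd : d ∈ δ.rangeIdeal s) {S : Set B}
    (hS : IsClosed S) (h : ∀ e ∈ δ.rangeIdeal s, d * e ∈ S) : d ∈ S :=
  mem_of_mul_mem_of_star_mul_self_mem (δ.rangeAlgebra s) (isClosed_rangeIdeal s)
    (mul_mem (S := NonUnitalStarSubalgebra ℂ B) (star_mem_rangeIdeal hd : _ ∈ δ.rangeAlgebra s) hd)
    hS h

/-- An approximate unit of `B_e` writes `x` as a limit of products `x e = x (e⋆)⋆`. -/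
theorem rangeIdeal_one : δ.rangeIdeal 1 = δ.spectral 1 := by
  refine le_antisymm (δ.rangeIdeal_le 1) fun x hx => ?_
  refine mem_of_mul_mem_of_star_mul_self_mem δ.unitFiber δ.isClosed_unitFiber (x := x)
    (mul_mem (star_mem_spectral_one hx : star x ∈ δ.unitFiber) hx) (isClosed_rangeIdeal 1) fun e he => ?_
  simpa using mul_star_mem_rangeIdeal hx (star_mem_spectral_one he)

end Coaction

theorem clm_ext_of_range {X H : Type u} {E : Type v} [AddCommGroup X] [Module ℂ X]
    [NormedAddCommGroup H]
    [InnerProductSpace ℂ H] [CompleteSpace H] [NormedAddCommGroup E] [NormedSpace ℂ E]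
    (f : X →ₗ[ℂ] H) {S T : H →L[ℂ] E} (h : ∀ x, S (f x) = T (f x))
    (h' : ∀ ξ, (∀ x, ⟪f x, ξ⟫_ℂ = 0) → S ξ = T ξ) : S = T := by
  let W := (LinearMap.range f).topologicalClosure
  have hW : IsClosed (W : Set H) := Submodule.isClosed_topologicalClosure _
  have : CompleteSpace W := hW.completeSpace_coe
  have h1 : ∀ ξ ∈ W, S ξ = T ξ := fun ξ hξ =>
    closure_minimal (s := (LinearMap.range f : Set H)) (t := {ξ | S ξ = T ξ})
      (by rintro _ ⟨x, rfl⟩; exact h x) (isClosed_eq S.continuous T.continuous) hξ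
  have h2 : ∀ ξ ∈ Wᗮ, S ξ = T ξ := fun ξ hξ => h' ξ fun x =>
    Submodule.inner_right_of_mem_orthogonal (K := W)
      (Submodule.le_topologicalClosure _ ⟨x, rfl⟩) hξ
  ext ξ
  rw [← Submodule.starProjection_add_starProjection_orthogonal (K := W) ξ, map_add, map_add,
    h1 _ (Submodule.starProjection_apply_mem _ _), h2 _ (Submodule.starProjection_apply_mem _ _)]

/-- The partial isometry given by two linear maps with the same inner products. -/
theorem exists_partialIsometry {X H : Type u} [AddCommGroup X] [Module ℂ X] [NormedAddCommGroup H]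
    [InnerProductSpace ℂ H] [CompleteSpace H] (f g : X →ₗ[ℂ] H)
    (h : ∀ x y, ⟪f x, f y⟫_ℂ = ⟪g x, g y⟫_ℂ) :
    ∃ U : H →L[ℂ] H, (∀ x, U (f x) = g x) ∧ (∀ ξ, (∀ x, ⟪f x, ξ⟫_ℂ = 0) → U ξ = 0) ∧
      (∀ x, star U (g x) = f x) ∧ ∀ ξ, (∀ x, ⟪g x, ξ⟫_ℂ = 0) → star U ξ = 0 := by
  have key : ∀ f g : X →ₗ[ℂ] H, (∀ x y, ⟪f x, f y⟫_ℂ = ⟪g x, g y⟫_ℂ) →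
      ∃ U : H →L[ℂ] H, (∀ x, U (f x) = g x) ∧ ∀ ξ, (∀ x, ⟪f x, ξ⟫_ℂ = 0) → U ξ = 0 := by
    intro f g h
    let W := (LinearMap.range f).topologicalClosure
    have hW : IsClosed (W : Set H) := Submodule.isClosed_topologicalClosure _
    have : CompleteSpace W := hW.completeSpace_coe
    let f' : X →ₗ[ℂ] W := f.codRestrict W fun x => Submodule.le_topologicalClosure _ ⟨x, rfl⟩
    have hdense : DenseRange f' := by
      intro y
      rw [closure_subtype]
      have : (Subtype.val '' Set.range f' : Set H) = (LinearMap.range f : Set H) := by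
        ext z
        constructor
        · rintro ⟨_, ⟨w, rfl⟩, rfl⟩; exact ⟨w, rfl⟩
        · rintro ⟨w, rfl⟩; exact ⟨f' w, ⟨w, rfl⟩, rfl⟩
      rw [this]
      exact y.2
    have hb : ∀ x, ‖g x‖ ≤ 1 * ‖f' x‖ := fun x => by
      rw [one_mul]
      change ‖g x‖ ≤ ‖f x‖
      rw [norm_eq_sqrt_re_inner (𝕜 := ℂ), norm_eq_sqrt_re_inner (𝕜 := ℂ), h]
    refine ⟨(g.extendOfNorm f').comp W.orthogonalProjectionOnto, fun x => ?_, fun ξ hξ => ?_⟩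
    · have h1 : W.orthogonalProjectionOnto (f x) = f' x :=
        Submodule.orthogonalProjectionOnto_mem_subspace_eq_self (K := W) (f' x)
      rw [ContinuousLinearMap.comp_apply, h1, LinearMap.extendOfNorm_eq hdense ⟨_, hb⟩]
    · have h1 : ξ ∈ Wᗮ := by
        rw [Submodule.orthogonal_closure, Submodule.mem_orthogonal]
        rintro _ ⟨w, rfl⟩
        exact hξ w
      rw [ContinuousLinearMap.comp_apply,
        Submodule.orthogonalProjectionOnto_apply_of_mem_orthogonal h1, map_zero]
  obtain ⟨U, hU, hU'⟩ := key f g h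
  obtain ⟨V, hV, hV'⟩ := key g f fun x y => (h x y).symm
  -- The adjoint is the map built from the interchanged pair. The two are compared on the closed
  -- range of `f` and of `g` and on their orthogonal complements, where both constructions are
  -- explicit.
  have hUV : star U = V := by
    rw [ContinuousLinearMap.star_eq_adjoint, eq_comm, ContinuousLinearMap.eq_adjoint_iff]
    intro η ξ
    have h1 : ∀ x, (innerSL ℂ (f x)).comp V = innerSL ℂ (g x) := fun x =>
      clm_ext_of_range g (fun y => by simp [hV, h]) fun ζ hζ => by simp [hV' ζ hζ, hζ x]
    have h2 : ∀ ζ, (∀ x, ⟪f x, ζ⟫_ℂ = 0) → (innerSL ℂ ζ).comp V = 0 := fun ζ hζ =>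
      clm_ext_of_range g (fun y => by
        have : ⟪ζ, f y⟫_ℂ = 0 := by rw [← inner_conj_symm, hζ, map_zero]
        simp [hV, this]) fun ζ' hζ' => by simp [hV' ζ' hζ']
    have h3 : innerSL ℂ (V η) = (innerSL ℂ η).comp U := clm_ext_of_range f
      (fun x => by
        have h4 := congrArg (fun T : H →L[ℂ] ℂ => T η) (h1 x)
        simp only [ContinuousLinearMap.comp_apply, innerSL_apply_apply] at h4
        simp only [ContinuousLinearMap.comp_apply, innerSL_apply_apply, hU]
        rw [← inner_conj_symm, h4, inner_conj_symm])
      fun ζ hζ => by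
        have h4 := congrArg (fun T : H →L[ℂ] ℂ => T η) (h2 ζ hζ)
        simp only [ContinuousLinearMap.comp_apply, innerSL_apply_apply, zero_apply] at h4
        simp only [ContinuousLinearMap.comp_apply, innerSL_apply_apply, hU' ζ hζ, inner_zero_right]
        rw [← inner_conj_symm, h4, map_zero]
    exact congrArg (fun T : H →L[ℂ] ℂ => T ξ) h3
  exact ⟨U, hU, hU', fun x => by rw [hUV, hV], fun ξ hξ => by rw [hUV, hV' ξ hξ]⟩

namespace Coaction

variable {G B : Type u} [Group G] [NonUnitalCStarAlgebra B] [PartialOrder B] [StarOrderedRing B]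
  {δ : Coaction G B}

theorem star_proj (s : G) : star (δ.proj s) = δ.proj s := by
  have : CompleteSpace (Submodule.span ℂ {η : UniversalSpace B | ∃ d ∈ δ.rangeIdeal s, ∃ ξ,
    η = universalRep B d ξ}).topologicalClosure :=
    (Submodule.isClosed_topologicalClosure _).completeSpace_coe
  exact (isSelfAdjoint_starProjection _).star_eq

theorem proj_mul_universalRep_of_mem_rangeIdeal {s : G} {d : B} (hd : d ∈ δ.rangeIdeal s) :
    δ.proj s * universalRep B d = universalRep B d := by
  ext1 ξ
  exact Submodule.starProjection_eq_self_iff.mpr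
    (Submodule.le_topologicalClosure _ (Submodule.subset_span ⟨d, hd, ξ, rfl⟩))

theorem isClosed_setOf_mul_universalRep (S T : UniversalSpace B →L[ℂ] UniversalSpace B) :
    IsClosed {x : B | S * universalRep B x = T * universalRep B x} :=
  isClosed_eq (continuous_const.mul (universalRep B).continuous_of_cstar)
    (continuous_const.mul (universalRep B).continuous_of_cstar)

theorem proj_mul_universalRep {s : G} {x : B} (hx : x ∈ δ.spectral s) :
    δ.proj s * universalRep B x = universalRep B x := by
  have := spectral_induction_left hx (isClosed_setOf_mul_universalRep (δ.proj s) 1) fun e he => by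
    change _ * universalRep B (e * x) = 1 * universalRep B (e * x)
    rw [map_mul, ← mul_assoc, proj_mul_universalRep_of_mem_rangeIdeal he, one_mul]
  simpa using this

theorem universalRep_mul_proj {s : G} {x : B} (hx : x ∈ δ.spectral s) :
    universalRep B x * δ.proj s⁻¹ = universalRep B x := by
  have h := congrArg star (proj_mul_universalRep (δ.star_mem_spectral hx))
  simpa [star_mul, StarHomClass.map_star, star_proj] using h

theorem universalRep_mul_proj_of_mem_rangeIdeal {s : G} {d : B} (hd : d ∈ δ.rangeIdeal s) :
    universalRep B d * δ.proj s = universalRep B d := by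
  have h := congrArg star (proj_mul_universalRep_of_mem_rangeIdeal (star_mem_rangeIdeal hd))
  simpa [star_mul, StarHomClass.map_star, star_proj] using h

/-- The vectors `d ξ` with `d ∈ D_s` are total in the range of `p_s`. Identities involving `p_s` are
thus reduced to identities in `B`. -/
theorem mul_proj_eq_of_forall {s : G} {S T : UniversalSpace B →L[ℂ] UniversalSpace B}
    (h : ∀ d ∈ δ.rangeIdeal s, S * universalRep B d = T * universalRep B d) :
    S * δ.proj s = T * δ.proj s := by
  ext1 ξ
  have h1 : δ.proj s ξ ∈ (Submodule.span ℂ {η : UniversalSpace B | ∃ d ∈ δ.rangeIdeal s, ∃ ξ,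
    η = universalRep B d ξ}).topologicalClosure := Submodule.starProjection_apply_mem _ _
  have h2 := Submodule.topologicalClosure_minimal _ (t := LinearMap.ker (S - T).toLinearMap)
    (Submodule.span_le.mpr (by
      rintro _ ⟨d, hd, ζ, rfl⟩
      have := congrArg (fun R : UniversalSpace B →L[ℂ] UniversalSpace B => R ζ) (h d hd)
      exact sub_eq_zero.mpr this)) (S - T).isClosed_ker h1
  exact sub_eq_zero.mp h2

theorem proj_mul_eq_of_forall {s : G} {S T : UniversalSpace B →L[ℂ] UniversalSpace B}
    (h : ∀ d ∈ δ.rangeIdeal s, universalRep B d * S = universalRep B d * T) :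
    δ.proj s * S = δ.proj s * T := by
  have := mul_proj_eq_of_forall (δ := δ) (s := s) (S := star S) (T := star T) fun d hd => by
    have := congrArg star (h (star d) (star_mem_rangeIdeal hd))
    simpa [star_mul, StarHomClass.map_star] using this
  simpa [star_mul, star_proj] using congrArg star this

/-- Since `D_s` is an ideal of `B_e`, the range of `p_s` is invariant under `b` and under `b⋆`. -/
theorem proj_commute_universalRep (s : G) {b : B} (hb : b ∈ δ.spectral 1) :
    δ.proj s * universalRep B b = universalRep B b * δ.proj s := by
  have h1 : ∀ b ∈ δ.spectral 1, δ.proj s * universalRep B b * δ.proj s =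
      universalRep B b * δ.proj s := fun b hb =>
    mul_proj_eq_of_forall fun d hd => by
      rw [mul_assoc, ← map_mul, proj_mul_universalRep_of_mem_rangeIdeal (mul_mem_rangeIdeal hb hd)]
  have h2 := congrArg star (h1 (star b) (star_mem_spectral_one hb))
  simp only [star_mul, StarHomClass.map_star, star_star, star_proj] at h2
  exact h2.symm.trans ((mul_assoc _ _ _).symm.trans (h1 b hb))

theorem proj_commute (s t : G) : Commute (δ.proj s) (δ.proj t) := by
  have h1 : δ.proj t * δ.proj s * δ.proj t = δ.proj s * δ.proj t :=
    mul_proj_eq_of_forall fun d hd => by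
      rw [mul_assoc, proj_commute_universalRep s (δ.rangeIdeal_le t hd), ← mul_assoc,
        proj_mul_universalRep_of_mem_rangeIdeal hd]
  have h2 := congrArg star h1
  simp only [star_mul, star_proj] at h2
  exact h1.symm.trans ((mul_assoc _ _ _).trans h2)

/-- Every `x ∈ B_s` is a limit of products `x e` with `e ∈ D_{s⁻¹} ⊆ B_e = D_e`, so `x p_e = x`.
Density of the spectral subspaces extends this to all of `B`, and the universal representation is
nondegenerate. -/
theorem proj_one (hδ : δ.IsNormal) : δ.proj 1 = 1 := by
  have h1 : ∀ b : B, universalRep B b * δ.proj 1 = universalRep B b := fun b => by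
    let f : B →L[ℂ] (UniversalSpace B →L[ℂ] UniversalSpace B) :=
      (((ContinuousLinearMap.mul ℂ (UniversalSpace B →L[ℂ] UniversalSpace B)).flip
        (δ.proj 1 - 1))).comp (universalRep B).toCLM
    have hf : ∀ b, f b = universalRep B b * (δ.proj 1 - 1) := fun b => rfl
    have h2 := Submodule.topologicalClosure_minimal _ (t := LinearMap.ker f.toLinearMap)
      (Submodule.span_le.mpr (by
        rintro x ⟨s, hx⟩
        change f x = 0
        rw [hf]
        have h3 := spectral_induction_right hx (S := {x | f x = 0})
          (isClosed_eq f.continuous continuous_const) fun e he => by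
            change f (x * e) = 0
            have he' : e ∈ δ.rangeIdeal 1 := rangeIdeal_one (δ := δ) ▸ δ.rangeIdeal_le _ he
            rw [hf, map_mul, mul_assoc, mul_sub, mul_one,
              universalRep_mul_proj_of_mem_rangeIdeal he', sub_self, mul_zero]
        exact h3)) f.isClosed_ker (mem_closure_span_spectral hδ b)
    have h3 : f b = 0 := h2
    rw [hf, mul_sub, mul_one, sub_eq_zero] at h3
    exact h3
  ext1 ξ
  rw [← sub_eq_zero, ← sub_apply]
  refine eq_zero_of_forall_universalRep_apply_eq_zero _ fun a => ?_
  have := congrArg (fun R : UniversalSpace B →L[ℂ] UniversalSpace B => R ξ) (h1 a)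
  rw [sub_apply, map_sub, sub_eq_zero]
  exact this

end Coaction

end

/-! ### Partial representations and module isomorphisms -/

noncomputable section

section StarSemigroup

variable {R : Type v} [Semigroup R] [StarMul R]

theorem mul_star_mul_star_mul_star {a b m p : R} (hm : star m * m = p) (ha : a * p = a) :
    a * star m * star (b * star m) = a * star b := by
  rw [star_mul, star_star, mul_assoc, ← mul_assoc (star m), hm, ← mul_assoc, ha]

/-- Multiplicativity of `x ↦ x m_s⋆` in abstract form, with `u`, `v`, `w` for `m_s`, `m_t`,
`m_{st}`. Because `b` commutes with the source projection of `u`, one has `x y = a (u b u⋆)(u v)`,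
so a factor `u v` stands next to `w⋆` and the extension property replaces `w⋆` by `(u v)⋆`. -/
theorem mul_mul_star_of_extend {a b x y u v w p : R} (hu : u * star u * u = u)
    (hp : star u * u = p) (hb : p * b = b * p) (hx : x = a * u) (hy : y = b * v)
    (hext : u * v * star (u * v) = u * v * star w) :
    x * y * star w = x * (y * star v) * star u := by
  have h : x * y = a * (u * b * star u) * (u * v) := by
    have h1 : u * b = u * b * star u * u := by
      rw [mul_assoc _ (star u), hp, mul_assoc, ← hb, ← mul_assoc, ← hp, ← mul_assoc, hu]
    calc x * y = a * (u * b) * v := by rw [hx, hy]; simp only [mul_assoc]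
      _ = a * (u * b * star u * u) * v := by rw [← h1]
      _ = _ := by simp only [mul_assoc]
  calc x * y * star w = a * (u * b * star u) * (u * v * star w) := by rw [h, mul_assoc]
    _ = x * y * star (u * v) := by rw [← hext, ← mul_assoc, ← h]
    _ = _ := by rw [star_mul]; simp only [mul_assoc]

end StarSemigroup

namespace Coaction

variable {G B : Type u} [Group G] [NonUnitalCStarAlgebra B] [PartialOrder B] [StarOrderedRing B]
  {δ : Coaction G B}

theorem universalRep_mul (a b : B) :
    universalRep B (a * b) = universalRep B a * universalRep B b := map_mul _ a b

theorem universalRep_star (a : B) : universalRep B (star a) = star (universalRep B a) :=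
  map_star _ a

theorem isClosed_universalRep_image {W : Submodule ℂ B} (hW : IsClosed (W : Set B)) :
    IsClosed (universalRep B '' (W : Set B)) :=
  (NonUnitalStarAlgHom.isometry _ (universalRep_injective B)).isClosedEmbedding.isClosedMap _ hW

/-- On products, `x e m⋆ = x (m e⋆)⋆`, and `m e⋆` lies in `B_s` because `m` is a multiplier; the
image of `D_s` is closed. -/
theorem exists_universalRep_eq_mul_star {s : G} {m : UniversalSpace B →L[ℂ] UniversalSpace B}
    (hm : m ∈ δ.multiplierBimodule s) {x : B} (hx : x ∈ δ.spectral s) :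
    ∃ d ∈ δ.rangeIdeal s, universalRep B d = universalRep B x * star m := by
  refine spectral_induction_right hx
    (S := {x : B | universalRep B x * star m ∈ universalRep B '' (δ.rangeIdeal s : Set B)})
    ((isClosed_universalRep_image (isClosed_rangeIdeal s)).preimage
      ((universalRep B).continuous_of_cstar.mul continuous_const)) fun e he => ?_
  obtain ⟨y, hy, hy'⟩ := hm.2.2 (star e) (star_mem_rangeIdeal he)
  refine ⟨x * star y, mul_star_mem_rangeIdeal hx hy, ?_⟩
  rw [universalRep_mul, universalRep_mul, universalRep_star, ← hy', star_mul, universalRep_star, star_star,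
    mul_assoc]

theorem exists_linearEquiv {s : G} {m : UniversalSpace B →L[ℂ] UniversalSpace B}
    (hm : m ∈ δ.multiplierBimodule s) (h₁ : m * star m = δ.proj s)
    (h₂ : star m * m = δ.proj s⁻¹) :
    ∃ e : δ.spectral s ≃ₗ[ℂ] δ.rangeIdeal s, ∀ x : δ.spectral s,
      universalRep B (e x : B) = universalRep B (x : B) * star m := by
  choose f hf hf' using fun x : δ.spectral s => exists_universalRep_eq_mul_star hm x.2
  -- The inverse of `x ↦ x m⋆` is `d ↦ d m`.
  choose g hg hg' using fun d : δ.rangeIdeal s => hm.2.1 d d.2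
  have hinj := universalRep_injective B
  exact ⟨
    { toFun := fun x => ⟨f x, hf x⟩
      map_add' := fun x y => Subtype.ext (hinj (by
        change universalRep B (f (x + y)) = universalRep B (f x + f y)
        rw [map_add, hf', hf', hf', Submodule.coe_add, map_add, add_mul]))
      map_smul' := fun c x => Subtype.ext (hinj (by
        change universalRep B (f (c • x)) = universalRep B (c • f x)
        rw [map_smul, hf', hf', Submodule.coe_smul, map_smul, smul_mul_assoc]))
      invFun := fun d => ⟨g d, hg d⟩
      left_inv := fun x => Subtype.ext (hinj (by
        change universalRep B (g ⟨f x, hf x⟩) = _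
        rw [← hg', hf', mul_assoc, h₂, universalRep_mul_proj x.2]))
      right_inv := fun d => Subtype.ext (hinj (by
        change universalRep B (f ⟨g d, hg d⟩) = _
        rw [hf', ← hg', mul_assoc, h₁, universalRep_mul_proj_of_mem_rangeIdeal d.2])) }, hf'⟩

theorem exists_moduleIso {s : G} {m : UniversalSpace B →L[ℂ] UniversalSpace B}
    (hm : m ∈ δ.multiplierBimodule s) (h₁ : m * star m = δ.proj s)
    (h₂ : star m * m = δ.proj s⁻¹) :
    ∃ ψ : δ.ModuleIso s, ∀ x : δ.spectral s,
      universalRep B (ψ.equiv x : B) = universalRep B (x : B) * star m := by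
  obtain ⟨e, he⟩ := exists_linearEquiv hm h₁ h₂
  have hinj := universalRep_injective B
  refine ⟨⟨e, fun d x => hinj ?_, fun x y => hinj ?_⟩, he⟩
  · rw [he, universalRep_mul (d : B) (x : B), universalRep_mul (d : B) (e x), he x, mul_assoc]
  · rw [universalRep_mul (e x : B), universalRep_mul (x : B), universalRep_star (e y : B),
      universalRep_star (y : B), he x, he y]
    exact mul_star_mul_star_mul_star h₂ (universalRep_mul_proj x.2)

theorem exists_moduleIso_of_partialRepresentation
    {m : G → (UniversalSpace B →L[ℂ] UniversalSpace B)} (hm : IsPartialRepresentation m)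
    (hm' : ∀ s, m s ∈ δ.multiplierBimodule s ∧ m s * star (m s) = δ.proj s) :
    ∃ ψ : ∀ s, δ.ModuleIso s, ∀ (s t : G) (x : δ.spectral s) (y : δ.spectral t),
      ((ψ (s * t)).equiv ⟨(x : B) * y, δ.mul_mem_spectral x.2 y.2⟩ : B) =
        (ψ s).equiv ⟨(x : B) * ((ψ t).equiv y : B),
          δ.mul_rangeIdeal_mem x.2 ((ψ t).equiv y).2⟩ := by
  have h₂ : ∀ s, star (m s) * m s = δ.proj s⁻¹ := fun s => (hm.inv s).trans (hm' s⁻¹).2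
  choose ψ hψ using fun s => exists_moduleIso (hm' s).1 (hm' s).2 (h₂ s)
  refine ⟨ψ, fun s t x y => universalRep_injective B ?_⟩
  have hx : universalRep B (x : B) = universalRep B ((ψ s).equiv x : B) * m s := by
    rw [hψ, mul_assoc, h₂, universalRep_mul_proj x.2]
  have hy : universalRep B (y : B) = universalRep B ((ψ t).equiv y : B) * m t := by
    rw [hψ, mul_assoc, h₂, universalRep_mul_proj y.2]
  have key := mul_mul_star_of_extend (hm.partialIsometry s) (h₂ s)
    (proj_commute_universalRep s⁻¹ (δ.rangeIdeal_le t ((ψ t).equiv y).2)) hx hy (hm.extend s t)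
  rw [hψ, hψ, universalRep_mul (x : B) (y : B), universalRep_mul (x : B), hψ t y]
  exact key

end Coaction

end

/-! ### From module isomorphisms to a partial representation in the double dual -/

noncomputable section

namespace Coaction

variable {G B : Type u} [Group G] [NonUnitalCStarAlgebra B] [PartialOrder B] [StarOrderedRing B]
  {δ : Coaction G B}

theorem rangeIdeal_inv_le_of_forall {s : G} {W : Submodule ℂ B} (hW : IsClosed (W : Set B))
    (h : ∀ x ∈ δ.spectral s, ∀ y ∈ δ.spectral s, star x * y ∈ W) : δ.rangeIdeal s⁻¹ ≤ W :=
  rangeIdeal_le_of_forall hW fun x hx y hy => by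
    simpa using h (star x) (star_mem_spectral_inv hx) (star y) (star_mem_spectral_inv hy)

theorem mul_proj_inv_eq_of_forall {s : G} {S T : UniversalSpace B →L[ℂ] UniversalSpace B}
    (h : ∀ x ∈ δ.spectral s, S * star (universalRep B x) = T * star (universalRep B x)) :
    S * δ.proj s⁻¹ = T * δ.proj s⁻¹ := by
  refine mul_proj_eq_of_forall fun d hd => ?_
  let f : B →L[ℂ] (UniversalSpace B →L[ℂ] UniversalSpace B) :=
    ((ContinuousLinearMap.mul ℂ (UniversalSpace B →L[ℂ] UniversalSpace B)) (S - T)).comp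
      (universalRep B).toCLM
  have hf : ∀ b, f b = S * universalRep B b - T * universalRep B b := fun b =>
    sub_mul S T (universalRep B b)
  have := rangeIdeal_inv_le_of_forall (δ := δ) (s := s) (W := LinearMap.ker f.toLinearMap)
    f.isClosed_ker (fun x hx y hy => by
      change f (star x * y) = 0
      rw [hf, universalRep_mul, universalRep_star, ← mul_assoc, ← mul_assoc, h x hx, sub_self]) hd
  exact sub_eq_zero.mp ((hf d).symm.trans this)

theorem proj_mul_commute_of_mem_centralizer (s : G)
    {T : UniversalSpace B →L[ℂ] UniversalSpace B}
    (hT : ∀ b, universalRep B b * T = T * universalRep B b) : δ.proj s * T = T * δ.proj s := by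
  have key : ∀ T : UniversalSpace B →L[ℂ] UniversalSpace B,
      (∀ b, universalRep B b * T = T * universalRep B b) →
      δ.proj s * T * δ.proj s = T * δ.proj s := fun T hT => mul_proj_eq_of_forall fun d hd => by
    rw [mul_assoc, ← hT, ← mul_assoc, proj_mul_universalRep_of_mem_rangeIdeal hd]
  have h1 := congrArg star (key (star T) fun b => by
    have := congrArg star (hT (star b))
    simpa [star_mul, universalRep_star] using this.symm)
  simp only [star_mul, star_star, star_proj] at h1
  rw [← h1, ← mul_assoc, key T hT]

/-- The operator is `m(x⋆h) = ψ(x)⋆h`. It preserves inner products since `⟨x⋆h, y⋆k⟩ = ⟨h, x y⋆ k⟩`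
and `ψ` preserves `x y⋆`, and it is put to zero on the orthogonal complement. -/
theorem exists_partialIsometry_of_moduleIso {s : G} (ψ : δ.ModuleIso s) :
    ∃ m : UniversalSpace B →L[ℂ] UniversalSpace B,
      (∀ x : δ.spectral s, universalRep B (x : B) * star m = universalRep B (ψ.equiv x : B)) ∧
      (∀ x : δ.spectral s, universalRep B (ψ.equiv x : B) * m = universalRep B (x : B)) ∧
      m * δ.proj s⁻¹ = m ∧ δ.proj s * m = m := by
  -- Formal sums of pairs `(x, h)` are the common domain of `(x, h) ↦ x⋆h` and `(x, h) ↦ ψ(x)⋆h`, so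
  -- well-definedness on vectors need not be discussed.
  let F : (δ.spectral s → B) → ((δ.spectral s →₀ UniversalSpace B) →ₗ[ℂ] UniversalSpace B) :=
    fun φ => Finsupp.lsum ℂ fun x => (star (universalRep B (φ x))).toLinearMap
  have hF : ∀ φ x h, F φ (Finsupp.single x h) = star (universalRep B (φ x)) h := fun φ x h => by
    simp [F]
  have hinner : ∀ a b h k, ⟪star (universalRep B a) h, star (universalRep B b) k⟫_ℂ =
      ⟪h, universalRep B (a * star b) k⟫_ℂ := fun a b h k => by
    rw [ContinuousLinearMap.star_eq_adjoint, ContinuousLinearMap.adjoint_inner_left,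
      universalRep_mul, universalRep_star]
    rfl
  obtain ⟨m, h1, h2, h3, h4⟩ := exists_partialIsometry (F fun x => x) (F fun x => ψ.equiv x) (by
    intro v w
    induction v using Finsupp.induction_linear with
    | zero => simp
    | add v v' h h' => rw [map_add, map_add, inner_add_left, inner_add_left, h, h']
    | single x h =>
      induction w using Finsupp.induction_linear with
      | zero => simp
      | add v v' h h' => rw [map_add, map_add, inner_add_right, inner_add_right, h, h']
      | single y k => rw [hF, hF, hF, hF, hinner, hinner, ψ.map_inner])
  have horth : ∀ φ ξ, (∀ x, universalRep B (φ x) ξ = 0) → ∀ v, ⟪F φ v, ξ⟫_ℂ = 0 := by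
    intro φ ξ hξ v
    induction v using Finsupp.induction_linear with
    | zero => simp
    | add v v' h h' => rw [map_add, inner_add_left, h, h', add_zero]
    | single x h =>
      rw [hF, ContinuousLinearMap.star_eq_adjoint, ContinuousLinearMap.adjoint_inner_left, hξ,
        inner_zero_right]
  refine ⟨m, fun x => ?_, fun x => ?_, ?_, ?_⟩
  · have : m * star (universalRep B (x : B)) = star (universalRep B (ψ.equiv x : B)) := by
      ext1 h
      have := h1 (Finsupp.single x h)
      rwa [hF, hF] at this
    simpa only [star_mul, star_star] using congrArg star this
  · have : star m * star (universalRep B (ψ.equiv x : B)) = star (universalRep B (x : B)) := by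
      ext1 h
      have := h3 (Finsupp.single x h)
      rwa [hF, hF] at this
    simpa only [star_mul, star_star] using congrArg star this
  · ext1 ξ
    have := h2 (ξ - δ.proj s⁻¹ ξ) (horth _ _ fun x => by
      rw [map_sub, sub_eq_zero]
      exact (congrArg (fun T => T ξ) (universalRep_mul_proj x.2)).symm)
    rw [map_sub, sub_eq_zero] at this
    exact this.symm
  · have h5 : star m * δ.proj s = star m := by
      ext1 ξ
      have := h4 (ξ - δ.proj s ξ) (horth _ _ fun x => by
        rw [map_sub, sub_eq_zero]
        exact (congrArg (fun T => T ξ) (universalRep_mul_proj_of_mem_rangeIdeal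
          (ψ.equiv x).2)).symm)
      rw [map_sub, sub_eq_zero] at this
      exact this.symm
    simpa only [star_mul, star_star, star_proj] using congrArg star h5

theorem mul_universalRep_star_eq {s : G} {ψ : δ.ModuleIso s}
    {m : UniversalSpace B →L[ℂ] UniversalSpace B}
    (h : ∀ x : δ.spectral s, universalRep B (x : B) * star m = universalRep B (ψ.equiv x : B))
    (x : δ.spectral s) :
    m * star (universalRep B (x : B)) = star (universalRep B (ψ.equiv x : B)) := by
  simpa only [star_mul, star_star] using congrArg star (h x)

/-- An operator `T` in the commutant satisfies `T m x⋆ = T ψ(x)⋆ = ψ(x)⋆ T = m x⋆ T = m T x⋆`. Hence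
`T m` and `m T` agree on the range of `p_{s⁻¹}`, and `p_{s⁻¹}` itself commutes with `T`. -/
theorem mem_doubleDual_of_moduleIso {s : G} {ψ : δ.ModuleIso s}
    {m : UniversalSpace B →L[ℂ] UniversalSpace B}
    (h : ∀ x : δ.spectral s, universalRep B (x : B) * star m = universalRep B (ψ.equiv x : B))
    (hm : m * δ.proj s⁻¹ = m) : m ∈ doubleDual B := by
  have key : ∀ T : UniversalSpace B →L[ℂ] UniversalSpace B,
      (∀ b, universalRep B b * T = T * universalRep B b) → T * m = m * T := by
    intro T hT
    have h1 : T * m * δ.proj s⁻¹ = m * T * δ.proj s⁻¹ := mul_proj_inv_eq_of_forall fun x hx => by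
      rw [mul_assoc, mul_assoc, mul_universalRep_star_eq h ⟨x, hx⟩, ← universalRep_star,
        ← universalRep_star, ← hT, ← hT, ← mul_assoc, universalRep_star, universalRep_star,
        mul_universalRep_star_eq h ⟨x, hx⟩]
    rw [mul_assoc, hm, mul_assoc, ← proj_mul_commute_of_mem_centralizer s⁻¹ hT, ← mul_assoc, hm]
      at h1
    exact h1
  rw [doubleDual, StarSubalgebra.mem_centralizer_iff]
  intro T hT
  have hT := (StarSubalgebra.mem_centralizer_iff ℂ).mp hT
  refine ⟨key T fun b => (hT _ ⟨b, rfl⟩).1, key (star T) fun b => ?_⟩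
  simpa using (congrArg star (hT _ ⟨b, rfl⟩).2).symm

/-- If `d = ψ(x)` then `d m = x`. On the other side `m x⋆ y = ψ(x)⋆ y ∈ D_s B_s`, and the products
`x⋆ y` span a dense subspace of `D_{s⁻¹}`. -/
theorem mem_multiplierBimodule_of_moduleIso {s : G} {ψ : δ.ModuleIso s}
    {m : UniversalSpace B →L[ℂ] UniversalSpace B}
    (h : ∀ x : δ.spectral s, universalRep B (x : B) * star m = universalRep B (ψ.equiv x : B))
    (h' : ∀ x : δ.spectral s, universalRep B (ψ.equiv x : B) * m = universalRep B (x : B))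
    (hm : m * δ.proj s⁻¹ = m) (hm' : δ.proj s * m = m) : m ∈ δ.multiplierBimodule s := by
  refine ⟨⟨m, mem_doubleDual_of_moduleIso h hm, by rw [hm', hm]⟩, fun d hd => ?_, fun d hd => ?_⟩
  · refine ⟨_, (ψ.equiv.symm ⟨d, hd⟩).2, ?_⟩
    rw [← h', LinearEquiv.apply_symm_apply]
  · let f : B →L[ℂ] (UniversalSpace B →L[ℂ] UniversalSpace B) :=
      ((ContinuousLinearMap.mul ℂ (UniversalSpace B →L[ℂ] UniversalSpace B)) m).comp
        (universalRep B).toCLM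
    have := rangeIdeal_inv_le_of_forall (δ := δ) (s := s)
      (W := ((δ.spectral s).map (universalRep B).toCLM.toLinearMap).comap f.toLinearMap)
      ((isClosed_universalRep_image (δ.isClosed_spectral s)).preimage f.continuous)
      (fun x hx y hy => ⟨star (ψ.equiv ⟨x, hx⟩ : B) * y,
        δ.rangeIdeal_mul_mem (star_mem_rangeIdeal (ψ.equiv ⟨x, hx⟩).2) hy, by
        change universalRep B _ = m * universalRep B _
        rw [universalRep_mul, universalRep_mul, universalRep_star, universalRep_star, ← mul_assoc,
          mul_universalRep_star_eq h ⟨x, hx⟩]⟩) hd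
    obtain ⟨x, hx, hx'⟩ := this
    exact ⟨x, hx, hx'.symm⟩

theorem mul_star_eq_proj_of_moduleIso {s : G} {ψ : δ.ModuleIso s}
    {m : UniversalSpace B →L[ℂ] UniversalSpace B}
    (h : ∀ x : δ.spectral s, universalRep B (x : B) * star m = universalRep B (ψ.equiv x : B))
    (h' : ∀ x : δ.spectral s, universalRep B (ψ.equiv x : B) * m = universalRep B (x : B))
    (hm' : δ.proj s * m = m) : m * star m = δ.proj s := by
  have := proj_mul_eq_of_forall (δ := δ) (s := s) (S := m * star m) (T := 1) fun d hd => by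
    have := h' (ψ.equiv.symm ⟨d, hd⟩)
    rw [LinearEquiv.apply_symm_apply] at this
    rw [← mul_assoc, this, h, LinearEquiv.apply_symm_apply, mul_one]
  rwa [← mul_assoc, hm', mul_one] at this

theorem star_mul_eq_proj_of_moduleIso {s : G} {ψ : δ.ModuleIso s}
    {m : UniversalSpace B →L[ℂ] UniversalSpace B}
    (h : ∀ x : δ.spectral s, universalRep B (x : B) * star m = universalRep B (ψ.equiv x : B))
    (h' : ∀ x : δ.spectral s, universalRep B (ψ.equiv x : B) * m = universalRep B (x : B))
    (hm : m * δ.proj s⁻¹ = m) : star m * m = δ.proj s⁻¹ := by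
  have := mul_proj_inv_eq_of_forall (δ := δ) (s := s) (S := star m * m) (T := 1)
    fun x hx => by
      rw [mul_assoc, mul_universalRep_star_eq h ⟨x, hx⟩, one_mul]
      simpa only [star_mul, star_star] using congrArg star (h' ⟨x, hx⟩)
  rwa [mul_assoc, hm, one_mul] at this

/-- If `u D_t v a = u D_t v b` in the universal representation, then `u v a = u v b`. -/
theorem mul_mul_eq_of_forall_rangeIdeal {s t : G}
    {u v a b : UniversalSpace B →L[ℂ] UniversalSpace B}
    (hu : star u * u = δ.proj s) (hu' : u * δ.proj s = u) (hv : δ.proj t * v = v)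
    (h : ∀ f ∈ δ.rangeIdeal t, u * universalRep B f * (v * a) = u * universalRep B f * (v * b)) :
    u * v * a = u * v * b := by
  -- Since `p_s` and `p_t` commute and `p_t v = v`, the vectors `p_s v T ξ` stay in the range of
  -- `p_t`; elements of `D_t` therefore suffice to test them.
  have h8 : ∀ T, δ.proj t * (δ.proj s * (v * T)) = δ.proj s * (v * T) := fun T => by
    rw [← mul_assoc, (proj_commute t s).eq, mul_assoc, ← mul_assoc (δ.proj t), hv]
  have h9 : δ.proj s * (v * a) = δ.proj s * (v * b) := by
    rw [← h8 a, ← h8 b]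
    refine proj_mul_eq_of_forall fun f hf => ?_
    have h10 : ∀ T, universalRep B f * (δ.proj s * T) = star u * (u * universalRep B f * T) :=
      fun T => by
        rw [← mul_assoc, ← proj_commute_universalRep s (δ.rangeIdeal_le t hf), ← hu]
        simp only [mul_assoc]
    rw [h10 (v * a), h10 (v * b), h f hf]
  have h11 : ∀ T, u * v * T = u * (δ.proj s * (v * T)) := fun T => by
    rw [← mul_assoc, hu', mul_assoc]
  rw [h11 a, h11 b, h9]

set_option maxHeartbeats 800000 in
-- Multiplicativity of `ψ` says `x y m_{st}⋆ = x (y m_t⋆) m_s⋆ = x y (m_s m_t)⋆`. With `e = ψ_s(x)`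
-- and `f = ψ_t(y)` one has `x y = e m_s f m_t`, so the extension property holds after inserting an
-- arbitrary `e ∈ D_s` on the left and `f ∈ D_t` in the middle. Here `e` is removed;
-- `mul_mul_eq_of_forall_rangeIdeal` removes `f`.
theorem mul_star_mul_eq_of_moduleIso (ψ : ∀ s, δ.ModuleIso s)
    (hψ : ∀ (s t : G) (x : δ.spectral s) (y : δ.spectral t),
      ((ψ (s * t)).equiv ⟨(x : B) * y, δ.mul_mem_spectral x.2 y.2⟩ : B) =
        (ψ s).equiv ⟨(x : B) * ((ψ t).equiv y : B),
          δ.mul_rangeIdeal_mem x.2 ((ψ t).equiv y).2⟩)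
    {m : G → (UniversalSpace B →L[ℂ] UniversalSpace B)}
    (h1 : ∀ s, ∀ x : δ.spectral s,
      universalRep B (x : B) * star (m s) = universalRep B ((ψ s).equiv x : B))
    (h2 : ∀ s, ∀ x : δ.spectral s,
      universalRep B ((ψ s).equiv x : B) * m s = universalRep B (x : B))
    (h4 : ∀ s, δ.proj s * m s = m s) (s t : G) {f : B} (hf : f ∈ δ.rangeIdeal t) :
    m s * universalRep B f * (m t * star (m s * m t)) =
      m s * universalRep B f * (m t * star (m (s * t))) := by
  have hm : ∀ T, m s * universalRep B f * T = δ.proj s * (m s * universalRep B f * T) :=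
    fun T => by rw [← mul_assoc, ← mul_assoc, h4]
  rw [hm, hm (m t * star (m (s * t)))]
  refine proj_mul_eq_of_forall fun e he => ?_
  obtain ⟨x, hx⟩ := (ψ s).equiv.surjective ⟨e, he⟩
  obtain ⟨y, hy⟩ := (ψ t).equiv.surjective ⟨f, hf⟩
  have hxe := h2 s x
  have hyf := h2 t y
  rw [hx] at hxe
  rw [hy] at hyf
  have hw : ∀ T, universalRep B e * (m s * universalRep B f * (m t * T)) =
      universalRep B (x : B) * universalRep B (y : B) * T := fun T => by
    rw [← hxe, ← hyf]
    simp only [mul_assoc]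
  have h3 := h1 (s * t) ⟨x * y, δ.mul_mem_spectral x.2 y.2⟩
  rw [hψ, ← h1, universalRep_mul (x : B) (y : B), universalRep_mul (x : B), ← h1 t y] at h3
  rw [hw, hw, h3, star_mul]
  simp only [mul_assoc]

theorem exists_partialRepresentation_of_moduleIso (hδ : δ.IsNormal) (ψ : ∀ s, δ.ModuleIso s)
    (hψ : ∀ (s t : G) (x : δ.spectral s) (y : δ.spectral t),
      ((ψ (s * t)).equiv ⟨(x : B) * y, δ.mul_mem_spectral x.2 y.2⟩ : B) =
        (ψ s).equiv ⟨(x : B) * ((ψ t).equiv y : B),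
          δ.mul_rangeIdeal_mem x.2 ((ψ t).equiv y).2⟩) :
    ∃ m : G → (UniversalSpace B →L[ℂ] UniversalSpace B), IsPartialRepresentation m ∧
      ∀ s, m s ∈ δ.multiplierBimodule s ∧ m s * star (m s) = δ.proj s := by
  choose m h1 h2 h3 h4 using fun s => exists_partialIsometry_of_moduleIso (ψ s)
  have h5 := fun s => mul_star_eq_proj_of_moduleIso (h1 s) (h2 s) (h4 s)
  have h6 := fun s => star_mul_eq_proj_of_moduleIso (h1 s) (h2 s) (h3 s)
  exact ⟨m, ⟨fun s => by rw [h5, h4], fun s t => by rw [h5, h5]; exact proj_commute s t,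
    by rw [h5, proj_one hδ], fun s => by rw [h6, h5], fun s t =>
      mul_mul_eq_of_forall_rangeIdeal (h6 s) (h3 s) (h4 t) fun f hf =>
        mul_star_mul_eq_of_moduleIso ψ hψ h1 h2 h4 s t hf⟩,
    fun s => ⟨mem_multiplierBimodule_of_moduleIso (h1 s) (h2 s) (h3 s) (h4 s), h5 s⟩⟩

end Coaction

end

/-! ### The regular representation of a partial action -/

noncomputable section

theorem clm_ext_of_universalRep {A : Type u} [NonUnitalCStarAlgebra A] [PartialOrder A]
    [StarOrderedRing A] {E : Type v} [NormedAddCommGroup E] [NormedSpace ℂ E] (J : Set A)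
    (hJ : ∀ c ∈ J, star c ∈ J) {S T : UniversalSpace A →L[ℂ] E}
    (h : ∀ c ∈ J, ∀ ξ, S (universalRep A c ξ) = T (universalRep A c ξ))
    (h' : ∀ ξ, (∀ c ∈ J, universalRep A c ξ = 0) → S ξ = T ξ) : S = T := by
  let F : (J →₀ UniversalSpace A) →ₗ[ℂ] UniversalSpace A :=
    Finsupp.lsum ℂ fun c => (universalRep A c).toLinearMap
  have hF : ∀ c h, F (Finsupp.single c h) = universalRep A c h := fun c h => by simp [F]
  refine clm_ext_of_range F (fun v => ?_) fun ξ hξ => h' ξ fun c hc => ?_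
  · induction v using Finsupp.induction_linear with
    | zero => simp
    | add v w hv hw => rw [map_add, map_add, map_add, hv, hw]
    | single c k => rw [hF]; exact h c c.2 k
  · refine ext_inner_left ℂ fun k => ?_
    have := hξ (Finsupp.single ⟨star c, hJ c hc⟩ k)
    rw [hF] at this
    change ⟪universalRep A (star c) k, ξ⟫_ℂ = 0 at this
    rw [map_star, ContinuousLinearMap.star_eq_adjoint,
      ContinuousLinearMap.adjoint_inner_left] at this
    rw [this, inner_zero_right]

namespace PartialAction

section Rel

variable {G A : Type u} [Group G] [NonUnitalCStarAlgebra A] (P : PartialAction G A)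

/-- The graph of `α_s`. -/
def Rel (s : G) (a b : A) : Prop := ∃ h : a ∈ P.D s⁻¹, (P.α s ⟨a, h⟩ : A) = b

variable {P} {s t : G} {a b c d : A}

theorem Rel.mem_left (h : P.Rel s a b) : a ∈ P.D s⁻¹ := h.1

theorem Rel.mem_right (h : P.Rel s a b) : b ∈ P.D s := by
  obtain ⟨h, rfl⟩ := h
  exact (P.α s _).2

theorem exists_rel_left (h : a ∈ P.D s⁻¹) : ∃ b, P.Rel s a b := ⟨_, h, rfl⟩

theorem rel_symm (b : P.D s) : P.Rel s ((P.α s).symm b : P.D s⁻¹) b :=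
  ⟨((P.α s).symm b).2, by simp⟩

theorem exists_rel_right (h : b ∈ P.D s) : ∃ a, P.Rel s a b := ⟨_, rel_symm ⟨b, h⟩⟩

theorem Rel.eq_symm (h : P.Rel s a b) : ((P.α s).symm ⟨b, h.mem_right⟩ : A) = a := by
  obtain ⟨h, rfl⟩ := h
  simp

theorem Rel.right_unique (h : P.Rel s a b) (h' : P.Rel s a c) : b = c := by
  obtain ⟨h, rfl⟩ := h
  obtain ⟨h', rfl⟩ := h'
  rfl

theorem Rel.left_unique (h : P.Rel s a c) (h' : P.Rel s b c) : a = b :=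
  h.eq_symm.symm.trans h'.eq_symm

theorem Rel.comp (h : P.Rel t a b) (h' : P.Rel s b c) : P.Rel (s * t) a c := by
  obtain ⟨h, rfl⟩ := h
  obtain ⟨h', rfl⟩ := h'
  exact P.extend s t ⟨a, h⟩ h'

theorem mem_D_one (a : A) : a ∈ P.D 1 := by rw [P.D_one]; trivial

/-- The map `α_e` is defined everywhere and extends `α_e ∘ α_e`, so it is an injective idempotent.
-/
theorem rel_one (a : A) : P.Rel 1 a a := by
  obtain ⟨b, hb⟩ := exists_rel_left (P := P) (s := 1) (a := a) (by rw [inv_one]; exact mem_D_one a)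
  obtain ⟨c, hc⟩ := exists_rel_left (P := P) (s := 1) (a := b) (by rw [inv_one]; exact mem_D_one b)
  have h := hb.comp hc
  rw [one_mul] at h
  obtain rfl := h.right_unique hb
  exact hb.left_unique hc ▸ hb

theorem Rel.inv (h : P.Rel s a b) : P.Rel s⁻¹ b a := by
  obtain ⟨c, hc⟩ := exists_rel_left (P := P) (s := s⁻¹) (a := b)
    (by rw [inv_inv]; exact h.mem_right)
  have h' := h.comp hc
  rw [inv_mul_cancel] at h'
  exact h'.right_unique (rel_one a) ▸ hc

theorem Rel.mul (h : P.Rel s a b) (h' : P.Rel s c d) : P.Rel s (a * c) (b * d) := by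
  obtain ⟨h, rfl⟩ := h
  obtain ⟨h', rfl⟩ := h'
  exact ⟨mul_mem h h', congrArg Subtype.val (map_mul (P.α s) ⟨a, h⟩ ⟨c, h'⟩)⟩

theorem Rel.add (h : P.Rel s a b) (h' : P.Rel s c d) : P.Rel s (a + c) (b + d) := by
  obtain ⟨h, rfl⟩ := h
  obtain ⟨h', rfl⟩ := h'
  exact ⟨add_mem h h', congrArg Subtype.val (map_add (P.α s) ⟨a, h⟩ ⟨c, h'⟩)⟩

theorem Rel.smul (k : ℂ) (h : P.Rel s a b) : P.Rel s (k • a) (k • b) := by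
  obtain ⟨h, rfl⟩ := h
  exact ⟨SMulMemClass.smul_mem k h, congrArg Subtype.val (map_smul (P.α s) k ⟨a, h⟩)⟩

theorem Rel.star (h : P.Rel s a b) : P.Rel s (star a) (star b) := by
  obtain ⟨h, rfl⟩ := h
  exact ⟨star_mem h, congrArg Subtype.val (map_star (P.α s) ⟨a, h⟩)⟩

/-- Writing `a = α_t(c)` gives `b = α_s(α_t(c)) = α_{st}(c)`: the composition axiom already contains
the domain condition `α_s(I_{s⁻¹} ∩ I_t) ⊆ I_{st}`. -/
theorem Rel.mem_of_mem (h : P.Rel s a b) (ha : a ∈ P.D t) : b ∈ P.D (s * t) := by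
  obtain ⟨c, hc⟩ := exists_rel_right ha
  exact (hc.comp h).mem_right

theorem Rel.mem_of_mem_right (h : P.Rel s a b) (hb : b ∈ P.D t) : a ∈ P.D (s⁻¹ * t) :=
  h.inv.mem_of_mem hb

theorem Rel.norm_eq (h : P.Rel s a b) : ‖b‖ = ‖a‖ := by
  obtain ⟨h, rfl⟩ := h
  have := P.isClosed_D s
  have := P.isClosed_D s⁻¹
  exact NonUnitalStarAlgHom.norm_map (P.α s) (P.α s).injective ⟨a, h⟩

end Rel

section ExtendedOp

variable {G A : Type u} [Group G] [NonUnitalCStarAlgebra A] [PartialOrder A] [StarOrderedRing A]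
  {P : PartialAction G A} {s t r : G} {a b c d e : A}

theorem Rel.twistedRep_eq (h : P.Rel t c d) :
    P.twistedRep t ⟨d, h.mem_right⟩ = universalRep A c := congrArg (universalRep A) h.eq_symm

theorem Rel.extendedOp_apply (h : P.Rel t c d) (h' : P.Rel t e (a * d)) (ξ : UniversalSpace A) :
    P.extendedOp t a (universalRep A c ξ) = universalRep A e ξ := by
  rw [← h.twistedRep_eq, ← h'.twistedRep_eq]
  exact idealExtension_apply (P.D t) (P.isClosed_D t) (P.mul_mem_left t) (P.twistedRep t) a _ ξ

theorem extendedOp_eq_zero {ξ : UniversalSpace A} (h : ∀ c ∈ P.D t⁻¹, universalRep A c ξ = 0) :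
    P.extendedOp t a ξ = 0 :=
  idealExtension_eq_zero _ _ _ _ a ξ fun d => h _ ((P.α t).symm d).2

theorem clm_ext_of_D {E : Type v} [NormedAddCommGroup E] [NormedSpace ℂ E]
    {S T : UniversalSpace A →L[ℂ] E}
    (h : ∀ c d, P.Rel t c d → ∀ ξ, S (universalRep A c ξ) = T (universalRep A c ξ))
    (h' : ∀ ξ, (∀ c ∈ P.D t⁻¹, universalRep A c ξ = 0) → S ξ = T ξ) : S = T :=
  clm_ext_of_universalRep (P.D t⁻¹) (fun _ hc => star_mem hc) (fun c hc ξ =>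
    (exists_rel_left hc).elim fun d hd => h c d hd ξ) h'

theorem Rel.exists_mul (h : P.Rel t c d) (a : A) : ∃ e, P.Rel t e (a * d) :=
  exists_rel_right (P.mul_mem_left t a d h.mem_right)

variable (P t) in
theorem extendedOp_add (a b : A) : P.extendedOp t (a + b) = P.extendedOp t a + P.extendedOp t b := by
  refine clm_ext_of_D (P := P) (t := t) (fun c d h ξ => ?_) fun ξ hξ => ?_
  · obtain ⟨e, he⟩ := h.exists_mul a
    obtain ⟨f, hf⟩ := h.exists_mul b
    rw [add_apply, h.extendedOp_apply he, h.extendedOp_apply hf,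
      h.extendedOp_apply (add_mul a b d ▸ he.add hf), map_add, add_apply]
  · rw [add_apply, extendedOp_eq_zero hξ, extendedOp_eq_zero hξ,
      extendedOp_eq_zero hξ, add_zero]

variable (P t) in
theorem extendedOp_smul (k : ℂ) (a : A) : P.extendedOp t (k • a) = k • P.extendedOp t a := by
  refine clm_ext_of_D (P := P) (t := t) (fun c d h ξ => ?_) fun ξ hξ => ?_
  · obtain ⟨e, he⟩ := h.exists_mul a
    rw [smul_apply, h.extendedOp_apply he,
      h.extendedOp_apply (smul_mul_assoc k a d ▸ he.smul k), map_smul,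
      smul_apply]
  · rw [smul_apply, extendedOp_eq_zero hξ, extendedOp_eq_zero hξ, smul_zero]

variable (P t) in
theorem extendedOp_mul (a b : A) : P.extendedOp t (a * b) = P.extendedOp t a * P.extendedOp t b := by
  refine clm_ext_of_D (P := P) (t := t) (fun c d h ξ => ?_) fun ξ hξ => ?_
  · obtain ⟨f, hf⟩ := h.exists_mul b
    obtain ⟨e, he⟩ := hf.exists_mul a
    rw [mul_apply_eq_comp, h.extendedOp_apply hf, hf.extendedOp_apply he,
      h.extendedOp_apply (mul_assoc a b d ▸ he)]
  · rw [mul_apply_eq_comp, extendedOp_eq_zero hξ, extendedOp_eq_zero hξ, map_zero]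

/-- The operator is defined by left multiplication inside the ideal; compatibility with right
multiplication is what identifies its adjoint in `extendedOp_star`. -/
theorem Rel.universalRep_mul_extendedOp (h : P.Rel t c d) (h' : P.Rel t e (d * a)) :
    universalRep A c * P.extendedOp t a = universalRep A e := by
  refine clm_ext_of_D (P := P) (t := t) (fun c' d' h'' ξ => ?_) fun ξ hξ => ?_
  · obtain ⟨f, hf⟩ := h''.exists_mul a
    have h1 := h.mul hf
    rw [← mul_assoc] at h1
    have h2 := h1.left_unique (h'.mul h'')
    rw [mul_apply_eq_comp, h''.extendedOp_apply hf, ← mul_apply_eq_comp,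
      ← map_mul, h2, map_mul, mul_apply_eq_comp]
  · rw [mul_apply_eq_comp, extendedOp_eq_zero hξ, map_zero, hξ e h'.mem_left]

theorem inner_extendedOp_eq_zero {ξ : UniversalSpace A}
    (h : ∀ c d e, P.Rel t c d → P.Rel t e (a * d) → universalRep A (star e) ξ = 0)
    (η : UniversalSpace A) : ⟪ξ, P.extendedOp t a η⟫_ℂ = 0 := by
  have : (innerSL ℂ ξ).comp (P.extendedOp t a) = 0 := by
    refine clm_ext_of_D (P := P) (t := t) (fun c d h' η => ?_) fun η hη => ?_
    · obtain ⟨e, he⟩ := h'.exists_mul a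
      rw [ContinuousLinearMap.comp_apply, h'.extendedOp_apply he, innerSL_apply_apply,
        ← ContinuousLinearMap.adjoint_inner_left, ← ContinuousLinearMap.star_eq_adjoint,
        ← map_star, h c d e h' he, inner_zero_left]
      rfl
    · rw [ContinuousLinearMap.comp_apply, extendedOp_eq_zero hη, map_zero]
      rfl
  exact congrArg (fun T => T η) this

variable (P t) in
theorem extendedOp_star (a : A) : P.extendedOp t (star a) = star (P.extendedOp t a) := by
  refine clm_ext_of_D (P := P) (t := t) (fun c d h ξ => ?_) fun ξ hξ => ?_
  · obtain ⟨e, he⟩ := h.exists_mul (star a)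
    have h1 := h.star.universalRep_mul_extendedOp (a := a) (e := star e)
      (by simpa using he.star)
    have h2 := congrArg star h1
    rw [star_mul, ← map_star, ← map_star, star_star, star_star] at h2
    rw [h.extendedOp_apply he, ← mul_apply_eq_comp, h2]
  · rw [extendedOp_eq_zero hξ]
    refine (ext_inner_right ℂ fun η => ?_).symm
    rw [ContinuousLinearMap.star_eq_adjoint, ContinuousLinearMap.adjoint_inner_left,
      inner_extendedOp_eq_zero fun c d e _ he => hξ _ (star_mem he.mem_left), inner_zero_left]

theorem extendedOp_one (a : A) : P.extendedOp 1 a = universalRep A a := by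
  refine clm_ext_of_D (P := P) (t := 1) (fun c d h ξ => ?_) fun ξ hξ => ?_
  · obtain rfl := (rel_one c).right_unique h
    rw [h.extendedOp_apply (rel_one (a * c)), map_mul, mul_apply_eq_comp]
  · rw [extendedOp_eq_zero hξ, hξ a (by rw [inv_one]; exact mem_D_one a)]

theorem extendedOp_eq_zero_of_mem {ξ : UniversalSpace A} (ha : a ∈ P.D s)
    (h : ∀ c ∈ P.D t⁻¹, c ∈ P.D (t⁻¹ * s) → universalRep A c ξ = 0) :
    P.extendedOp t a ξ = 0 := by
  refine ext_inner_right ℂ fun η => ?_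
  rw [← ContinuousLinearMap.adjoint_inner_right, ← ContinuousLinearMap.star_eq_adjoint,
    ← extendedOp_star, inner_zero_left]
  refine inner_extendedOp_eq_zero (fun c d e _ he => h _ (star_mem he.mem_left) ?_) η
  exact star_mem (he.mem_of_mem_right (P.mul_mem_right s d _ (star_mem ha)))

/-- Covariance of the regular representation: `α_{r⁻¹}(α_s(b))` and `α_{r⁻¹s}(b)` define the same
multiplier. Both operators vanish off the part of the space carried by `I_{r⁻¹} ∩ I_{r⁻¹s}`, and on
that part the composition law applies. -/
theorem Rel.extendedOp_eq (h : P.Rel s b a) (r : G) :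
    P.extendedOp r a = P.extendedOp (s⁻¹ * r) b := by
  refine clm_ext_of_universalRep {c | c ∈ P.D r⁻¹ ∧ c ∈ P.D (r⁻¹ * s)}
    (fun c hc => ⟨star_mem hc.1, star_mem hc.2⟩) (fun c hc ξ => ?_) fun ξ hξ => ?_
  · obtain ⟨d, hd⟩ := exists_rel_left hc.1
    obtain ⟨f, hf⟩ := exists_rel_right (by simpa using hd.mem_of_mem hc.2 : d ∈ P.D s)
    obtain ⟨e, he⟩ := hd.exists_mul a
    rw [hd.extendedOp_apply he,
      (hd.comp hf.inv).extendedOp_apply (he.comp (h.mul hf).inv)]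
  · rw [extendedOp_eq_zero_of_mem h.mem_right fun c hc hc' => hξ c ⟨hc, hc'⟩,
      extendedOp_eq_zero_of_mem h.mem_left fun c hc hc' => hξ c ⟨?_, ?_⟩]
    · simpa using hc'
    · simpa using hc

end ExtendedOp

end PartialAction

end

/-! ### Matrix entries on `ℓ²`-sums and the relations among the operators `a m_s` -/

noncomputable section

section L2Single

variable {ι : Type u} {H : Type v} [NormedAddCommGroup H] [InnerProductSpace ℂ H]

open scoped Classical in
/-- The inclusion of `H` in `ℓ²(ι, H)` at the index `t`. -/
def l2Single (t : ι) : H →L[ℂ] lp (fun _ : ι => H) 2 :=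
  lp.singleContinuousLinearMap ℂ (fun _ : ι => H) 2 t

theorem l2Single_apply_self (t : ι) (h : H) : l2Single t h t = h := by
  classical exact lp.single_apply_self (E := fun _ : ι => H) 2 t h

theorem l2Single_apply_ne {t r : ι} (h : H) (hr : r ≠ t) : l2Single t h r = 0 := by
  classical exact lp.single_apply_ne (E := fun _ : ι => H) 2 t h hr

theorem inner_l2Single (t : ι) (h : H) (ξ : lp (fun _ : ι => H) 2) :
    ⟪l2Single t h, ξ⟫_ℂ = ⟪h, ξ t⟫_ℂ := by
  classical exact lp.inner_single_left (G := fun _ : ι => H) t h ξ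

theorem norm_l2Single (t : ι) (h : H) : ‖(l2Single t h : lp (fun _ : ι => H) 2)‖ = ‖h‖ := by
  classical exact lp.norm_single (E := fun _ : ι => H) (by norm_num) t h

theorem clm_ext_l2Single {E : Type*} [NormedAddCommGroup E] [NormedSpace ℂ E]
    {f g : lp (fun _ : ι => H) 2 →L[ℂ] E} (h : ∀ t k, f (l2Single t k) = g (l2Single t k)) :
    f = g := by
  classical
  refine ContinuousLinearMap.ext fun ξ => ?_
  have h1 := lp.hasSum_single (p := 2) (by norm_num) ξ
  refine (h1.mapL f).unique ?_
  have h2 : ∀ t, f (lp.single 2 t (ξ t)) = g (lp.single 2 t (ξ t)) := fun t => h t (ξ t)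
  simp only [h2]
  exact h1.mapL g

/-- The diagonal entry at `t` of an operator on `ℓ²(ι, H)`. -/
def l2Diag (t : ι) : (lp (fun _ : ι => H) 2 →L[ℂ] lp (fun _ : ι => H) 2) →L[ℂ] (H →L[ℂ] H) :=
  (ContinuousLinearMap.compL ℂ H (lp (fun _ : ι => H) 2) H (lp.evalCLM ℂ (fun _ : ι => H) 2 t)).comp
    ((ContinuousLinearMap.compL ℂ H (lp (fun _ : ι => H) 2) (lp (fun _ : ι => H) 2)).flip
      (l2Single t))

theorem l2Diag_apply (t : ι) (T : lp (fun _ : ι => H) 2 →L[ℂ] lp (fun _ : ι => H) 2) (h : H) :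
    l2Diag t T h = T (l2Single t h) t := rfl

variable [CompleteSpace H]

theorem inner_l2Diag_star_mul_self (t : ι)
    (T : lp (fun _ : ι => H) 2 →L[ℂ] lp (fun _ : ι => H) 2) (h : H) :
    ⟪h, l2Diag t (star T * T) h⟫_ℂ = ((‖T (l2Single t h)‖ ^ 2 : ℝ) : ℂ) := by
  rw [l2Diag_apply, ← inner_l2Single, mul_apply_eq_comp, ContinuousLinearMap.star_eq_adjoint,
    ContinuousLinearMap.adjoint_inner_right, inner_self_eq_norm_sq_to_K]
  push_cast
  rfl

theorem eq_zero_of_l2Diag_eq_zero {T : lp (fun _ : ι => H) 2 →L[ℂ] lp (fun _ : ι => H) 2}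
    (h : ∀ t, l2Diag t (star T * T) = 0) : T = 0 := by
  refine clm_ext_l2Single fun t k => ?_
  have h1 := inner_l2Diag_star_mul_self t T k
  rw [h t] at h1
  have h2 : ‖T (l2Single t k)‖ ^ 2 = 0 := by
    have : ((‖T (l2Single t k)‖ ^ 2 : ℝ) : ℂ) = 0 := by rw [← h1]; exact inner_zero_right _
    exact_mod_cast this
  exact norm_eq_zero.mp ((pow_eq_zero_iff two_ne_zero).mp h2)

theorem nonneg_of_inner {T : H →L[ℂ] H} (h : ∀ k, ∃ r : ℝ, 0 ≤ r ∧ ⟪k, T k⟫_ℂ = r) : 0 ≤ T := by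
  rw [ContinuousLinearMap.nonneg_iff_isPositive, ContinuousLinearMap.isPositive_iff_complex]
  intro k
  obtain ⟨r, hr, hr'⟩ := h k
  have : ⟪T k, k⟫_ℂ = r := by
    rw [← inner_conj_symm, hr', Complex.conj_ofReal]
  rw [this]
  exact ⟨by simp, by simpa using hr⟩

end L2Single

namespace PartialAction

variable {G A : Type u} [Group G] [NonUnitalCStarAlgebra A] [PartialOrder A] [StarOrderedRing A]
  {P : PartialAction G A} {s t r : G} {a b c d e : A}

variable (P s) in
theorem regularOp_add (a b : A) : P.regularOp s (a + b) = P.regularOp s a + P.regularOp s b := by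
  ext1 ξ
  refine lp.ext (funext fun t => ?_)
  change P.extendedOp t (a + b) _ = P.extendedOp t a _ + P.extendedOp t b _
  rw [extendedOp_add]
  rfl

variable (P s) in
theorem regularOp_smul (k : ℂ) (a : A) : P.regularOp s (k • a) = k • P.regularOp s a := by
  ext1 ξ
  refine lp.ext (funext fun t => ?_)
  change P.extendedOp t (k • a) _ = k • P.extendedOp t a _
  rw [extendedOp_smul]
  rfl

/-- This is `a m_s c m_t = α_s(α_{s⁻¹}(a) c) m_{st}`, which follows entrywise from covariance. -/
theorem Rel.regularOp_mul (h : P.Rel s b a) (h' : P.Rel s (b * c) d) (t : G) :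
    P.regularOp s a * P.regularOp t c = P.regularOp (s * t) d := by
  ext1 ξ
  refine lp.ext (funext fun r => ?_)
  change P.extendedOp r a (P.extendedOp (s⁻¹ * r) c (ξ (t⁻¹ * (s⁻¹ * r)))) =
    P.extendedOp r d (ξ ((s * t)⁻¹ * r))
  rw [h.extendedOp_eq, h'.extendedOp_eq, extendedOp_mul, mul_inv_rev, mul_assoc]
  rfl

theorem Rel.star_regularOp (h : P.Rel s b a) :
    Star.star (P.regularOp s a) = P.regularOp s⁻¹ (Star.star b) := by
  rw [ContinuousLinearMap.star_eq_adjoint]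
  symm
  refine (ContinuousLinearMap.eq_adjoint_iff _ _).mpr fun ξ η => ?_
  rw [lp.inner_eq_tsum, lp.inner_eq_tsum]
  have h1 : ∀ r, ⟪ξ r, P.regularOp s a η r⟫_ℂ =
      ⟪P.regularOp s⁻¹ (Star.star b) ξ (s⁻¹ * r), η (s⁻¹ * r)⟫_ℂ := fun r => by
    rw [regularOp_apply, regularOp_apply, inv_inv, mul_inv_cancel_left, h.extendedOp_eq,
      extendedOp_star, ContinuousLinearMap.star_eq_adjoint, ContinuousLinearMap.adjoint_inner_left]
  simp only [h1]
  exact ((Equiv.mulLeft s⁻¹).tsum_eq fun r => ⟪P.regularOp s⁻¹ (Star.star b) ξ r, η r⟫_ℂ).symm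

theorem Rel.norm_regularOp (h : P.Rel s b a) : ‖P.regularOp s a‖ = ‖a‖ := by
  refine le_antisymm ?_ ?_
  · refine ContinuousLinearMap.opNorm_le_bound _ (norm_nonneg a) fun ξ => ?_
    have h1 : ‖l2Reindex (H := UniversalSpace A) (Equiv.mulLeft s⁻¹) ξ‖ ≤ ‖ξ‖ := by
      have h2 := (l2Reindex (H := UniversalSpace A) (Equiv.mulLeft s⁻¹)).le_of_opNorm_le
        (LinearMap.mkContinuous_norm_le _ zero_le_one _) ξ
      rwa [one_mul] at h2
    exact (ContinuousLinearMap.le_of_opNorm_le _ (lp.norm_mapCLM_le 2 _ (norm_nonneg a)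
      fun _ => norm_idealExtension_le _ _ _ _ a) _).trans
      (mul_le_mul_of_nonneg_left h1 (norm_nonneg a))
  · rw [h.norm_eq, ← norm_universalRep A b]
    refine ContinuousLinearMap.opNorm_le_bound _ (norm_nonneg _) fun ξ => ?_
    -- The entry of `a m_s` in row `s` and column `e` is `π(α_{s⁻¹}(a))`, and this already has norm
    -- `‖a‖`.
    have h1 : P.regularOp s a (l2Single 1 ξ) s = universalRep A b ξ := by
      rw [regularOp_apply, inv_mul_cancel, l2Single_apply_self, h.extendedOp_eq, inv_mul_cancel,
        extendedOp_one]
    rw [← h1]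
    refine (lp.norm_apply_le_norm (by norm_num) _ s).trans ?_
    refine (ContinuousLinearMap.le_opNorm _ _).trans ?_
    rw [norm_l2Single]

theorem l2Diag_regularOp_one (t : G) (a : A) : l2Diag t (P.regularOp 1 a) = P.extendedOp t a := by
  ext1 h
  rw [l2Diag_apply, regularOp_apply, inv_one, one_mul, l2Single_apply_self]

theorem l2Diag_regularOp_ne (t : G) (hs : s ≠ 1) (a : A) : l2Diag t (P.regularOp s a) = 0 := by
  ext1 h
  rw [l2Diag_apply, regularOp_apply, l2Single_apply_ne, map_zero]
  · rfl
  · simpa using hs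

end PartialAction

end

/-! ### The dense span of the generators and the faithful conditional expectation -/

noncomputable section

namespace PartialAction

variable {G A : Type u} [Group G] [NonUnitalCStarAlgebra A] [PartialOrder A] [StarOrderedRing A]
  {P : PartialAction G A} {s t r : G} {a b c d e : A}

theorem inclusion_injective : Function.Injective P.inclusion := Subtype.val_injective

theorem inclusion_generator (s : G) (a : P.D s) : P.inclusion (P.generator s a) = P.regularOp s a :=
  rfl

theorem norm_inclusion (z : P.ReducedCrossedProduct) : ‖P.inclusion z‖ = ‖z‖ := rfl

theorem norm_generator (s : G) (a : P.D s) : ‖P.generator s a‖ = ‖a‖ := by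
  rw [← norm_inclusion]
  exact (rel_symm a).norm_regularOp

theorem generator_add (s : G) (a b : P.D s) :
    P.generator s (a + b) = P.generator s a + P.generator s b :=
  inclusion_injective (by rw [map_add]; exact regularOp_add P s a b)

theorem generator_smul (s : G) (k : ℂ) (a : P.D s) :
    P.generator s (k • a) = k • P.generator s a :=
  inclusion_injective (by rw [map_smul]; exact regularOp_smul P s k a)

theorem Rel.mul_mem (h : P.Rel s (b * c) d) (hc : c ∈ P.D t) : d ∈ P.D (s * t) :=
  h.mem_of_mem (P.mul_mem_left t b c hc)

theorem Rel.generator_mul (h : P.Rel s b a) (h' : P.Rel s (b * c) d) (hc : c ∈ P.D t) :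
    P.generator s ⟨a, h.mem_right⟩ * P.generator t ⟨c, hc⟩ =
      P.generator (s * t) ⟨d, h'.mul_mem hc⟩ :=
  inclusion_injective (by rw [map_mul]; exact h.regularOp_mul h' t)

theorem Rel.star_generator (h : P.Rel s b a) :
    Star.star (P.generator s ⟨a, h.mem_right⟩) =
      P.generator s⁻¹ ⟨Star.star b, star_mem h.mem_left⟩ :=
  inclusion_injective (by rw [map_star]; exact h.star_regularOp)

theorem generator_congr (h : s = t) (a : A) (ha : a ∈ P.D s) (ha' : a ∈ P.D t) :
    P.generator s ⟨a, ha⟩ = P.generator t ⟨a, ha'⟩ := by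
  subst h
  rfl

/-- The elements `a m_s` are closed under products and adjoints, so their linear span is already the
generated ⋆-algebra. -/
theorem adjoin_regularOp_le_span :
    (NonUnitalStarAlgebra.adjoin ℂ {T : P.RegularSpace →L[ℂ] P.RegularSpace |
      ∃ s, ∃ a ∈ P.D s, T = P.regularOp s a} : Set (P.RegularSpace →L[ℂ] P.RegularSpace)) ⊆
    Submodule.span ℂ {T : P.RegularSpace →L[ℂ] P.RegularSpace |
      ∃ s, ∃ a ∈ P.D s, T = P.regularOp s a} := by
  set S := {T : P.RegularSpace →L[ℂ] P.RegularSpace | ∃ s, ∃ a ∈ P.D s, T = P.regularOp s a}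
    with hS
  have hstar : ∀ T ∈ S, star T ∈ S := by
    rintro _ ⟨s, a, ha, rfl⟩
    obtain ⟨b, hb⟩ := exists_rel_right ha
    exact ⟨s⁻¹, star b, star_mem hb.mem_left, hb.star_regularOp⟩
  have hmul : ∀ T ∈ S, ∀ T' ∈ S, T * T' ∈ S := by
    rintro _ ⟨s, a, ha, rfl⟩ _ ⟨t, c, hc, rfl⟩
    obtain ⟨b, hb⟩ := exists_rel_right ha
    obtain ⟨d, hd⟩ := exists_rel_left (P.mul_mem_right s⁻¹ c b hb.mem_left)
    exact ⟨s * t, d, hd.mul_mem hc, hb.regularOp_mul hd t⟩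
  have h1 : S ∪ star S = S := Set.union_eq_left.mpr fun T hT => by
    simpa using hstar _ hT
  have h2 : (Subsemigroup.closure S : Set (P.RegularSpace →L[ℂ] P.RegularSpace)) ≤ S :=
    Subsemigroup.closure_le (S := ⟨S, fun {T T'} hT hT' => hmul T hT T' hT'⟩).mpr le_rfl
  intro T hT
  have h3 : T ∈ (NonUnitalStarAlgebra.adjoin ℂ S).toSubmodule := hT
  rw [NonUnitalStarAlgebra.adjoin_eq_span, h1] at h3
  exact Submodule.span_mono h2 h3

theorem mem_closure_span_generator (z : P.ReducedCrossedProduct) :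
    z ∈ (Submodule.span ℂ {z : P.ReducedCrossedProduct |
      ∃ s a, z = P.generator s a}).topologicalClosure := by
  have h1 : ∀ T ∈ Submodule.span ℂ {T : P.RegularSpace →L[ℂ] P.RegularSpace |
      ∃ s, ∃ a ∈ P.D s, T = P.regularOp s a}, ∃ y ∈ Submodule.span ℂ
        {z : P.ReducedCrossedProduct | ∃ s a, z = P.generator s a}, P.inclusion y = T := by
    intro T hT
    induction hT using Submodule.span_induction with
    | mem T hT =>
      obtain ⟨s, a, ha, rfl⟩ := hT
      exact ⟨_, Submodule.subset_span ⟨s, ⟨a, ha⟩, rfl⟩, rfl⟩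
    | zero => exact ⟨0, zero_mem _, map_zero _⟩
    | add T T' _ _ h h' =>
      obtain ⟨y, hy, rfl⟩ := h
      obtain ⟨y', hy', rfl⟩ := h'
      exact ⟨y + y', add_mem hy hy', map_add _ _ _⟩
    | smul k T _ h =>
      obtain ⟨y, hy, rfl⟩ := h
      exact ⟨k • y, Submodule.smul_mem _ k hy, map_smul _ _ _⟩
  have h2 : P.inclusion z ∈ closure (NonUnitalStarAlgebra.adjoin ℂ
      {T : P.RegularSpace →L[ℂ] P.RegularSpace | ∃ s, ∃ a ∈ P.D s, T = P.regularOp s a} :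
      Set (P.RegularSpace →L[ℂ] P.RegularSpace)) := Subtype.prop (p := (· ∈ P.reducedAlgebra)) z
  change z ∈ closure (Submodule.span ℂ {z : P.ReducedCrossedProduct |
      ∃ s a, z = P.generator s a} : Set P.ReducedCrossedProduct)
  rw [Metric.mem_closure_iff] at h2 ⊢
  intro ε hε
  obtain ⟨T, hT, hT'⟩ := h2 ε hε
  obtain ⟨y, hy, rfl⟩ := h1 T (adjoin_regularOp_le_span hT)
  refine ⟨y, hy, ?_⟩
  rw [dist_eq_norm] at hT' ⊢
  rwa [← map_sub, norm_inclusion] at hT'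

variable (P) in
/-- The conditional expectation of the reduced crossed product on `A`, composed with the universal
representation of `A`. -/
def expectation : P.ReducedCrossedProduct →L[ℂ] (UniversalSpace A →L[ℂ] UniversalSpace A) :=
  (l2Diag 1).comp P.inclusion.toCLM

theorem expectation_apply (z : P.ReducedCrossedProduct) :
    P.expectation z = l2Diag 1 (P.inclusion z) := rfl

theorem expectation_generator_one (a : P.D 1) :
    P.expectation (P.generator 1 a) = universalRep A (a : A) := by
  rw [expectation_apply, inclusion_generator, l2Diag_regularOp_one, extendedOp_one]

theorem expectation_generator_ne (hs : s ≠ 1) (a : P.D s) :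
    P.expectation (P.generator s a) = 0 := by
  rw [expectation_apply, inclusion_generator, l2Diag_regularOp_ne 1 hs]

theorem expectation_star_mul_self_nonneg (z : P.ReducedCrossedProduct) :
    0 ≤ P.expectation (star z * z) := nonneg_of_inner fun k => by
  refine ⟨_, sq_nonneg ‖P.inclusion z (l2Single 1 k)‖, ?_⟩
  rw [expectation_apply, map_mul, map_star, inner_l2Diag_star_mul_self]

/-- Only the coefficient `a` at `e` contributes to the diagonal, and it enters the entry at `t` as
`π(ᾱ_{t⁻¹}(a))`. Since `‖ᾱ_{t⁻¹}(a)‖ ≤ ‖a‖`, the entry at `e` dominates all others. -/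
theorem exists_extendedOp_eq_of_mem_span (t : G) {z : P.ReducedCrossedProduct}
    (hz : z ∈ Submodule.span ℂ {z : P.ReducedCrossedProduct | ∃ s a, z = P.generator s a}) :
    ∃ a, l2Diag t (P.inclusion z) = P.extendedOp t a ∧ P.expectation z = universalRep A a := by
  induction hz using Submodule.span_induction with
  | mem z hz =>
    obtain ⟨s, a, rfl⟩ := hz
    by_cases hs : s = 1
    · subst hs
      exact ⟨a, l2Diag_regularOp_one t _, expectation_generator_one a⟩
    · refine ⟨0, ?_, ?_⟩
      · rw [inclusion_generator, l2Diag_regularOp_ne t hs]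
        simpa using (extendedOp_smul P t 0 (0 : A)).symm
      · rw [expectation_generator_ne hs, map_zero]
  | zero =>
    refine ⟨0, ?_, by simp⟩
    simpa using (extendedOp_smul P t 0 (0 : A)).symm
  | add z z' _ _ h h' =>
    obtain ⟨a, h1, h2⟩ := h
    obtain ⟨b, h3, h4⟩ := h'
    exact ⟨a + b, by rw [map_add, map_add, h1, h3, extendedOp_add], by
      rw [map_add, map_add, h2, h4]⟩
  | smul k z _ h =>
    obtain ⟨a, h1, h2⟩ := h
    exact ⟨k • a, by rw [map_smul, map_smul, h1, extendedOp_smul], by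
      rw [map_smul, map_smul, h2]⟩

theorem norm_l2Diag_inclusion_le (t : G) (z : P.ReducedCrossedProduct) :
    ‖l2Diag t (P.inclusion z)‖ ≤ ‖P.expectation z‖ := by
  have hc : IsClosed {z | ‖l2Diag t (P.inclusion z)‖ ≤ ‖P.expectation z‖} :=
    isClosed_le ((l2Diag t).comp P.inclusion.toCLM).continuous.norm
      P.expectation.continuous.norm
  refine closure_minimal (fun z hz => ?_) hc (mem_closure_span_generator z)
  obtain ⟨a, ha, ha'⟩ := exists_extendedOp_eq_of_mem_span t hz
  change ‖_‖ ≤ ‖_‖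
  rw [ha, ha', norm_universalRep]
  exact norm_idealExtension_le _ _ _ _ a

/-- If the entry of `z⋆z` at `e` vanishes, so does every diagonal entry, and these are the squared
column norms of `z`. -/
theorem eq_zero_of_expectation_star_mul_self {z : P.ReducedCrossedProduct}
    (h : P.expectation (star z * z) = 0) : z = 0 := by
  refine inclusion_injective ((eq_zero_of_l2Diag_eq_zero fun t => ?_).trans (map_zero _).symm)
  have := norm_l2Diag_inclusion_le t (star z * z)
  rw [h, norm_zero, map_mul, map_star] at this
  exact norm_le_zero_iff.mp this

end PartialAction

end

/-! ### Faithful positive maps and norms -/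

section PositiveMap

variable {C : Type u} {F : Type v} [NonUnitalCStarAlgebra C]

/-- Put `a = x⋆x`, choose `r` strictly between `k` and `‖a‖`, and let `f(t) = max(0, t - r)`. With
`c = f(a)` the identity `t f(t)² = r f(t)² + f(t)³` gives the formula, `d` being the square root of
`f(a)³`. As `a` has spectrum above `r`, `c ≠ 0`. -/
theorem exists_cutoff (x : C) {k : ℝ} (hk : 0 ≤ k) (hx : k < ‖star x * x‖) :
    ∃ c d : C, ∃ r : ℝ, k < r ∧ c ≠ 0 ∧
      star (x * c) * (x * c) = (r : ℂ) • (star c * c) + star d * d := by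
  set a := star x * x with ha
  have hsa : IsSelfAdjoint a := IsSelfAdjoint.star_mul_self x
  let r := (k + ‖a‖) / 2
  have hr : k < r := by simp only [r]; linarith
  have hr' : r < ‖a‖ := by simp only [r]; linarith
  have hr0 : 0 < r := hk.trans_lt hr
  let f : ℝ → ℝ := fun t => max 0 (t - r)
  let g : ℝ → ℝ := fun t => f t * Real.sqrt (f t)
  have hf : Continuous f := by fun_prop
  have hg : Continuous g := by fun_prop
  have hf0 : f 0 = 0 := by simp [f, hr0.le]
  have hg0 : g 0 = 0 := by simp [g, hf0]
  have hfsa : star (cfcₙ f a) = cfcₙ f a := (cfcₙ_predicate f a : IsSelfAdjoint _)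
  have hgsa : star (cfcₙ g a) = cfcₙ g a := (cfcₙ_predicate g a : IsSelfAdjoint _)
  refine ⟨cfcₙ f a, cfcₙ g a, r, hr, fun h => ?_, ?_⟩
  -- If `c` vanished, the spectrum of `a` would lie in `[0, r]`, contrary to `r < ‖a‖`.
  · have h1 : (quasispectrum ℝ a).EqOn f 0 := by
      refine eqOn_of_cfcₙ_eq_cfcₙ (h.trans ?_) hsa hf.continuousOn hf0 continuousOn_const rfl
      exact (cfcₙ_zero ℝ a).symm
    have h2 : ∀ t ∈ quasispectrum ℝ a, t ≤ r := fun t ht => by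
      have h3 : max 0 (t - r) = 0 := h1 ht
      have := max_eq_left_iff.mp h3
      linarith
    let : PartialOrder C := CStarAlgebra.spectralOrder C
    have : StarOrderedRing C := CStarAlgebra.spectralOrderedRing C
    have h3 : ‖a‖ ≤ r := by
      rw [← cfcₙ_id ℝ a]
      refine norm_cfcₙ_le fun t ht => ?_
      rw [id, Real.norm_of_nonneg (quasispectrum_nonneg_of_nonneg a (star_mul_self_nonneg x) t ht)]
      exact h2 t ht
    linarith
  · have h1 : star (x * cfcₙ f a) * (x * cfcₙ f a) = cfcₙ f a * cfcₙ (id : ℝ → ℝ) a * cfcₙ f a := by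
      rw [star_mul, hfsa, cfcₙ_id ℝ a, ha]
      simp only [mul_assoc]
    have hff : Continuous fun t => f t * f t := hf.mul hf
    have hff0 : f 0 * f 0 = 0 := by rw [hf0, mul_zero]
    rw [h1, hfsa, hgsa, ← cfcₙ_mul f id a hf.continuousOn hf0 continuousOn_id rfl,
      ← cfcₙ_mul (fun t => f t * id t) f a (hf.mul continuous_id).continuousOn
        (by rw [hf0, zero_mul]) hf.continuousOn hf0,
      ← cfcₙ_mul f f a hf.continuousOn hf0 hf.continuousOn hf0,
      ← cfcₙ_mul g g a hg.continuousOn hg0 hg.continuousOn hg0, Complex.coe_smul,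
      ← cfcₙ_smul r (fun t => f t * f t) a hff.continuousOn hff0,
      ← cfcₙ_add (fun t => r • (f t * f t)) (fun t => g t * g t) a
        (hff.const_smul r).continuousOn (by rw [hff0, smul_zero]) (hg.mul hg).continuousOn
        (by rw [hg0, mul_zero])]
    refine cfcₙ_congr fun t _ => ?_
    have h2 : g t * g t = f t * f t * f t := by
      have : Real.sqrt (f t) * Real.sqrt (f t) = f t := Real.mul_self_sqrt (le_max_left _ _)
      calc g t * g t = f t * f t * (Real.sqrt (f t) * Real.sqrt (f t)) := by simp only [g]; ring
        _ = _ := by rw [this]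
    change f t * t * f t = r • (f t * f t) + g t * g t
    rw [h2, smul_eq_mul]
    rcases le_total (t - r) 0 with h | h
    · have : f t = 0 := max_eq_left h
      rw [this]; ring
    · have : f t = t - r := max_eq_right h
      rw [this]; ring

variable [NonUnitalCStarAlgebra F] [PartialOrder F] [StarOrderedRing F]

/-- Apply positivity of `E` to `y⋆x⋆x y ≤ ‖x⋆x‖ y⋆y`. -/
theorem norm_star_mul_self_map_le (E : C →L[ℂ] F) (hE : ∀ b, 0 ≤ E (star b * b)) (x y : C) :
    ‖E (star (x * y) * (x * y))‖ ≤ ‖x‖ ^ 2 * ‖E (star y * y)‖ := by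
  let : PartialOrder C := CStarAlgebra.spectralOrder C
  have : StarOrderedRing C := CStarAlgebra.spectralOrderedRing C
  have h1 : star (x * y) * (x * y) ≤ ‖star x * x‖ • (star y * y) := by
    have := CStarAlgebra.star_left_conjugate_le_norm_smul (a := y) (b := star x * x)
      (IsSelfAdjoint.star_mul_self x)
    simpa only [star_mul, mul_assoc] using this
  obtain ⟨d, hd⟩ := CStarAlgebra.nonneg_iff_eq_star_mul_self.mp (sub_nonneg.mpr h1)
  have h2 : E (star (x * y) * (x * y)) ≤ ‖star x * x‖ • E (star y * y) := by
    have h3 := hE d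
    rw [← hd, map_sub, ← Complex.coe_smul, map_smul, Complex.coe_smul] at h3
    exact sub_nonneg.mp h3
  refine (CStarAlgebra.norm_le_norm_of_nonneg_of_le (hE _) h2).trans_eq ?_
  rw [norm_smul, norm_norm, CStarRing.norm_star_mul_self, sq]

/-- The norm of `x` is recovered as the bound of left multiplication for `y ↦ ‖E(y⋆y)‖^{1/2}`. If
`‖x‖ > k`, the element `c` of `exists_cutoff` has `E((x c)⋆(x c)) ≥ r E(c⋆c)` with `r > k²`. The
hypothesis then forces `E(c⋆c) = 0`, and faithfulness gives `c = 0`. -/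
theorem norm_le_of_faithful_positive (E : C →L[ℂ] F) (hE : ∀ b, 0 ≤ E (star b * b))
    (hE' : ∀ b, E (star b * b) = 0 → b = 0) {x : C} {k : ℝ} (hk : 0 ≤ k)
    (h : ∀ y, ‖E (star (x * y) * (x * y))‖ ≤ k ^ 2 * ‖E (star y * y)‖) : ‖x‖ ≤ k := by
  by_contra hx
  push Not at hx
  obtain ⟨c, d, r, hr, hc, hcd⟩ := exists_cutoff x (sq_nonneg k) (by
    rw [CStarRing.norm_star_mul_self, ← sq]
    exact pow_lt_pow_left₀ hx hk two_ne_zero)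
  have h1 : r • E (star c * c) ≤ E (star (x * c) * (x * c)) := by
    rw [hcd, map_add, map_smul, Complex.coe_smul]
    exact le_add_of_nonneg_right (hE d)
  have hr0 : 0 < r := (sq_nonneg k).trans_lt hr
  have h2 := CStarAlgebra.norm_le_norm_of_nonneg_of_le (smul_nonneg hr0.le (hE c)) h1
  rw [norm_smul, Real.norm_of_nonneg hr0.le] at h2
  have h3 : ‖E (star c * c)‖ ≤ 0 := by
    by_contra h4
    push Not at h4
    have := mul_lt_mul_of_pos_right hr h4
    linarith [h c]
  exact hc (hE' c (norm_le_zero_iff.mp h3))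

end PositiveMap

/-! ### Isomorphisms from graphs with faithful expectations -/

section Graph

variable {C₁ C₂ : Type u} [NonUnitalCStarAlgebra C₁] [NonUnitalCStarAlgebra C₂]

/-- A ⋆-subalgebra of `C₁ × C₂` with dense projections on whose elements faithful positive maps
agree in norm consists of pairs of equal norm. -/
theorem norm_snd_le_norm_fst {F₁ F₂ : Type v} [NonUnitalCStarAlgebra F₁] [PartialOrder F₁]
    [StarOrderedRing F₁] [NonUnitalCStarAlgebra F₂] [PartialOrder F₂] [StarOrderedRing F₂]
    (Γ : Set (C₁ × C₂)) (hmul : ∀ p ∈ Γ, ∀ q ∈ Γ, p * q ∈ Γ) (hstar : ∀ p ∈ Γ, star p ∈ Γ)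
    (h₂ : Dense (Prod.snd '' Γ)) (E₁ : C₁ →L[ℂ] F₁) (hE₁ : ∀ b, 0 ≤ E₁ (star b * b))
    (E₂ : C₂ →L[ℂ] F₂) (hE₂ : ∀ b, 0 ≤ E₂ (star b * b)) (hE₂' : ∀ b, E₂ (star b * b) = 0 → b = 0)
    (hE : ∀ p ∈ Γ, ‖E₁ p.1‖ = ‖E₂ p.2‖) {p : C₁ × C₂} (hp : p ∈ Γ) : ‖p.2‖ ≤ ‖p.1‖ := by
  refine norm_le_of_faithful_positive E₂ hE₂ hE₂' (norm_nonneg _) fun y => ?_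
  have hc : IsClosed {y | ‖E₂ (star (p.2 * y) * (p.2 * y))‖ ≤ ‖p.1‖ ^ 2 * ‖E₂ (star y * y)‖} :=
    isClosed_le (by fun_prop) (by fun_prop)
  refine closure_minimal ?_ hc (h₂ y)
  rintro _ ⟨q, hq, rfl⟩
  have h1 := hE _ (hmul _ (hstar _ (hmul _ hp _ hq)) _ (hmul _ hp _ hq))
  have h2 := hE _ (hmul _ (hstar _ hq) _ hq)
  have h3 := norm_star_mul_self_map_le E₁ hE₁ p.1 q.1
  change ‖E₁ (star (p.1 * q.1) * (p.1 * q.1))‖ = ‖E₂ (star (p.2 * q.2) * (p.2 * q.2))‖ at h1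
  change ‖E₁ (star q.1 * q.1)‖ = ‖E₂ (star q.2 * q.2)‖ at h2
  rw [h1, h2] at h3
  exact h3

/-- Equality of norms makes `Γ` the graph of an isometry between dense subspaces. It and its inverse
extend by continuity, and the algebraic identities pass to the closure. -/
theorem exists_starAlgEquiv_of_graph (Γ : Submodule ℂ (C₁ × C₂))
    (hmul : ∀ p ∈ Γ, ∀ q ∈ Γ, p * q ∈ Γ) (hstar : ∀ p ∈ Γ, star p ∈ Γ)
    (h₁ : Dense (Prod.fst '' (Γ : Set (C₁ × C₂)))) (h₂ : Dense (Prod.snd '' (Γ : Set (C₁ × C₂))))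
    (hnorm : ∀ p ∈ Γ, ‖p.1‖ = ‖p.2‖) : ∃ θ : C₁ ≃⋆ₐ[ℂ] C₂, ∀ p ∈ Γ, θ p.1 = p.2 := by
  let f₁ : Γ →ₗ[ℂ] C₁ := LinearMap.fst ℂ C₁ C₂ ∘ₗ Γ.subtype
  let f₂ : Γ →ₗ[ℂ] C₂ := LinearMap.snd ℂ C₁ C₂ ∘ₗ Γ.subtype
  have hd₁ : DenseRange f₁ := h₁.mono (by rintro _ ⟨p, hp, rfl⟩; exact ⟨⟨p, hp⟩, rfl⟩)
  have hd₂ : DenseRange f₂ := h₂.mono (by rintro _ ⟨p, hp, rfl⟩; exact ⟨⟨p, hp⟩, rfl⟩)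
  let T : C₁ →L[ℂ] C₂ := f₂.extendOfNorm f₁
  let T' : C₂ →L[ℂ] C₁ := f₁.extendOfNorm f₂
  have hT : ∀ p ∈ Γ, T p.1 = p.2 := fun p hp =>
    LinearMap.extendOfNorm_eq hd₁ ⟨1, fun q => by
      rw [one_mul]; exact (hnorm q q.2).ge⟩ ⟨p, hp⟩
  have hT' : ∀ p ∈ Γ, T' p.2 = p.1 := fun p hp =>
    LinearMap.extendOfNorm_eq hd₂ ⟨1, fun q => by
      rw [one_mul]; exact (hnorm q q.2).le⟩ ⟨p, hp⟩
  have ind₁ : ∀ {Q : C₁ → Prop}, IsClosed {x | Q x} → (∀ p ∈ Γ, Q p.1) → ∀ x, Q x :=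
    fun hQ h x => closure_minimal (by rintro _ ⟨p, hp, rfl⟩; exact h p hp) hQ (h₁ x)
  have ind₂ : ∀ {Q : C₂ → Prop}, IsClosed {x | Q x} → (∀ p ∈ Γ, Q p.2) → ∀ x, Q x :=
    fun hQ h x => closure_minimal (by rintro _ ⟨p, hp, rfl⟩; exact h p hp) hQ (h₂ x)
  exact ⟨
    { toFun := T
      invFun := T'
      left_inv := ind₁ (isClosed_eq (by fun_prop) (by fun_prop)) fun p hp => by
        rw [hT p hp, hT' p hp]
      right_inv := ind₂ (isClosed_eq (by fun_prop) (by fun_prop)) fun p hp => by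
        rw [hT' p hp, hT p hp]
      map_add' := map_add T
      map_smul' := map_smul T
      map_mul' := by
        intro x y
        refine ind₁ (Q := fun x => T (x * y) = T x * T y)
          (isClosed_eq (by fun_prop) (by fun_prop)) (fun p hp => ?_) x
        refine ind₁ (Q := fun y => T (p.1 * y) = T p.1 * T y)
          (isClosed_eq (by fun_prop) (by fun_prop)) (fun q hq => ?_) y
        rw [hT p hp, hT q hq]
        exact hT _ (hmul p hp q hq)
      map_star' := ind₁ (isClosed_eq (by fun_prop) (by fun_prop)) fun p hp => by
        rw [hT p hp]
        exact hT _ (hstar p hp) }, hT⟩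

end Graph

/-! ### The partial action of a multiplicative family of module isomorphisms -/

noncomputable section

namespace Coaction

variable {G B : Type u} [Group G] [NonUnitalCStarAlgebra B]

/-- The multiplicativity condition `ψ_{st}(xy) = ψ_s(x ψ_t(y))`. -/
def IsMultiplicative {δ : Coaction G B} (ψ : ∀ s, δ.ModuleIso s) : Prop :=
  ∀ (s t : G) (x : δ.spectral s) (y : δ.spectral t),
    ((ψ (s * t)).equiv ⟨(x : B) * y, δ.mul_mem_spectral x.2 y.2⟩ : B) =
      (ψ s).equiv ⟨(x : B) * ((ψ t).equiv y : B), δ.mul_rangeIdeal_mem x.2 ((ψ t).equiv y).2⟩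

/-- The graph of a module isomorphism. -/
def ModuleIso.Graph {δ : Coaction G B} {s : G} (ψ : δ.ModuleIso s) (x d : B) : Prop :=
  ∃ hx : x ∈ δ.spectral s, (ψ.equiv ⟨x, hx⟩ : B) = d

namespace ModuleIso

variable {δ : Coaction G B} {s t : G}

section Single

variable {ψ : δ.ModuleIso s} {x y d e b : B}

theorem Graph.mem_left (h : ψ.Graph x d) : x ∈ δ.spectral s := h.1

theorem Graph.mem_right (h : ψ.Graph x d) : d ∈ δ.rangeIdeal s := by
  obtain ⟨h, rfl⟩ := h
  exact (ψ.equiv _).2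

theorem exists_graph_left (hx : x ∈ δ.spectral s) : ∃ d, ψ.Graph x d := ⟨_, hx, rfl⟩

theorem exists_graph_right (hd : d ∈ δ.rangeIdeal s) : ∃ x, ψ.Graph x d :=
  ⟨ψ.equiv.symm ⟨d, hd⟩, (ψ.equiv.symm ⟨d, hd⟩).2, by simp⟩

theorem Graph.right_unique (h : ψ.Graph x d) (h' : ψ.Graph x e) : d = e := by
  obtain ⟨h, rfl⟩ := h
  obtain ⟨h', rfl⟩ := h'
  rfl

theorem Graph.left_unique (h : ψ.Graph x d) (h' : ψ.Graph y d) : x = y := by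
  obtain ⟨h, rfl⟩ := h
  obtain ⟨h', h''⟩ := h'
  exact (congrArg Subtype.val (ψ.equiv.injective (Subtype.ext h''))).symm

theorem Graph.add (h : ψ.Graph x d) (h' : ψ.Graph y e) : ψ.Graph (x + y) (d + e) := by
  obtain ⟨h, rfl⟩ := h
  obtain ⟨h', rfl⟩ := h'
  exact ⟨add_mem h h', congrArg Subtype.val (map_add ψ.equiv ⟨x, h⟩ ⟨y, h'⟩)⟩

theorem Graph.smul (k : ℂ) (h : ψ.Graph x d) : ψ.Graph (k • x) (k • d) := by
  obtain ⟨h, rfl⟩ := h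
  exact ⟨Submodule.smul_mem _ k h, congrArg Subtype.val (map_smul ψ.equiv k ⟨x, h⟩)⟩

theorem Graph.mul_star_eq (h : ψ.Graph x d) (h' : ψ.Graph y e) : d * star e = x * star y := by
  obtain ⟨h, rfl⟩ := h
  obtain ⟨h', rfl⟩ := h'
  exact ψ.map_inner _ _

theorem Graph.norm_eq (h : ψ.Graph x d) : ‖d‖ = ‖x‖ := by
  have h1 := congrArg norm (h.mul_star_eq h)
  rw [CStarRing.norm_self_mul_star, CStarRing.norm_self_mul_star] at h1
  exact (mul_self_inj (norm_nonneg _) (norm_nonneg _)).mp h1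

theorem Graph.rangeIdeal_mul (h : ψ.Graph x d) (he : e ∈ δ.rangeIdeal s) :
    ψ.Graph (e * x) (e * d) := by
  obtain ⟨h, rfl⟩ := h
  exact ⟨_, ψ.map_module ⟨e, he⟩ ⟨x, h⟩⟩

/-- Linearity is assumed only over `D_s`. For `b ∈ B_e` and `e ∈ D_s` the product `e b` is in `D_s`,
so `ψ(b x) - b ψ(x)`, an element of `D_s`, is annihilated by `D_s` and hence zero. -/
theorem Graph.mul (h : ψ.Graph x d) (hb : b ∈ δ.spectral 1) : ψ.Graph (b * x) (b * d) := by
  obtain ⟨f, hf⟩ := exists_graph_left (ψ := ψ) (one_mul_mem_spectral hb h.mem_left)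
  have h1 : ∀ e ∈ δ.rangeIdeal s, e * (f - b * d) = 0 := fun e he => by
    have h2 := hf.rangeIdeal_mul he
    rw [← mul_assoc] at h2
    rw [mul_sub, h2.right_unique (h.rangeIdeal_mul (mul_one_mem_rangeIdeal he hb)), mul_assoc,
      sub_self]
  have h2 : f - b * d = 0 := (CStarRing.star_mul_self_eq_zero_iff _).mp (h1 _
    (star_mem_rangeIdeal (sub_mem hf.mem_right (mul_mem_rangeIdeal hb h.mem_right))))
  rwa [sub_eq_zero.mp h2] at hf

end Single

variable {ψ : ∀ s, δ.ModuleIso s} {x y d e f b : B}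

theorem Graph.mul_of_isMultiplicative (hψ : IsMultiplicative ψ) (hx : x ∈ δ.spectral s)
    (hy : (ψ t).Graph y e) (h : (ψ s).Graph (x * e) f) : (ψ (s * t)).Graph (x * y) f := by
  obtain ⟨hy, rfl⟩ := hy
  obtain ⟨h, rfl⟩ := h
  exact ⟨_, hψ s t ⟨x, hx⟩ ⟨y, hy⟩⟩

theorem graph_congr (h : s = t) (h' : (ψ s).Graph x d) : (ψ t).Graph x d := h ▸ h'

/-- Multiplicativity at `s = t = e` reads `ψ_e(y x) = ψ_e(y ψ_e(x))`, so injectivity gives `y (x -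
ψ_e(x)) = 0` for all `y ∈ B_e`. -/
theorem graph_one (hψ : IsMultiplicative ψ) (hx : x ∈ δ.spectral 1) : (ψ 1).Graph x x := by
  obtain ⟨d, hd⟩ := exists_graph_left (ψ := ψ 1) hx
  have h1 : ∀ y ∈ δ.spectral 1, y * (x - d) = 0 := fun y hy => by
    obtain ⟨f, hf⟩ := exists_graph_left (ψ := ψ 1)
      (mul_one_mem_spectral hy (δ.rangeIdeal_le 1 hd.mem_right))
    have h2 := graph_congr (one_mul 1) (hd.mul_of_isMultiplicative hψ hy hf)
    rw [mul_sub, h2.left_unique hf, sub_self]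
  have h2 : x - d = 0 := (CStarRing.star_mul_self_eq_zero_iff _).mp (h1 _
    (star_mem_spectral_one (sub_mem hx (δ.rangeIdeal_le 1 hd.mem_right))))
  rwa [← sub_eq_zero.mp h2] at hd

end ModuleIso

open ModuleIso

variable {δ : Coaction G B}

/-- The graph of the partial action: `c` and `d` are related if there is `n ∈ B_s` with
`ψ_{s⁻¹}(n⋆) = c⋆` and `ψ_s(n) = d`. -/
def ActionRel (ψ : ∀ s, δ.ModuleIso s) (s : G) (c d : B) : Prop :=
  ∃ n, (ψ s⁻¹).Graph (star n) (star c) ∧ (ψ s).Graph n d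

namespace ActionRel

variable {ψ : ∀ s, δ.ModuleIso s} {s t : G} {a b c d e f n : B}

theorem mem_left (h : ActionRel ψ s c d) : c ∈ δ.rangeIdeal s⁻¹ := by
  obtain ⟨n, h, -⟩ := h
  simpa using star_mem_rangeIdeal h.mem_right

theorem mem_right (h : ActionRel ψ s c d) : d ∈ δ.rangeIdeal s := by
  obtain ⟨n, -, h⟩ := h
  exact h.mem_right

theorem exists_right (hc : c ∈ δ.rangeIdeal s⁻¹) : ∃ d, ActionRel ψ s c d := by
  obtain ⟨n, hn⟩ := exists_graph_right (ψ := ψ s⁻¹) (star_mem_rangeIdeal hc)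
  obtain ⟨d, hd⟩ := exists_graph_left (ψ := ψ s) (star_mem_spectral_inv hn.mem_left)
  exact ⟨d, star n, by rwa [star_star], hd⟩

theorem exists_of_graph (h : (ψ s).Graph n d) :
    ∃ c, (ψ s⁻¹).Graph (star n) (star c) ∧ ActionRel ψ s c d := by
  obtain ⟨c, hc⟩ := exists_graph_left (ψ := ψ s⁻¹) (δ.star_mem_spectral h.mem_left)
  exact ⟨star c, by rwa [star_star], n, by rwa [star_star], h⟩

theorem exists_left (hd : d ∈ δ.rangeIdeal s) : ∃ c, ActionRel ψ s c d := by
  obtain ⟨n, hn⟩ := exists_graph_right (ψ := ψ s) hd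
  obtain ⟨c, -, hc⟩ := exists_of_graph hn
  exact ⟨c, hc⟩

theorem right_unique (h : ActionRel ψ s c d) (h' : ActionRel ψ s c e) : d = e := by
  obtain ⟨n, h1, h2⟩ := h
  obtain ⟨m, h3, h4⟩ := h'
  obtain rfl := star_injective (h1.left_unique h3)
  exact h2.right_unique h4

theorem left_unique (h : ActionRel ψ s c e) (h' : ActionRel ψ s d e) : c = d := by
  obtain ⟨n, h1, h2⟩ := h
  obtain ⟨m, h3, h4⟩ := h'
  obtain rfl := h2.left_unique h4
  exact star_injective (h1.right_unique h3)

theorem graph (h : ActionRel ψ s c d) (hn : (ψ s).Graph n d) :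
    (ψ s⁻¹).Graph (star n) (star c) := by
  obtain ⟨m, h1, h2⟩ := h
  rwa [hn.left_unique h2]

theorem add (h : ActionRel ψ s c d) (h' : ActionRel ψ s e f) : ActionRel ψ s (c + e) (d + f) := by
  obtain ⟨n, h1, h2⟩ := h
  obtain ⟨m, h3, h4⟩ := h'
  exact ⟨n + m, by rw [star_add, star_add]; exact h1.add h3, h2.add h4⟩

theorem smul (k : ℂ) (h : ActionRel ψ s c d) : ActionRel ψ s (k • c) (k • d) := by
  obtain ⟨n, h1, h2⟩ := h
  exact ⟨k • n, by rw [star_smul, star_smul]; exact h1.smul _, h2.smul k⟩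

theorem sub (h : ActionRel ψ s c d) (h' : ActionRel ψ s e f) : ActionRel ψ s (c - e) (d - f) := by
  simpa [sub_eq_add_neg] using h.add (h'.smul (-1))

theorem norm_eq (h : ActionRel ψ s c d) : ‖d‖ = ‖c‖ := by
  obtain ⟨n, h1, h2⟩ := h
  rw [h2.norm_eq, ← norm_star n, ← norm_star c, h1.norm_eq]

/-- `n_s(c) b = n_s(c b)` for `b ∈ B_e`. -/
theorem exists_mul (h : ActionRel ψ s c d) (hn : (ψ s).Graph n d) (hb : b ∈ δ.spectral 1) :
    ∃ e, (ψ s).Graph (n * b) e ∧ ActionRel ψ s (c * b) e := by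
  obtain ⟨e, he⟩ := exists_graph_left (ψ := ψ s) (mul_one_mem_spectral hn.mem_left hb)
  refine ⟨e, he, n * b, ?_, he⟩
  rw [star_mul, star_mul]
  exact (h.graph hn).mul (star_mem_spectral_one hb)

/-- Let `n` and `m` be the witnesses for `c` and `e⋆`. Multiplicativity with `ψ_e = id` gives `n m⋆
= ψ_s(n ψ_{s⁻¹}(m⋆)) = ψ_s(n e)`, whereas `n m⋆ = d f⋆` because `ψ_s` preserves inner products. This
product formula is available before the relation is known to respect the involution. -/
theorem mul_star (hψ : IsMultiplicative ψ) (h : ActionRel ψ s c d) (h' : ActionRel ψ s (star e) f) :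
    ActionRel ψ s (c * e) (d * star f) := by
  obtain ⟨n, h1, h2⟩ := h
  obtain ⟨m, h3, h4⟩ := h'
  rw [star_star] at h3
  obtain ⟨g, hg, hg'⟩ := exists_mul ⟨n, h1, h2⟩ h2 (δ.rangeIdeal_le _ h3.mem_right)
  have h5 := graph_congr (mul_inv_cancel s) (h3.mul_of_isMultiplicative hψ h2.mem_left hg)
  rw [h2.mul_star_eq h4, ← h5.right_unique (graph_one hψ h5.mem_left)]
  exact hg'

/-- Let `f` be the image of `c⋆`, and let `a'`, `e'` have images `a`, `e⋆`. Bracketing `a' c e'⋆` in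
the two possible ways, `mul_star` gives the images `a d e` and `a f⋆ e`. So `a (d - f⋆) e = 0` for
all `a, e ∈ D_s`. -/
theorem star (hψ : IsMultiplicative ψ) (h : ActionRel ψ s c d) :
    ActionRel ψ s (star c) (star d) := by
  obtain ⟨f, hf⟩ := exists_right (ψ := ψ) (star_mem_rangeIdeal h.mem_left)
  have key : ∀ a ∈ δ.rangeIdeal s, ∀ e ∈ δ.rangeIdeal s, a * (d - Star.star f) * e = 0 := by
    intro a ha e he
    obtain ⟨a', ha'⟩ := exists_left (ψ := ψ) ha
    obtain ⟨e', he'⟩ := exists_left (ψ := ψ) (star_mem_rangeIdeal he)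
    have h1 : ActionRel ψ s (e' * Star.star c) (Star.star e * Star.star d) :=
      he'.mul_star hψ (by rwa [star_star])
    have h2 : ActionRel ψ s (a' * (c * Star.star e')) (a * Star.star (Star.star e * Star.star d)) :=
      ha'.mul_star hψ (by simpa using h1)
    have h3 : ActionRel ψ s (a' * c * Star.star e') (a * Star.star f * Star.star (Star.star e)) :=
      (ha'.mul_star hψ hf).mul_star hψ (by rwa [star_star])
    rw [mul_assoc] at h3
    have h4 := h2.right_unique h3
    rw [mul_sub, sub_mul, sub_eq_zero]
    simpa [mul_assoc] using h4
  have hz : d - Star.star f ∈ δ.rangeIdeal s := sub_mem h.mem_right (star_mem_rangeIdeal hf.mem_right)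
  set z := d - Star.star f with hzdef
  -- With `a = e = z⋆` this is `z⋆ z z⋆ = 0`, hence `(z z⋆)⋆(z z⋆) = 0`.
  have h1 := key _ (star_mem_rangeIdeal hz) _ (star_mem_rangeIdeal hz)
  have h2 : z * Star.star z = 0 := by
    rw [← CStarRing.star_mul_self_eq_zero_iff, star_mul, star_star, mul_assoc,
      ← mul_assoc (Star.star z), h1, mul_zero]
  rw [CStarRing.mul_star_self_eq_zero_iff, hzdef, sub_eq_zero] at h2
  rwa [h2, star_star]

theorem mul (hψ : IsMultiplicative ψ) (h : ActionRel ψ s c d) (h' : ActionRel ψ s e f) :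
    ActionRel ψ s (c * e) (d * f) := by
  simpa using h.mul_star hψ (h'.star hψ)

theorem inv (hψ : IsMultiplicative ψ) (h : ActionRel ψ s c d) : ActionRel ψ s⁻¹ d c := by
  obtain ⟨n, h1, h2⟩ := h.star hψ
  rw [star_star] at h1
  exact ⟨Star.star n, by rw [star_star]; exact graph_congr (inv_inv s).symm h2, h1⟩

/-- A witness for `st` is sought as a product `n m` of witnesses for `s` and `t`. If `n` belongs to
`(b, c)` and `m` to `e`, the product `n m` belongs to `a e` rather than to `a`: multiplicativity
gives `ψ_{st}(n m) = ψ_s(n ψ_t(m))`, and its adjoint version produces `(a e)⋆`. -/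
theorem comp_mul (hψ : IsMultiplicative ψ) (h : ActionRel ψ t a b) (h' : ActionRel ψ s b c)
    (he : e ∈ δ.rangeIdeal t⁻¹) :
    ∃ f g, ActionRel ψ t (a * e) f ∧ ActionRel ψ s f g ∧ ActionRel ψ (s * t) (a * e) g := by
  obtain ⟨b', hb'⟩ := exists_right (ψ := ψ) he
  obtain ⟨n, h1, h2⟩ := h'
  obtain ⟨m, h3, h4⟩ := hb'
  have hb' : ActionRel ψ t e b' := ⟨m, h3, h4⟩
  obtain ⟨g, hg, hg'⟩ := exists_mul ⟨n, h1, h2⟩ h2 (δ.rangeIdeal_le _ hb'.mem_right)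
  refine ⟨b * b', g, h.mul hψ hb', hg', n * m, ?_, h4.mul_of_isMultiplicative hψ h2.mem_left hg⟩
  rw [star_mul]
  obtain ⟨k, hk, hk'⟩ := exists_mul ((hb'.star hψ).inv hψ) h3
    (δ.rangeIdeal_le _ (star_mem_rangeIdeal h.mem_right))
  have h5 := (((hb'.star hψ).inv hψ).mul hψ ((h.star hψ).inv hψ)).right_unique hk'
  rw [← star_mul] at h5
  rw [h5]
  exact graph_congr (mul_inv_rev s t).symm (h1.mul_of_isMultiplicative hψ h3.mem_left hk)

theorem comp (hψ : IsMultiplicative ψ) (h : ActionRel ψ t a b) (h' : ActionRel ψ s b c) :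
    ActionRel ψ (s * t) a c := by
  have h1 : a ∈ δ.rangeIdeal (s * t)⁻¹ :=
    rangeIdeal_induction_right h.mem_left (isClosed_rangeIdeal _) fun e he => by
      obtain ⟨f, g, -, -, hg⟩ := comp_mul hψ h h' he
      exact hg.mem_left
  obtain ⟨c', hc'⟩ := exists_right (ψ := ψ) h1
  -- For `x = a e` the composition law holds exactly, and the relations are isometric, so the two
  -- candidate images of `a` differ by at most `2 ‖a - a e‖`. The condition is closed in `x`, and at
  -- `x = a` the bound is zero.
  have h2 : a ∈ {x : B | ‖c' - c‖ ≤ 2 * ‖a - x‖} :=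
    rangeIdeal_induction_right h.mem_left
      (isClosed_le continuous_const (by fun_prop)) fun e he => by
        obtain ⟨f, g, hf, hg, hg'⟩ := comp_mul hψ h h' he
        have h3 := (hc'.sub hg').norm_eq
        have h4 := (h'.sub hg).norm_eq.trans (h.sub hf).norm_eq
        have h5 : c' - c = (c' - g) - (c - g) := by abel
        change ‖c' - c‖ ≤ 2 * ‖a - a * e‖
        rw [h5]
        refine (norm_sub_le _ _).trans ?_
        rw [h3, h4]
        linarith
  have h3 : ‖c' - c‖ ≤ 2 * ‖a - a‖ := h2
  rw [sub_self, norm_zero, mul_zero] at h3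
  rwa [← sub_eq_zero.mp (norm_le_zero_iff.mp h3)]

end ActionRel

end Coaction

end

/-! ### The partial action on `B_e` and the pairing of `B` with its crossed product -/

noncomputable section

namespace Coaction

variable {G B : Type u} [Group G] [NonUnitalCStarAlgebra B] (δ : Coaction G B)

instance : IsClosed (δ.unitFiber : Set B) := δ.isClosed_unitFiber

/-- The spectral subspace `B_e` as a C⋆-algebra. -/
def UnitFiber : Type u := δ.unitFiber

instance : NonUnitalCStarAlgebra δ.UnitFiber :=
  NonUnitalStarSubalgebra.nonUnitalCStarAlgebra δ.unitFiber

instance : PartialOrder δ.UnitFiber := CStarAlgebra.spectralOrder _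

instance : StarOrderedRing δ.UnitFiber := CStarAlgebra.spectralOrderedRing _

/-- The inclusion of `B_e` in `B`. -/
def unitInclusion : δ.UnitFiber →⋆ₙₐ[ℂ] B := NonUnitalStarSubalgebraClass.subtype δ.unitFiber

theorem unitInclusion_injective : Function.Injective δ.unitInclusion := Subtype.val_injective

theorem norm_unitInclusion (a : δ.UnitFiber) : ‖δ.unitInclusion a‖ = ‖a‖ := rfl

theorem unitInclusion_mem (a : δ.UnitFiber) : δ.unitInclusion a ∈ δ.spectral 1 :=
  Subtype.prop (p := (· ∈ δ.unitFiber)) a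

/-- The element of `B_e` given by an element of `B`. -/
def toUnitFiber (b : B) (hb : b ∈ δ.spectral 1) : δ.UnitFiber := (⟨b, hb⟩ : δ.unitFiber)

/-- The ideal `D_s` of `B_e`. -/
def fiberIdeal (s : G) : NonUnitalStarSubalgebra ℂ δ.UnitFiber :=
  (δ.rangeAlgebra s).comap δ.unitInclusion

variable {δ}

theorem mem_fiberIdeal {s : G} {a : δ.UnitFiber} :
    a ∈ δ.fiberIdeal s ↔ δ.unitInclusion a ∈ δ.rangeIdeal s := Iff.rfl

variable {ψ : ∀ s, δ.ModuleIso s}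

theorem exists_actionRel_right {s : G} (a : δ.fiberIdeal s⁻¹) :
    ∃ b : δ.fiberIdeal s, ActionRel ψ s (δ.unitInclusion a) (δ.unitInclusion b) := by
  obtain ⟨d, hd⟩ := ActionRel.exists_right (ψ := ψ) a.2
  exact ⟨⟨δ.toUnitFiber d (δ.rangeIdeal_le _ hd.mem_right), hd.mem_right⟩, hd⟩

theorem exists_actionRel_left {s : G} (b : δ.fiberIdeal s) :
    ∃ a : δ.fiberIdeal s⁻¹, ActionRel ψ s (δ.unitInclusion a) (δ.unitInclusion b) := by
  obtain ⟨d, hd⟩ := ActionRel.exists_left (ψ := ψ) b.2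
  exact ⟨⟨δ.toUnitFiber d (δ.rangeIdeal_le _ hd.mem_left), hd.mem_left⟩, hd⟩

theorem exists_fiberEquiv (hψ : IsMultiplicative ψ) (s : G) :
    ∃ α : δ.fiberIdeal s⁻¹ ≃⋆ₐ[ℂ] δ.fiberIdeal s, ∀ a : δ.fiberIdeal s⁻¹,
      ActionRel ψ s (δ.unitInclusion a) (δ.unitInclusion (α a)) := by
  choose f hf using fun a : δ.fiberIdeal s⁻¹ => exists_actionRel_right (ψ := ψ) a
  choose g hg using fun a : δ.fiberIdeal s => exists_actionRel_left (ψ := ψ) a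
  have hinj : ∀ {t : G} {a b : δ.fiberIdeal t}, δ.unitInclusion a = δ.unitInclusion b → a = b :=
    fun h => Subtype.ext (δ.unitInclusion_injective h)
  exact ⟨
    { toFun := f
      invFun := g
      left_inv := fun a => hinj ((hg _).left_unique (hf a))
      right_inv := fun a => hinj ((hf _).right_unique (hg a))
      map_add' := fun a b => hinj ((hf (a + b)).right_unique ((hf a).add (hf b)))
      map_smul' := fun k a => hinj ((hf (k • a)).right_unique ((hf a).smul k))
      map_mul' := fun a b => hinj ((hf (a * b)).right_unique ((hf a).mul hψ (hf b)))
      map_star' := fun a => hinj ((hf (star a)).right_unique ((hf a).star hψ)) }, hf⟩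

/-- The partial action on `B_e` given by a multiplicative family of module isomorphisms. -/
def partialAction (hψ : IsMultiplicative ψ) : PartialAction G δ.UnitFiber where
  D := δ.fiberIdeal
  isClosed_D s := (isClosed_rangeIdeal s).preimage continuous_subtype_val
  mul_mem_left s a d hd := mul_mem_rangeIdeal (δ.unitInclusion_mem a) hd
  mul_mem_right s a d hd := mul_one_mem_rangeIdeal hd (δ.unitInclusion_mem a)
  α s := Classical.choose (exists_fiberEquiv hψ s)
  D_one := by
    refine top_unique fun a _ => ?_
    rw [mem_fiberIdeal, rangeIdeal_one]
    exact δ.unitInclusion_mem a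
  extend s t a h := by
    have h1 := Classical.choose_spec (exists_fiberEquiv hψ t) a
    have h2 := h1.comp hψ (Classical.choose_spec (exists_fiberEquiv hψ s) ⟨_, h⟩)
    refine ⟨h2.mem_left, δ.unitInclusion_injective ?_⟩
    exact (Classical.choose_spec (exists_fiberEquiv hψ (s * t)) ⟨a, h2.mem_left⟩).right_unique h2

theorem partialAction_rel (hψ : IsMultiplicative ψ) {s : G} {a b : δ.UnitFiber}
    (h : ActionRel ψ s (δ.unitInclusion a) (δ.unitInclusion b)) : (partialAction hψ).Rel s a b :=
  ⟨h.mem_left, δ.unitInclusion_injective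
    ((Classical.choose_spec (exists_fiberEquiv hψ s) ⟨a, h.mem_left⟩).right_unique h)⟩

/-- The element `ψ_s(x) m_s` of the reduced crossed product, where `d = ψ_s(x)`. -/
def fiberGenerator (hψ : IsMultiplicative ψ) (s : G) (d : B) (hd : d ∈ δ.rangeIdeal s) :
    (partialAction hψ).ReducedCrossedProduct :=
  (partialAction hψ).generator s ⟨δ.toUnitFiber d (δ.rangeIdeal_le s hd), hd⟩

variable (hψ : IsMultiplicative ψ)

/-- The pairs `(x, ψ_s(x) m_s)`, `x ∈ B_s`. -/
def generatorPairs : Set (B × (partialAction hψ).ReducedCrossedProduct) :=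
  {p | ∃ s x d, ∃ h : (ψ s).Graph x d, p = (x, fiberGenerator hψ s d h.mem_right)}

variable {hψ}

/-- With `d = ψ_s(x)`, `e = ψ_t(y)` and `d = α_s(c)`, the product of the second components is `d m_s
e m_t = α_s(c e) m_{st}`, and `α_s(c e) = ψ_s(x e) = ψ_{st}(x y)`. -/
theorem mul_mem_generatorPairs {p q : B × (partialAction hψ).ReducedCrossedProduct}
    (hp : p ∈ generatorPairs hψ) (hq : q ∈ generatorPairs hψ) : p * q ∈ generatorPairs hψ := by
  obtain ⟨s, x, d, h, rfl⟩ := hp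
  obtain ⟨t, y, e, h', rfl⟩ := hq
  obtain ⟨c, hc, hcd⟩ := ActionRel.exists_of_graph h
  have he := δ.rangeIdeal_le t h'.mem_right
  obtain ⟨f, hf, hf'⟩ := hcd.exists_mul h he
  refine ⟨s * t, x * y, f, h'.mul_of_isMultiplicative hψ h.mem_left hf, Prod.ext rfl ?_⟩
  have h1 := partialAction_rel hψ (a := δ.toUnitFiber c (δ.rangeIdeal_le _ hcd.mem_left))
    (b := δ.toUnitFiber d (δ.rangeIdeal_le _ h.mem_right)) hcd
  have h2 := partialAction_rel hψ
    (a := δ.toUnitFiber c (δ.rangeIdeal_le _ hcd.mem_left) * δ.toUnitFiber e he)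
    (b := δ.toUnitFiber f (δ.rangeIdeal_le _ hf.mem_right)) hf'
  exact h1.generator_mul h2 h'.mem_right

theorem star_mem_generatorPairs {p : B × (partialAction hψ).ReducedCrossedProduct}
    (hp : p ∈ generatorPairs hψ) : star p ∈ generatorPairs hψ := by
  obtain ⟨s, x, d, h, rfl⟩ := hp
  obtain ⟨c, hc, hcd⟩ := ActionRel.exists_of_graph h
  have h1 := partialAction_rel hψ (a := δ.toUnitFiber c (δ.rangeIdeal_le _ hcd.mem_left))
    (b := δ.toUnitFiber d (δ.rangeIdeal_le _ h.mem_right)) hcd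
  exact ⟨s⁻¹, star x, star c, hc, Prod.ext rfl h1.star_generator⟩

theorem mul_mem_span_generatorPairs {p q : B × (partialAction hψ).ReducedCrossedProduct}
    (hp : p ∈ Submodule.span ℂ (generatorPairs hψ)) (hq : q ∈ Submodule.span ℂ (generatorPairs hψ)) :
    p * q ∈ Submodule.span ℂ (generatorPairs hψ) := by
  induction hp using Submodule.span_induction with
  | zero => rw [zero_mul]; exact zero_mem _
  | add p p' _ _ h h' => rw [add_mul]; exact add_mem h h'
  | smul k p _ h => rw [smul_mul_assoc]; exact Submodule.smul_mem _ k h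
  | mem p hp =>
    induction hq using Submodule.span_induction with
    | zero => rw [mul_zero]; exact zero_mem _
    | add p p' _ _ h h' => rw [mul_add]; exact add_mem h h'
    | smul k p _ h => rw [mul_smul_comm]; exact Submodule.smul_mem _ k h
    | mem q hq => exact Submodule.subset_span (mul_mem_generatorPairs hp hq)

theorem star_mem_span_generatorPairs {p : B × (partialAction hψ).ReducedCrossedProduct}
    (hp : p ∈ Submodule.span ℂ (generatorPairs hψ)) :
    star p ∈ Submodule.span ℂ (generatorPairs hψ) := by
  induction hp using Submodule.span_induction with
  | zero => rw [star_zero]; exact zero_mem _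
  | add p p' _ _ h h' => rw [star_add]; exact add_mem h h'
  | smul k p _ h => rw [star_smul]; exact Submodule.smul_mem _ _ h
  | mem p hp => exact Submodule.subset_span (star_mem_generatorPairs hp)

/-- Both expectations vanish on the fibres with `s ≠ e`, and over `e` the pairing is the identity
because `ψ_e = id`. -/
theorem expectation_of_mem_generatorPairs {p : B × (partialAction hψ).ReducedCrossedProduct}
    (hp : p ∈ generatorPairs hψ) : ∃ a : δ.UnitFiber, δ.fourier 1 p.1 = δ.unitInclusion a ∧
      (partialAction hψ).expectation p.2 = universalRep δ.UnitFiber a := by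
  classical
  obtain ⟨s, x, d, h, rfl⟩ := hp
  by_cases hs : s = 1
  · subst hs
    obtain rfl := h.right_unique (ModuleIso.graph_one hψ h.mem_left)
    exact ⟨δ.toUnitFiber d h.mem_left, (δ.fourier_of_mem h.mem_left).trans (if_pos rfl),
      PartialAction.expectation_generator_one _⟩
  · exact ⟨0, ((δ.fourier_of_mem h.mem_left).trans (if_neg hs)).trans (map_zero _).symm,
      (PartialAction.expectation_generator_ne hs _).trans (map_zero _).symm⟩

theorem expectation_of_mem_span_generatorPairs {p : B × (partialAction hψ).ReducedCrossedProduct}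
    (hp : p ∈ Submodule.span ℂ (generatorPairs hψ)) : ∃ a : δ.UnitFiber,
      δ.fourier 1 p.1 = δ.unitInclusion a ∧
      (partialAction hψ).expectation p.2 = universalRep δ.UnitFiber a := by
  induction hp using Submodule.span_induction with
  | zero => exact ⟨0, (map_zero _).trans (map_zero _).symm, (map_zero _).trans (map_zero _).symm⟩
  | add p p' _ _ h h' =>
    obtain ⟨a, h1, h2⟩ := h
    obtain ⟨b, h3, h4⟩ := h'
    exact ⟨a + b, ((δ.fourier 1).map_add p.1 p'.1).trans (by rw [h1, h3, map_add]),
      ((partialAction hψ).expectation.map_add p.2 p'.2).trans (by rw [h2, h4, map_add])⟩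
  | smul k p _ h =>
    obtain ⟨a, h1, h2⟩ := h
    exact ⟨k • a, ((δ.fourier 1).map_smul k p.1).trans (by rw [h1, map_smul]),
      ((partialAction hψ).expectation.map_smul k p.2).trans (by rw [h2, map_smul])⟩
  | mem p hp => exact expectation_of_mem_generatorPairs hp

theorem dense_fst_generatorPairs (hδ : δ.IsNormal) : Dense (Prod.fst '' (Submodule.span ℂ
    (generatorPairs hψ) : Set (B × (partialAction hψ).ReducedCrossedProduct))) := by
  intro b
  refine closure_mono ?_ (mem_closure_span_spectral hδ b)
  change Submodule.span ℂ {x : B | ∃ s, x ∈ δ.spectral s} ≤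
    (Submodule.span ℂ (generatorPairs hψ)).map (LinearMap.fst ℂ _ _)
  refine Submodule.span_le.mpr ?_
  rintro x ⟨s, hx⟩
  obtain ⟨d, hd⟩ := ModuleIso.exists_graph_left (ψ := ψ s) hx
  exact ⟨_, Submodule.subset_span ⟨s, x, d, hd, rfl⟩, rfl⟩

theorem dense_snd_generatorPairs : Dense (Prod.snd '' (Submodule.span ℂ
    (generatorPairs hψ) : Set (B × (partialAction hψ).ReducedCrossedProduct))) := by
  intro z
  refine closure_mono ?_ (PartialAction.mem_closure_span_generator z)
  change Submodule.span ℂ {z | ∃ s a, z = (partialAction hψ).generator s a} ≤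
    (Submodule.span ℂ (generatorPairs hψ)).map (LinearMap.snd ℂ _ _)
  refine Submodule.span_le.mpr ?_
  rintro _ ⟨s, a, rfl⟩
  obtain ⟨x, hx⟩ := ModuleIso.exists_graph_right (ψ := ψ s) a.2
  exact ⟨_, Submodule.subset_span ⟨s, x, _, hx, rfl⟩, rfl⟩

end Coaction

end

/-! ### Transport of coactions -/

noncomputable section

namespace MinTensor

variable {A C C₁ A' C' C₁' : Type u} [NonUnitalCStarAlgebra A] [NonUnitalCStarAlgebra C]
  [NonUnitalCStarAlgebra C₁] [NonUnitalCStarAlgebra A'] [NonUnitalCStarAlgebra C']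
  [NonUnitalCStarAlgebra C₁']

theorem AssocRel.map {x : MinTensor (MinTensor A C) C₁} {y : MinTensor A (MinTensor C C₁)}
    (h : AssocRel x y) (φ : A →⋆ₙₐ[ℂ] A') (χ : C →⋆ₙₐ[ℂ] C') (τ : C₁ →⋆ₙₐ[ℂ] C₁') :
    AssocRel (MinTensor.map (MinTensor.map φ χ) τ x) (MinTensor.map φ (MinTensor.map χ τ) y) := by
  let k : MinTensor (MinTensor A C) C₁ × MinTensor A (MinTensor C C₁) →L[ℂ]
      MinTensor (MinTensor A' C') C₁' × MinTensor A' (MinTensor C' C₁') :=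
    (MinTensor.map (MinTensor.map φ χ) τ).toCLM.prodMap (MinTensor.map φ (MinTensor.map χ τ)).toCLM
  refine Submodule.topologicalClosure_minimal _ (t := (Submodule.topologicalClosure
    (Submodule.span ℂ {z : MinTensor (MinTensor A' C') C₁' × MinTensor A' (MinTensor C' C₁') |
    ∃ a b c, z = (tmul (tmul a b) c, tmul a (tmul b c))})).comap k.toLinearMap)
    (Submodule.span_le.mpr ?_)
    ((Submodule.isClosed_topologicalClosure _).preimage k.continuous) h
  rintro _ ⟨a, b, c, rfl⟩
  refine Submodule.le_topologicalClosure _ (Submodule.subset_span ⟨φ a, χ b, τ c, ?_⟩)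
  refine Prod.ext ?_ ?_
  · change MinTensor.map (MinTensor.map φ χ) τ (tmul (tmul a b) c) = _
    rw [map_tmul, map_tmul]
  · change MinTensor.map φ (MinTensor.map χ τ) (tmul a (tmul b c)) = _
    rw [map_tmul, map_tmul]

theorem map_starAlgEquiv_symm_apply (θ : A ≃⋆ₐ[ℂ] A') (z : MinTensor A C) :
    MinTensor.map (θ.symm : A' →⋆ₙₐ[ℂ] A) (NonUnitalStarAlgHom.id ℂ C)
      (MinTensor.map (θ : A →⋆ₙₐ[ℂ] A') (NonUnitalStarAlgHom.id ℂ C) z) = z := by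
  rw [map_map]
  have h : (θ.symm : A' →⋆ₙₐ[ℂ] A).comp (θ : A →⋆ₙₐ[ℂ] A') = NonUnitalStarAlgHom.id ℂ A :=
    NonUnitalStarAlgHom.ext fun a => θ.symm_apply_apply a
  rw [h]
  exact map_id z

theorem map_starAlgEquiv_apply_symm (θ : A ≃⋆ₐ[ℂ] A') (z : MinTensor A' C) :
    MinTensor.map (θ : A →⋆ₙₐ[ℂ] A') (NonUnitalStarAlgHom.id ℂ C)
      (MinTensor.map (θ.symm : A' →⋆ₙₐ[ℂ] A) (NonUnitalStarAlgHom.id ℂ C) z) = z :=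
  map_starAlgEquiv_symm_apply θ.symm z

end MinTensor

namespace Coaction

variable {G B C : Type u} [Group G] [NonUnitalCStarAlgebra B] [NonUnitalCStarAlgebra C]

/-- The coaction `(θ ⊗ ι) ∘ δ ∘ θ⁻¹`. -/
def transport (δ : Coaction G B) (θ : B ≃⋆ₐ[ℂ] C) : Coaction G C where
  hom := ((MinTensor.map (θ : B →⋆ₙₐ[ℂ] C) (NonUnitalStarAlgHom.id ℂ (GroupCStar G))).comp
    δ.hom).comp (θ.symm : C →⋆ₙₐ[ℂ] B)
  injective := by
    have h : Function.Injective (MinTensor.map (θ : B →⋆ₙₐ[ℂ] C)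
        (NonUnitalStarAlgHom.id ℂ (GroupCStar G))) :=
      Function.LeftInverse.injective (MinTensor.map_starAlgEquiv_symm_apply θ)
    exact fun c c' hc => θ.symm.injective (δ.injective (h hc))
  nondegenerate := by
    refine top_unique fun z _ => ?_
    let Θ := MinTensor.map (θ : B →⋆ₙₐ[ℂ] C) (NonUnitalStarAlgHom.id ℂ (GroupCStar G))
    let Θ' := MinTensor.map (θ.symm : C →⋆ₙₐ[ℂ] B) (NonUnitalStarAlgHom.id ℂ (GroupCStar G))
    have hΘ : ∀ z, Θ (Θ' z) = z := MinTensor.map_starAlgEquiv_apply_symm θ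
    have h1 : Θ' z ∈ (Submodule.span ℂ {z : MinTensor B (GroupCStar G) |
        ∃ b x, z = δ.hom b * x}).topologicalClosure := by
      rw [δ.nondegenerate]
      trivial
    have h2 := Submodule.topologicalClosure_minimal _ (t := (Submodule.topologicalClosure
      (Submodule.span ℂ {z : MinTensor C (GroupCStar G) |
        ∃ c x, z = Θ (δ.hom (θ.symm c)) * x})).comap Θ.toCLM.toLinearMap)
      (Submodule.span_le.mpr ?_)
      ((Submodule.isClosed_topologicalClosure _).preimage Θ.toCLM.continuous) h1
    · rw [Submodule.mem_comap] at h2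
      change Θ.toCLM (Θ' z) ∈ _ at h2
      rw [NonUnitalStarAlgHom.toCLM_apply, hΘ] at h2
      exact h2
    · rintro _ ⟨b, x, rfl⟩
      refine Submodule.le_topologicalClosure _ (Submodule.subset_span ⟨θ b, Θ x, ?_⟩)
      rw [θ.symm_apply_apply]
      exact map_mul Θ _ _
  coassoc c := by
    have h := (δ.coassoc (θ.symm c)).map (θ : B →⋆ₙₐ[ℂ] C)
      (NonUnitalStarAlgHom.id ℂ (GroupCStar G)) (NonUnitalStarAlgHom.id ℂ (GroupCStar G))
    rw [MinTensor.map_map, MinTensor.map_map] at h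
    change MinTensor.AssocRel (MinTensor.map _ _ (MinTensor.map _ _ (δ.hom (θ.symm c))))
      (MinTensor.map _ _ (MinTensor.map _ _ (δ.hom (θ.symm c))))
    rw [MinTensor.map_map, MinTensor.map_map]
    convert h using 2
    · congr 1
      refine NonUnitalStarAlgHom.ext fun b => ?_
      change MinTensor.map _ _ (δ.hom (θ.symm (θ b))) = MinTensor.map _ _ (δ.hom b)
      rw [θ.symm_apply_apply]
    · congr 1
      refine NonUnitalStarAlgHom.ext fun b => ?_
      exact (MinTensor.map_id _).symm

theorem transport_apply (δ : Coaction G B) (θ : B ≃⋆ₐ[ℂ] C) (b : B) :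
    (δ.transport θ).hom (θ b) =
      MinTensor.map (θ : B →⋆ₙₐ[ℂ] C) (NonUnitalStarAlgHom.id ℂ (GroupCStar G)) (δ.hom b) := by
  change MinTensor.map _ _ (δ.hom (θ.symm (θ b))) = _
  rw [θ.symm_apply_apply]

theorem transport_apply_of_mem (δ : Coaction G B) (θ : B ≃⋆ₐ[ℂ] C) {s : G} {b : B}
    (hb : b ∈ δ.spectral s) :
    (δ.transport θ).hom (θ b) = MinTensor.tmul (θ b) (GroupCStar.of s) := by
  rw [transport_apply, hb, MinTensor.map_tmul]
  rfl

theorem isIso_transport (δ : Coaction G B) (θ : B ≃⋆ₐ[ℂ] C) : δ.IsIso (δ.transport θ) θ :=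
  fun b => (δ.transport_apply θ b).symm

/-! ### The isomorphism of a normal coaction with the dual coaction -/

section Reduced

variable [PartialOrder B] [StarOrderedRing B] {δ : Coaction G B}

theorem nonneg_universalRep_fourier_one (b : B) :
    0 ≤ universalRep B (δ.fourier 1 (star b * b)) := nonneg_of_inner fun k => by
  let ρ : CStarRep B := { space := UniversalSpace B, hom := universalRep B }
  exact ⟨_, sq_nonneg _, (inner_inducedRep_star_mul_self (δ := δ) ρ k 1 b).symm⟩

variable {ψ : ∀ s, δ.ModuleIso s}

/-- Each inequality needs faithfulness of the expectation on the side being estimated: for `B` it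
comes from normality, for the crossed product from the regular representation. -/
theorem norm_eq_of_mem_span_generatorPairs (hδ : δ.IsNormal) {hψ : IsMultiplicative ψ}
    {p : B × (partialAction hψ).ReducedCrossedProduct}
    (hp : p ∈ Submodule.span ℂ (generatorPairs hψ)) : ‖p.1‖ = ‖p.2‖ := by
  let E₁ : B →L[ℂ] (UniversalSpace B →L[ℂ] UniversalSpace B) :=
    (universalRep B).toCLM.comp (δ.fourier 1)
  have h1 : ∀ b, 0 ≤ E₁ (star b * b) := nonneg_universalRep_fourier_one
  have h2 : ∀ b, E₁ (star b * b) = 0 → b = 0 := fun b hb =>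
    eq_zero_of_fourier_one_star_mul_self hδ
      (universalRep_injective B (hb.trans (map_zero (universalRep B)).symm))
  have hE : ∀ p ∈ Submodule.span ℂ (generatorPairs hψ),
      ‖E₁ p.1‖ = ‖(partialAction hψ).expectation p.2‖ := fun p hp => by
    obtain ⟨a, ha, ha'⟩ := expectation_of_mem_span_generatorPairs hp
    rw [ha', norm_universalRep, ← norm_unitInclusion, ← ha]
    exact norm_universalRep B _
  refine le_antisymm ?_ ?_
  -- The bound on the second component is applied to the transposed graph.
  · refine norm_snd_le_norm_fst (p := p.swap) (Prod.swap ⁻¹' (Submodule.span ℂ (generatorPairs hψ) :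
      Set (B × (partialAction hψ).ReducedCrossedProduct)))
      (fun p hp q hq => mul_mem_span_generatorPairs hp hq)
      (fun p hp => star_mem_span_generatorPairs hp) ?_ (partialAction hψ).expectation
      PartialAction.expectation_star_mul_self_nonneg E₁ h1 h2
      (fun p hp => (hE p.swap hp).symm) hp
    refine (dense_fst_generatorPairs (hψ := hψ) hδ).mono ?_
    rintro _ ⟨q, hq, rfl⟩
    exact ⟨q.swap, hq, rfl⟩
  · exact norm_snd_le_norm_fst _ (fun p hp q hq => mul_mem_span_generatorPairs hp hq)
      (fun p hp => star_mem_span_generatorPairs hp) dense_snd_generatorPairs E₁ h1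
      (partialAction hψ).expectation PartialAction.expectation_star_mul_self_nonneg
      (fun b hb => PartialAction.eq_zero_of_expectation_star_mul_self hb) hE hp

theorem exists_starAlgEquiv_of_moduleIso (hδ : δ.IsNormal) (hψ : IsMultiplicative ψ) :
    ∃ θ : B ≃⋆ₐ[ℂ] (partialAction hψ).ReducedCrossedProduct,
      ∀ p ∈ generatorPairs hψ, θ p.1 = p.2 := by
  obtain ⟨θ, hθ⟩ := exists_starAlgEquiv_of_graph (Submodule.span ℂ (generatorPairs hψ))
    (fun p hp q hq => mul_mem_span_generatorPairs hp hq)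
    (fun p hp => star_mem_span_generatorPairs hp) (dense_fst_generatorPairs hδ)
    dense_snd_generatorPairs fun p hp => norm_eq_of_mem_span_generatorPairs hδ hp
  exact ⟨θ, fun p hp => hθ p (Submodule.subset_span hp)⟩

theorem isNormalizedDualCoaction_transport {hψ : IsMultiplicative ψ}
    {θ : B ≃⋆ₐ[ℂ] (partialAction hψ).ReducedCrossedProduct}
    (hθ : ∀ p ∈ generatorPairs hψ, θ p.1 = p.2) :
    (partialAction hψ).IsNormalizedDualCoaction (δ.transport θ) := by
  intro s a
  obtain ⟨x, hx⟩ := ModuleIso.exists_graph_right (ψ := ψ s) a.2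
  have h1 : θ x = (partialAction hψ).generator s a := hθ _ ⟨s, x, _, hx, rfl⟩
  rw [← h1]
  exact δ.transport_apply_of_mem θ hx.mem_left

theorem exists_partialAction_of_moduleIso (hδ : δ.IsNormal) (hψ : IsMultiplicative ψ) :
    ∃ (A : Type u) (_ : NonUnitalCStarAlgebra A) (_ : PartialOrder A) (_ : StarOrderedRing A)
      (P : PartialAction G A) (ε : Coaction G P.ReducedCrossedProduct),
      P.IsNormalizedDualCoaction ε ∧ ∃ θ : B ≃⋆ₐ[ℂ] P.ReducedCrossedProduct, δ.IsIso ε θ := by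
  obtain ⟨θ, hθ⟩ := exists_starAlgEquiv_of_moduleIso hδ hψ
  exact ⟨δ.UnitFiber, _, _, _, partialAction hψ,
    δ.transport θ, isNormalizedDualCoaction_transport hθ, θ, δ.isIso_transport θ⟩

end Reduced

end Coaction

end

/-! ### The module isomorphisms of a reduced crossed product -/

noncomputable section

namespace PartialAction

variable {G A : Type u} [Group G] [NonUnitalCStarAlgebra A] [PartialOrder A] [StarOrderedRing A]
  {P : PartialAction G A} {s t r : G}

variable (P s) in
/-- The map `a ↦ a m_s`. -/
def generatorₗᵢ : P.D s →ₗᵢ[ℂ] P.ReducedCrossedProduct where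
  toFun := P.generator s
  map_add' := generator_add s
  map_smul' := generator_smul s
  norm_map' := norm_generator s

theorem isClosed_range_generator (s : G) :
    IsClosed (LinearMap.range (generatorₗᵢ P s).toLinearMap : Set P.ReducedCrossedProduct) := by
  have : CompleteSpace (P.D s) := (P.isClosed_D s).completeSpace_coe
  have h := (generatorₗᵢ P s).isometry.isClosedEmbedding.isClosed_range
  exact h

theorem generator_mul_generator_one {a : A} (ha : a ∈ P.D s) {b c d : A} (hb : b ∈ P.D 1)
    (h : P.Rel s c a) (h' : P.Rel s (c * b) d) :
    P.generator s ⟨a, ha⟩ * P.generator 1 ⟨b, hb⟩ = P.generator s ⟨d, h'.mem_right⟩ :=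
  (h.generator_mul h' hb).trans (generator_congr (mul_one s) _ _ _)

theorem generator_one_mul_generator {a b : A} (ha : a ∈ P.D 1) (hb : b ∈ P.D s) :
    P.generator 1 ⟨a, ha⟩ * P.generator s ⟨b, hb⟩ =
      P.generator s ⟨a * b, P.mul_mem_left s a b hb⟩ :=
  ((rel_one a).generator_mul (rel_one (a * b)) hb).trans (generator_congr (one_mul s) _ _ _)

theorem generator_mul_star_generator {a b : A} (ha : a ∈ P.D s) (hb : b ∈ P.D s) :
    P.generator s ⟨a, ha⟩ * star (P.generator s ⟨b, hb⟩) =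
      P.generator 1 ⟨a * star b, mem_D_one _⟩ := by
  obtain ⟨a', ha'⟩ := exists_rel_right ha
  obtain ⟨b', hb'⟩ := exists_rel_right hb
  rw [hb'.star_generator, ha'.generator_mul (ha'.mul hb'.star) (star_mem hb'.mem_left)]
  exact generator_congr (mul_inv_cancel s) _ _ _

/-- The Fourier coefficient at `s` fixes the spectral subspace and sends every generator into the
set of all `a m_s`. That set is closed because `a ↦ a m_s` is isometric, and the generators are
total. -/
theorem mem_spectral_iff_exists_generator {ε : Coaction G P.ReducedCrossedProduct}
    (hε : P.IsNormalizedDualCoaction ε) {z : P.ReducedCrossedProduct} :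
    z ∈ ε.spectral s ↔ ∃ a, z = P.generator s a := by
  classical
  refine ⟨fun hz => ?_, ?_⟩
  · have h1 := Submodule.topologicalClosure_minimal _
      (t := (LinearMap.range (generatorₗᵢ P s).toLinearMap).comap (ε.fourier s).toLinearMap)
      (Submodule.span_le.mpr (by
        rintro _ ⟨r, a, rfl⟩
        change ε.fourier s (P.generator r a) ∈ LinearMap.range (generatorₗᵢ P s).toLinearMap
        rw [ε.fourier_of_mem (hε r a)]
        split_ifs with h
        · subst h
          exact ⟨a, rfl⟩
        · exact zero_mem _))
      ((isClosed_range_generator s).preimage (ε.fourier s).continuous)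
      (mem_closure_span_generator z)
    obtain ⟨a, ha⟩ := h1
    refine ⟨a, ?_⟩
    have h2 := (ε.fourier_of_mem (s := s) hz).trans (if_pos rfl)
    exact h2.symm.trans ha.symm
  · rintro ⟨a, rfl⟩
    exact hε s a

end PartialAction

namespace Coaction

open PartialAction

variable {G B : Type u} [Group G] [NonUnitalCStarAlgebra B]

theorem IsIso.mem_spectral_iff {C : Type u} [NonUnitalCStarAlgebra C] {δ : Coaction G B}
    {ε : Coaction G C} {θ : B ≃⋆ₐ[ℂ] C} (h : δ.IsIso ε θ) {s : G} {b : B} :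
    b ∈ δ.spectral s ↔ θ b ∈ ε.spectral s := by
  have h1 : MinTensor.map (θ : B →⋆ₙₐ[ℂ] C) (NonUnitalStarAlgHom.id ℂ (GroupCStar G))
      (MinTensor.tmul b (GroupCStar.of s)) = MinTensor.tmul (θ b) (GroupCStar.of s) :=
    MinTensor.map_tmul _ _ _ _
  rw [δ.mem_spectral, ε.mem_spectral, ← h b, ← h1]
  exact ⟨fun h => by rw [h], fun h =>
    Function.LeftInverse.injective (MinTensor.map_starAlgEquiv_symm_apply θ) h⟩

variable {A : Type u} [NonUnitalCStarAlgebra A] [PartialOrder A] [StarOrderedRing A]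
  {P : PartialAction G A} {δ : Coaction G B} {ε : Coaction G P.ReducedCrossedProduct}
  {θ : B ≃⋆ₐ[ℂ] P.ReducedCrossedProduct} {s t : G}

theorem IsIso.exists_generator (hθ : δ.IsIso ε θ) (hε : P.IsNormalizedDualCoaction ε) {b : B}
    (hb : b ∈ δ.spectral s) : ∃ a, θ b = P.generator s a :=
  (mem_spectral_iff_exists_generator hε).mp (hθ.mem_spectral_iff.mp hb)

theorem IsIso.symm_generator_mem (hθ : δ.IsIso ε θ) (hε : P.IsNormalizedDualCoaction ε)
    (a : P.D s) : θ.symm (P.generator s a) ∈ δ.spectral s := by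
  rw [hθ.mem_spectral_iff, θ.apply_symm_apply]
  exact hε s a

theorem IsIso.exists_generator_one (hθ : δ.IsIso ε θ) (hε : P.IsNormalizedDualCoaction ε) {b : B}
    (hb : b ∈ δ.rangeIdeal s) : ∃ a : P.D s, θ b = P.generator 1 ⟨a, mem_D_one _⟩ := by
  have hc : IsClosed {b : B | ∃ a : P.D s, θ b = P.generator 1 ⟨a, mem_D_one _⟩} := by
    have h1 : {b : B | ∃ a : P.D s, θ b = P.generator 1 ⟨a, mem_D_one _⟩} =
        θ ⁻¹' (generatorₗᵢ P 1 '' {a | (a : A) ∈ P.D s}) := by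
      ext b
      constructor
      · rintro ⟨a, ha⟩
        exact ⟨⟨a, mem_D_one _⟩, a.2, ha.symm⟩
      · rintro ⟨a, ha, ha'⟩
        exact ⟨⟨a, ha⟩, ha'.symm⟩
    rw [h1]
    have : CompleteSpace (P.D 1) := (P.isClosed_D 1).completeSpace_coe
    refine IsClosed.preimage (θ : B →⋆ₙₐ[ℂ] P.ReducedCrossedProduct).continuous_of_cstar ?_
    exact (generatorₗᵢ P 1).isometry.isClosedEmbedding.isClosedMap _
      ((P.isClosed_D s).preimage continuous_subtype_val)
  -- Since `(a m_s)(b m_s)⋆ = a b⋆ m_e`, the preimage of the elements `a m_e` with `a ∈ I_s` is a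
  -- closed subspace containing the generators of `D_s`.
  let W : Submodule ℂ B :=
    { carrier := {b : B | ∃ a : P.D s, θ b = P.generator 1 ⟨a, mem_D_one _⟩}
      zero_mem' := ⟨0, by rw [map_zero]; exact (map_zero (generatorₗᵢ P 1)).symm⟩
      add_mem' := by
        rintro x y ⟨a, ha⟩ ⟨b, hb⟩
        exact ⟨a + b, by rw [map_add, ha, hb, ← generator_add]; rfl⟩
      smul_mem' := by
        rintro k x ⟨a, ha⟩
        exact ⟨k • a, by rw [map_smul, ha, ← generator_smul]; rfl⟩ }
  refine rangeIdeal_le_of_forall (W := W) hc (fun x hx y hy => ?_) hb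
  obtain ⟨a, ha⟩ := hθ.exists_generator hε hx
  obtain ⟨b, hb⟩ := hθ.exists_generator hε hy
  refine ⟨⟨a * star (b : A), mul_mem a.2 (star_mem b.2)⟩, ?_⟩
  rw [map_mul, map_star, ha, hb]
  exact generator_mul_star_generator a.2 b.2

/-- An approximate unit of the ideal reduces to products, where `a e m_e = (a m_s)(e⋆ m_s)⋆`. -/
theorem IsIso.symm_generator_one_mem (hθ : δ.IsIso ε θ) (hε : P.IsNormalizedDualCoaction ε)
    (a : P.D s) : θ.symm (P.generator 1 ⟨a, mem_D_one _⟩) ∈ δ.rangeIdeal s := by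
  have hcont : Continuous fun a : A => θ.symm (P.generator 1 ⟨a, mem_D_one _⟩) :=
    (θ.symm : P.ReducedCrossedProduct →⋆ₙₐ[ℂ] B).continuous_of_cstar.comp
      ((generatorₗᵢ P 1).continuous.comp (continuous_id.subtype_mk _))
  refine mem_of_mul_mem_of_star_mul_self_mem (P.D s) (P.isClosed_D s) (x := (a : A))
    (S := {a : A | θ.symm (P.generator 1 ⟨a, mem_D_one _⟩) ∈ δ.rangeIdeal s})
    (mul_mem (star_mem a.2) a.2) ((isClosed_rangeIdeal s).preimage hcont) fun e he => ?_
  have h1 := generator_mul_star_generator a.2 (star_mem he)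
  have h2 := mul_star_mem_rangeIdeal (hθ.symm_generator_mem hε a)
    (hθ.symm_generator_mem hε ⟨star e, star_mem he⟩)
  rw [← map_star, ← map_mul, h1] at h2
  simp only [star_star] at h2
  exact h2

/-- Removing the symbol `m_s`, that is `a m_s ↦ a m_e`, preserves left multiplication by `B_e`, and
both sides have the inner product `a b⋆ m_e`. -/
theorem IsIso.exists_moduleIso (hθ : δ.IsIso ε θ) (hε : P.IsNormalizedDualCoaction ε) (s : G) :
    ∃ ψ : δ.ModuleIso s, ∀ (a : P.D s) (hx : θ.symm (P.generator s a) ∈ δ.spectral s),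
      (ψ.equiv ⟨θ.symm (P.generator s a), hx⟩ : B) = θ.symm (P.generator 1 ⟨a, mem_D_one _⟩) := by
  choose f hf using fun x : δ.spectral s => hθ.exists_generator hε x.2
  choose g hg using fun x : δ.rangeIdeal s => hθ.exists_generator_one hε x.2
  have hθinj : ∀ {b c : B}, θ b = θ c → b = c := fun {b c} h => by
    rw [← θ.symm_apply_apply b, h, θ.symm_apply_apply]
  have hinj : ∀ r, Function.Injective (P.generator r) := fun r => (generatorₗᵢ P r).injective
  have hinj1 : ∀ {a b : P.D s}, P.generator 1 ⟨a, mem_D_one _⟩ = P.generator 1 ⟨b, mem_D_one _⟩ →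
      a = b := fun h => Subtype.ext (Subtype.mk.inj (hinj 1 h))
  have hf' : ∀ a hx, f ⟨θ.symm (P.generator s a), hx⟩ = a := fun a hx => hinj s (by
    rw [← hf, θ.apply_symm_apply])
  have hg' : ∀ (a : P.D s) hx, g ⟨θ.symm (P.generator 1 ⟨a, mem_D_one _⟩), hx⟩ = a := fun a hx => hinj1 (by
    rw [← hg, θ.apply_symm_apply])
  have hfadd : ∀ x y, f (x + y) = f x + f y := fun x y => hinj s (by
    rw [generator_add, ← hf, ← hf, ← hf, ← map_add]; rfl)
  have hfsmul : ∀ (k : ℂ) x, f (k • x) = k • f x := fun k x => hinj s (by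
    rw [generator_smul, ← hf, ← hf, ← map_smul]; rfl)
  let e : δ.spectral s ≃ₗ[ℂ] δ.rangeIdeal s :=
    { toFun := fun x => ⟨θ.symm (P.generator 1 ⟨f x, mem_D_one _⟩),
        hθ.symm_generator_one_mem hε (f x)⟩
      map_add' := fun x y => Subtype.ext (hθinj (by
        change θ (θ.symm _) = θ (θ.symm _ + θ.symm _)
        rw [map_add, θ.apply_symm_apply, θ.apply_symm_apply, θ.apply_symm_apply,
          ← generator_add]
        exact congrArg _ (Subtype.ext (congrArg (Subtype.val : P.D s → A) (hfadd x y)))))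
      map_smul' := fun k x => Subtype.ext (hθinj (by
        change θ (θ.symm _) = θ (k • θ.symm _)
        rw [map_smul, θ.apply_symm_apply, θ.apply_symm_apply, ← generator_smul]
        exact congrArg _ (Subtype.ext (congrArg (Subtype.val : P.D s → A) (hfsmul k x)))))
      invFun := fun d => ⟨θ.symm (P.generator s (g d)), hθ.symm_generator_mem hε (g d)⟩
      left_inv := fun x => Subtype.ext (hθinj (by
        change θ (θ.symm (P.generator s (g _))) = θ x
        rw [θ.apply_symm_apply, hg', hf]))
      right_inv := fun d => Subtype.ext (hθinj (by
        change θ (θ.symm (P.generator 1 ⟨f _, _⟩)) = θ d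
        rw [θ.apply_symm_apply, hg]
        exact congrArg _ (Subtype.ext (congrArg (Subtype.val : P.D s → A) (hf' _ _))))) }
  have he : ∀ x, θ (e x : B) = P.generator 1 ⟨f x, mem_D_one _⟩ := fun x => θ.apply_symm_apply _
  refine ⟨⟨e, fun d x => hθinj ?_, fun x y => hθinj ?_⟩, fun a hx => hθinj ?_⟩
  · rw [map_mul, he, he, hg, generator_one_mul_generator]
    refine congrArg _ (Subtype.ext ?_)
    have h1 : f ⟨(d : B) * x, δ.rangeIdeal_mul_mem d.2 x.2⟩ =
        ⟨(g d : A) * f x, P.mul_mem_left s _ _ (f x).2⟩ := hinj s (by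
      rw [← hf, map_mul, hg, hf]
      exact generator_one_mul_generator _ _)
    exact congrArg (Subtype.val : P.D s → A) h1
  · rw [map_mul, map_mul, map_star, map_star, he, he, hf, hf, generator_mul_star_generator,
      ← generator_mul_star_generator (f x).2 (f y).2]
  · rw [he, θ.apply_symm_apply]
    exact congrArg _ (Subtype.ext (congrArg (Subtype.val : P.D s → A) (hf' a hx)))

/-- The products `a m_s b m_t` and `a m_s b m_e` have the same coefficient `d = α_s(α_{s⁻¹}(a) b)`,
over `st` and over `s` respectively, so the two sides of the identity are both `d m_e`. -/
theorem IsIso.exists_isMultiplicative (hθ : δ.IsIso ε θ) (hε : P.IsNormalizedDualCoaction ε) :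
    ∃ ψ : ∀ s, δ.ModuleIso s, IsMultiplicative ψ := by
  choose ψ hψ using fun s => hθ.exists_moduleIso hε s
  refine ⟨ψ, fun s t x y => ?_⟩
  obtain ⟨x, hx⟩ := x
  obtain ⟨y, hy⟩ := y
  obtain ⟨a, ha⟩ := hθ.exists_generator hε hx
  obtain ⟨b, hb⟩ := hθ.exists_generator hε hy
  obtain rfl : x = θ.symm (P.generator s a) := by rw [← ha, θ.symm_apply_apply]
  obtain rfl : y = θ.symm (P.generator t b) := by rw [← hb, θ.symm_apply_apply]
  obtain ⟨c, hc⟩ := exists_rel_right a.2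
  obtain ⟨d, hd⟩ := exists_rel_left (P.mul_mem_right s⁻¹ (b : A) c hc.mem_left)
  have h1 : θ.symm (P.generator s a) * θ.symm (P.generator t b) =
      θ.symm (P.generator (s * t) ⟨d, hd.mul_mem b.2⟩) := by
    rw [← map_mul]
    exact congrArg _ (hc.generator_mul hd b.2)
  have h2 : θ.symm (P.generator s a) * θ.symm (P.generator 1 ⟨b, mem_D_one _⟩) =
      θ.symm (P.generator s ⟨d, hd.mem_right⟩) := by
    rw [← map_mul]
    exact congrArg _ (generator_mul_generator_one a.2 _ hc hd)
  simp only [hψ, h1, h2]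

end Coaction

end

/-! ### The equivalence of the three conditions -/

theorem mainTheorem1 {G B : Type u} [Group G] [NonUnitalCStarAlgebra B] [PartialOrder B]
    [StarOrderedRing B] (δ : Coaction G B) (hδ : δ.IsNormal) :
    List.TFAE [
      ∃ (A : Type u) (_ : NonUnitalCStarAlgebra A) (_ : PartialOrder A) (_ : StarOrderedRing A)
        (P : PartialAction G A) (ε : Coaction G P.ReducedCrossedProduct),
        P.IsNormalizedDualCoaction ε ∧ ∃ θ : B ≃⋆ₐ[ℂ] P.ReducedCrossedProduct, δ.IsIso ε θ,
      ∃ m : G → (UniversalSpace B →L[ℂ] UniversalSpace B), IsPartialRepresentation m ∧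
        ∀ s, m s ∈ δ.multiplierBimodule s ∧ m s * star (m s) = δ.proj s,
      ∃ ψ : ∀ s, δ.ModuleIso s, ∀ (s t : G) (x : δ.spectral s) (y : δ.spectral t),
        ((ψ (s * t)).equiv ⟨(x : B) * y, δ.mul_mem_spectral x.2 y.2⟩ : B) =
          (ψ s).equiv ⟨(x : B) * ((ψ t).equiv y : B),
            δ.mul_rangeIdeal_mem x.2 ((ψ t).equiv y).2⟩] := by
  tfae_have 2 → 3 := fun ⟨_, hm, hm'⟩ => Coaction.exists_moduleIso_of_partialRepresentation hm hm'
  tfae_have 3 → 2 := fun ⟨ψ, hψ⟩ => Coaction.exists_partialRepresentation_of_moduleIso hδ ψ hψ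
  tfae_have 3 → 1 := fun ⟨_, hψ⟩ => Coaction.exists_partialAction_of_moduleIso hδ hψ
  tfae_have 1 → 3 := by
    rintro ⟨A, _, _, _, P, ε, hε, θ, hθ⟩
    exact hθ.exists_isMultiplicative hε
  tfae_finish
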